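/- All models are over purely relational vocabularies and have nonempty domains. Let $\tau$ be a finite relational vocabulary with a fixed ordering $R_1,\dots,R_p$ of its symbols. Teams and $\mathrm{D}^*$. A team with codomain $A$ is a set $U$ of assignments $s:X\to A$ with a common finite set $X$ of variables as domain. For $f:U\to\mathcal P(T)$ let $U[f/x]=\{s[a/x] : s\in U,\ a\in f(s)\}$, and let $U[T/x]$ be the case of constant $f=T$. Formulas of $\mathrm{D}^*$ are built from the literals $x=y$, $\neg x=y$, $R(\bar x)$, $\neg R(\bar x)$, dependence atoms $=\!(x_1,\dots,x_k)$, inclusion atoms $\bar x\subseteq\bar y$, exclusion atoms $\bar x\,|\,\bar y$ and (conditional or unconditional) independence atoms $\bar x\perp_{\bar z}\bar y$, $\bar x\perp\bar y$ by means of $\wedge,\vee,\exists x,\forall x$ and $\mathrm{I}x$, where $\mathrm Ix$ binds $x$. They are evaluated by lax team semantics, where $\mathfrak A,U\models\exists x\,\varphi$ iff $\mathfrak A,U[f/x]\models\varphi$ for some $f:U\to\mathcal P(A)\setminus\{\emptyset\}$, and where $\mathfrak A,U\models \mathrm Ix\,\varphi$ iff there is a finite nonempty set $S$ with $S\cap A=\emptyset$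 such that $\mathfrak A+S,\,U[S/x]\models\varphi$; here $\mathfrak A+S$ has domain $A\cup S$ and the same relations as $\mathfrak A$. For a sentence, $\mathfrak A\models\varphi$ means $\mathfrak A,\{\emptyset\}\models\varphi$. $\mathcal L_{RE}$. A $\tau$-sentence of $\mathcal L_{RE}$ has the form $\mathrm IY\,\exists X_1\dots\exists X_k\,\psi$, where $Y\notin\tau$ is a unary relation variable, $X_1,\dots,X_k$ are further relation variables, and $\psi$ is a first-order sentence over $\tau\cup\{Y,X_1,\dots,X_k\}$. It is true in $\mathfrak A$ iff there is a finite nonempty set $S$ with $S\cap A=\emptyset$ such that $\exists X_1\dots\exists X_k\,\psi$ is true in the expansion of $\mathfrak A+S$ by $Y:=S$. Recursive enumerability. For a finite $\tau$-model $\mathfrak A$ and a linear order $<$ of $A$, the encoding of $(\mathfrak A,<)$ is the binary string $0^{|A|}\,1\,\mathrm{enc}(R_1^{\mathfrak A})\cdots\mathrm{enc}(R_p^{\mathfrak A})$, where for $k$-ary $R$ the string $\mathrm{enc}(R^{\mathfrak A})$ has length $|A|^k$ and its $i$-th bit is $1$ iff the $i$-th tuple of $A^k$ in the lexicographic order is in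 $R^{\mathfrak A}$. A class $\mathcal C$ of finite $\tau$-models is recursively enumerable if the set of all encodings of all models in $\mathcal C$, with respect to all linear orders of their domains, is a recursively enumerable set of binary strings. Theorem. 1. For every $\mathrm D^*$-sentence $\varphi$ over $\tau$, the class of finite $\tau$-models $\mathfrak A$ with $\mathfrak A\models\varphi$ is recursively enumerable, and there is an $\mathcal L_{RE}$-sentence $\chi$ over $\tau$ such that $\mathfrak A\models\varphi\iff\mathfrak A\models\chi$ for all finite $\tau$-models $\mathfrak A$. 2. $\mathrm D^*$ captures RE: a class $\mathcal C$ of finite $\tau$-models is closed under isomorphism and recursively enumerable if and only if there is a $\mathrm D^*$-sentence $\varphi$ over $\tau$ such that, for all finite $\tau$-models $\mathfrak A$, $\mathfrak A\in\mathcal C\iff\mathfrak A\models\varphi$. -/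

import Mathlib

open scoped FirstOrder

universe u v w

namespace TeamRE

/-! ### Finite models, bloatings -/

/-- A finite model of a vocabulary: a finite nonempty domain with an interpretation. -/
structure FinModel (L : FirstOrder.Language.{u, v}) where
  carrier : Type w
  str : L.Structure carrier
  fin : Finite carrier
  nonempty : Nonempty carrier

/-- Two finite models are isomorphic. -/
def FinModel.Iso {L : FirstOrder.Language.{u, v}} (M N : FinModel.{u, v, w} L) : Prop :=
  letI := M.str
  letI := N.str
  Nonempty (M.carrier ≃[L] N.carrier)

/-- The class `C` is closed under isomorphism. -/
def IsoClosed {L : FirstOrder.Language.{u, v}} (C : Set (FinModel.{u, v, w} L)) : Prop :=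
  ∀ M N : FinModel.{u, v, w} L, M.Iso N → M ∈ C → N ∈ C

/-- The bloating `𝔄 + S`: the domain is the disjoint union of `A` and `S`, and every relation
is interpreted by exactly the same tuples (all of them from `A`) as in `𝔄`. -/
@[reducible] def bloat {L : FirstOrder.Language.{u, v}} [L.IsRelational] {A : Type w} (I : L.Structure A) (S : Type) :
    L.Structure (A ⊕ S) where
  funMap := fun {_} f _ => isEmptyElim f
  RelMap := fun {n} R v => ∃ a : Fin n → A, v = Sum.inl ∘ a ∧ I.RelMap R a

/-! ### Teams

An assignment is a partial function from the variables (natural numbers) to the domain; `none`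
means that the variable is not in the domain of the assignment. -/

/-- Assignments with values in `A`. -/
abbrev Assignment (A : Type w) : Type w := ℕ → Option A

/-- Teams with codomain `A`. -/
abbrev Team (A : Type w) : Type w := Set (Assignment A)

/-- The empty assignment. -/
def emptyAssignment (A : Type w) : Assignment A := fun _ => none

/-- `s[a/x]`. -/
def Assignment.set {A : Type w} (s : Assignment A) (a : A) (x : ℕ) : Assignment A :=
  Function.update s x (some a)

/-- `U[f/x]`, the set of all `s[a/x]` with `s ∈ U` and `a ∈ f s`. For constant `f` with value
`T` this is `U[T/x]`. -/
def Team.modify {A : Type w} (U : Team A) (f : Assignment A → Set A) (x : ℕ) : Team A :=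
  {t | ∃ s ∈ U, ∃ a ∈ f s, t = s.set a x}

/-- `Rel(U, (x₁, …, xₖ))`. -/
def Team.Rel {A : Type w} (U : Team A) {k : ℕ} (x : Fin k → ℕ) : Set (Fin k → A) :=
  {a | ∃ s ∈ U, ∀ i, s (x i) = some (a i)}

/-- The team `U`, regarded as a team with the larger codomain `A ∪ S`. -/
def Team.lift {A : Type w} (U : Team A) (S : Type) : Team (A ⊕ S) :=
  (fun (s : Assignment A) (x : ℕ) => (s x).map Sum.inl) '' U

/-! ### The logic `D*` -/

/-- Formulas of `D*` (in negation normal form) over the relational vocabulary `L`. Tuples in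
dependence, inclusion, exclusion and independence atoms are nonempty; only the tuple `z` of an
independence atom `x ⊥_z y` may be empty, which gives the atom `x ⊥ y`. -/
inductive DStar (L : FirstOrder.Language.{u, v}) : Type v where
  | eq (x y : ℕ) : DStar L
  | neq (x y : ℕ) : DStar L
  | rel {n : ℕ} (R : L.Relations n) (x : Fin n → ℕ) : DStar L
  | nrel {n : ℕ} (R : L.Relations n) (x : Fin n → ℕ) : DStar L
  | dep {k : ℕ} (x : Fin (k + 1) → ℕ) : DStar L
  | incl {k : ℕ} (x y : Fin (k + 1) → ℕ) : DStar L
  | excl {k : ℕ} (x y : Fin (k + 1) → ℕ) : DStar L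
  | indep {k m n : ℕ} (x : Fin (k + 1) → ℕ) (z : Fin m → ℕ) (y : Fin (n + 1) → ℕ) : DStar L
  | and (φ ψ : DStar L) : DStar L
  | or (φ ψ : DStar L) : DStar L
  | all (x : ℕ) (φ : DStar L) : DStar L
  | ex (x : ℕ) (φ : DStar L) : DStar L
  | ix (x : ℕ) (φ : DStar L) : DStar L

namespace DStar

/-- The free variables; `∀ x`, `∃ x` and `Ix` bind `x`. -/
def freeVars {L : FirstOrder.Language.{u, v}} : DStar L → Set ℕ
  | eq x y => {x, y}
  | neq x y => {x, y}
  | rel _ x => Set.range x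
  | nrel _ x => Set.range x
  | dep x => Set.range x
  | incl x y => Set.range x ∪ Set.range y
  | excl x y => Set.range x ∪ Set.range y
  | indep x z y => Set.range x ∪ Set.range z ∪ Set.range y
  | and φ ψ => φ.freeVars ∪ ψ.freeVars
  | or φ ψ => φ.freeVars ∪ ψ.freeVars
  | all x φ => φ.freeVars \ {x}
  | ex x φ => φ.freeVars \ {x}
  | ix x φ => φ.freeVars \ {x}

/-- A sentence is a formula without free variables. -/
def IsSentence {L : FirstOrder.Language.{u, v}} (φ : DStar L) : Prop := φ.freeVars = ∅

/-- Lax team semantics. In the clause for `ix`, the finite nonempty set of fresh points is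
taken to be `Fin (n + 1)`, which represents all such sets up to bijection. -/
def Sat {L : FirstOrder.Language.{u, v}} [L.IsRelational] :
    DStar L → (A : Type w) → L.Structure A → Team A → Prop
  | eq x y, A, _, U => ∀ s ∈ U, ∃ a b : A, s x = some a ∧ s y = some b ∧ a = b
  | neq x y, A, _, U => ∀ s ∈ U, ∃ a b : A, s x = some a ∧ s y = some b ∧ a ≠ b
  | rel (n := n) R x, A, I, U =>
      ∀ s ∈ U, ∃ a : Fin n → A, (∀ i, s (x i) = some (a i)) ∧ I.RelMap R a
  | nrel (n := n) R x, A, I, U =>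
      ∀ s ∈ U, ∃ a : Fin n → A, (∀ i, s (x i) = some (a i)) ∧ ¬ I.RelMap R a
  | dep (k := k) x, _, _, U =>
      ∀ a ∈ U.Rel x, ∀ b ∈ U.Rel x,
        (∀ i : Fin k, a i.castSucc = b i.castSucc) → a (Fin.last k) = b (Fin.last k)
  | incl x y, _, _, U => U.Rel x ⊆ U.Rel y
  | excl x y, _, _, U => U.Rel x ∩ U.Rel y = ∅
  | indep x z y, _, _, U =>
      ∀ s ∈ U, ∀ s' ∈ U, ∃ t ∈ U, (∀ i, s (z i) = s' (z i)) →
        (∀ i, t (x i) = s (x i)) ∧ (∀ i, t (z i) = s (z i)) ∧ (∀ i, t (y i) = s' (y i))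
  | and φ ψ, A, I, U => φ.Sat A I U ∧ ψ.Sat A I U
  | or φ ψ, A, I, U => ∃ U₀ U₁ : Team A, U₀ ∪ U₁ = U ∧ φ.Sat A I U₀ ∧ ψ.Sat A I U₁
  | all x φ, A, I, U => φ.Sat A I (U.modify (fun _ => Set.univ) x)
  | ex x φ, A, I, U =>
      ∃ f : Assignment A → Set A, (∀ s ∈ U, (f s).Nonempty) ∧ φ.Sat A I (U.modify f x)
  | ix x φ, A, I, U =>
      ∃ n : ℕ, φ.Sat (A ⊕ Fin (n + 1)) (bloat I (Fin (n + 1)))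
        ((U.lift (Fin (n + 1))).modify (fun _ => Set.range Sum.inr) x)

/-- `𝔄 ⊨ φ` for a sentence `φ`: satisfaction by the team that consists of the empty
assignment. -/
def Holds {L : FirstOrder.Language.{u, v}} [L.IsRelational] (φ : DStar L) (M : FinModel.{u, v, w} L) :
    Prop :=
  φ.Sat M.carrier M.str {emptyAssignment M.carrier}

end DStar

/-! ### Existential second-order logic and `L_RE` -/

/-- The relational vocabulary that has one symbol of arity `ar i` for each `i < k`. -/
def relVocabulary {k : ℕ} (ar : Fin k → ℕ) : FirstOrder.Language.{0, 0} where
  Functions := fun _ => Empty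
  Relations := fun n => {i : Fin k // ar i = n}

/-- Sentences `∃ X₁ … ∃ Xₖ ψ` of existential second-order logic over `L`, where `ψ` is a
first-order sentence over `L` with the additional relation symbols `X₁, …, Xₖ`. -/
structure ESO (L : FirstOrder.Language.{u, v}) where
  numVars : ℕ
  arity : Fin numVars → ℕ
  body : (L.sum (relVocabulary arity)).Sentence

/-- Truth of an existential second-order sentence in a structure. -/
def ESO.Holds {L : FirstOrder.Language.{u, v}} (φ : ESO L) (A : Type w) (I : L.Structure A) : Prop :=
  ∃ J : (relVocabulary φ.arity).Structure A,
    letI := I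
    letI := J
    A ⊨ φ.body

/-- The vocabulary that has a single unary relation symbol `Y`. -/
abbrev vocabularyY : FirstOrder.Language.{0, 0} := relVocabulary (fun _ : Fin 1 => 1)

/-- The interpretation of the symbol `Y` in `A ∪ S` by the set `S`. -/
@[reducible] def freshY (A : Type w) (S : Type) :
    vocabularyY.Structure (A ⊕ S) where
  funMap := fun {_} f _ => Empty.elim f
  RelMap := fun {_} R v => v (Fin.cast R.2 0) ∈ Set.range (Sum.inr : S → A ⊕ S)

/-- Sentences `IY ψ` of the logic `L_RE` over `L`, where `ψ` is an existential second-order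
sentence over `L` with the additional unary symbol `Y`. -/
structure LRE (L : FirstOrder.Language.{u, v}) where
  body : ESO (L.sum vocabularyY)

/-- `𝔄 ⊨ IY ψ`: there is a finite nonempty set `S` (up to bijection, `Fin (n + 1)`) such that
`𝔄 + S`, with `Y` interpreted by `S`, satisfies `ψ`. -/
def LRE.Holds {L : FirstOrder.Language.{u, v}} [L.IsRelational] (χ : LRE L) (M : FinModel.{u, v, w} L) :
    Prop :=
  ∃ n : ℕ,
    letI := bloat M.str (Fin (n + 1))
    letI := freshY M.carrier (Fin (n + 1))
    χ.body.Holds (M.carrier ⊕ Fin (n + 1)) (L.sumStructure vocabularyY _)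

/-! ### Encodings and recursive enumerability -/

/-- All `k`-tuples over `{0, …, n - 1}`, in lexicographic order. -/
def lexTuples (n : ℕ) : (k : ℕ) → List (Fin k → Fin n)
  | 0 => [Fin.elim0]
  | k + 1 => (List.finRange n).flatMap fun a => (lexTuples n k).map fun t => Fin.cons a t

open Classical in
/-- The binary encoding `0^|A| 1 enc(R₁) … enc(Rₚ)` of the structure `I` on `A`, where `e`
enumerates the relation symbols and `o` enumerates `A` in increasing order with respect to
a linear order of `A`. -/
noncomputable def encoding {L : FirstOrder.Language.{u, v}} {p : ℕ} (e : Fin p ≃ Σ k, L.Relations k)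
    {A : Type w} (I : L.Structure A) {n : ℕ} (o : Fin n ≃ A) : List Bool :=
  List.replicate n false ++ [true] ++
    (List.finRange p).flatMap fun i =>
      (lexTuples n (e i).1).map fun t => decide (I.RelMap (e i).2 (o ∘ t))

/-- The class `C` of finite models is recursively enumerable: the set of all encodings of models
in `C` (with respect to all linear orders of their domains) is a recursively enumerable set of
binary strings. -/
def RecEnum {L : FirstOrder.Language.{u, v}} {p : ℕ} (e : Fin p ≃ Σ k, L.Relations k)
    (C : Set (FinModel.{u, v, w} L)) : Prop :=
  REPred fun b : List Bool =>
    ∃ M ∈ C, ∃ (n : ℕ) (o : Fin n ≃ M.carrier), b = encoding e M.str o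

end TeamRE

namespace TeamRE

/-! ### Codes of primitive recursive functions -/

/-! Everything passes through a third formalism: a quantifier-free formula with function variables,
universally closed and evaluated in a model enlarged by finitely many fresh points (`QF.Defines`).

From enumerability to such a formula (`exists_defines`): membership in a recursively enumerable
class means that some `w` stands in a primitive recursive relation to an encoding of the model.
Under a linear order, the enlarged domain is an initial segment of the natural numbers with the old
points first, so the table of the relations and the witness `w` can be coded by single points. The
axioms describe the functions for all subcodes of finitely many primitive recursive codes. A finite
segment cannot hold total functions, so one point `top` marks overflow, and values equal to `top`
are hardly constrained. All other values are correct in every interpretation satisfying the axioms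
(`PR.AllOk.eval_eq_rank`), and with enough fresh points the relevant computations fit
(`PR.eventually_good`, `canon_allOk`); together this is `QF.defines_axioms`. Membership is known
only through encodings, so closure under isomorphism leads back to the given model
(`iso_of_encoding_eq`).

From such a formula to the logics: `L_RE` quantifies over the graphs of the functions
(`QF.exists_lre`). In `D*`, a universal block produces all argument tuples, an existential block
holds the values of applications, dependence atoms make these values functional, and inclusion atoms
force different applications of one symbol to use the same function (`QF.exists_dstar`).

Conversely, models and teams over finite domains are coded by lists of numbers, and satisfaction is
a projection of a primitive recursive relation, by induction on the formula: disjunction, `∃` and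
`I` become guesses of a code (`exists_describes`). The relation sees only the codes, which gives
both enumerability and closure under isomorphism. The `L_RE`-sentence for a `D*`-sentence arises by
composing these results, without a translation connective by connective. -/

/-- Codes of primitive recursive functions of `n` arguments. -/
inductive PR : ℕ → Type
  | zero : PR 0
  | succ : PR 1
  | get {n : ℕ} (i : Fin n) : PR n
  | comp {m n : ℕ} (f : PR m) (g : Fin m → PR n) : PR n
  | prec {n : ℕ} (f : PR n) (g : PR (n + 2)) : PR (n + 1)

/-- The function with a given code. -/
def PR.eval : {n : ℕ} → PR n → (Fin n → ℕ) → ℕ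
  | _, .zero, _ => 0
  | _, .succ, v => v 0 + 1
  | _, .get i, v => v i
  | _, .comp f g, v => f.eval fun i => (g i).eval v
  | _, .prec f g, v =>
      Nat.rec (f.eval (Fin.tail v)) (fun y z => g.eval (Fin.cons y (Fin.cons z (Fin.tail v)))) (v 0)

theorem PR.eval_prec_zero {n : ℕ} (f : PR n) (g : PR (n + 2)) (v : Fin n → ℕ) :
    (PR.prec f g).eval (Fin.cons 0 v) = f.eval v := by
  simp [PR.eval]

theorem PR.eval_prec_succ {n : ℕ} (f : PR n) (g : PR (n + 2)) (a : ℕ) (v : Fin n → ℕ) :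
    (PR.prec f g).eval (Fin.cons (a + 1) v) =
      g.eval (Fin.cons a (Fin.cons ((PR.prec f g).eval (Fin.cons a v)) v)) := by
  simp [PR.eval]

/-- `Nat.Primrec'` is a proposition; codes as data can serve as function symbols and allow recursion
over subcodes. -/
theorem PR.exists_code {n : ℕ} {f : List.Vector ℕ n → ℕ} (hf : Nat.Primrec' f) :
    ∃ c : PR n, ∀ v : Fin n → ℕ, c.eval v = f (List.Vector.ofFn v) := by
  induction hf with
  | zero => exact ⟨.zero, fun v => rfl⟩
  | succ => exact ⟨.succ, fun v => by simp [PR.eval]⟩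
  | get i => exact ⟨.get i, fun v => by simp [PR.eval]⟩
  | comp g hf hg ihf ihg =>
    obtain ⟨c, hc⟩ := ihf
    choose d hd using ihg
    exact ⟨.comp c d, fun v => by simp [PR.eval, hc, hd]⟩
  | prec hf hg ihf ihg =>
    obtain ⟨c, hc⟩ := ihf
    obtain ⟨d, hd⟩ := ihg
    refine ⟨.prec c d, fun v => ?_⟩
    simp only [PR.eval, hc, hd, List.Vector.ofFn, List.Vector.head_cons, List.Vector.tail_cons]
    rfl

/-! ### Universal sentences with function variables -/

/-- Function symbols: an order, the constants `tt` and the characteristic function `chi` of the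
set of fresh points, the greatest element, predecessors, the number of old points, the code
of a model, a witness, and one symbol for each primitive recursive function. -/
inductive Name : ℕ → Type
  | lt : Name 2
  | tt : Name 0
  | chi : Name 1
  | top : Name 0
  | pred : Name 1
  | card : Name 0
  | code : Name 0
  | wit : Name 0
  | pr {k : ℕ} (c : PR k) : Name k

/-- Interpretations of the function symbols. -/
abbrev Interp (B : Type w) : Type w := ∀ ⦃k : ℕ⦄, Name k → (Fin k → B) → B

/-- Terms of depth at most one. -/
inductive Tm : Type
  | var (j : ℕ) : Tm
  | app {k : ℕ} (f : Name k) (σ : Fin k → ℕ) : Tm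

def Tm.eval {B : Type w} (F : Interp B) (x : ℕ → B) : Tm → B
  | .var j => x j
  | .app f σ => F f (x ∘ σ)

/-- Quantifier-free formulas. -/
inductive QF (L : FirstOrder.Language.{u, v}) : Type v
  | fls : QF L
  | eq (s t : Tm) : QF L
  | rel {n : ℕ} (R : L.Relations n) (σ : Fin n → ℕ) : QF L
  | imp (φ ψ : QF L) : QF L

namespace QF

variable {L : FirstOrder.Language.{u, v}}

def eval {B : Type w} (I : L.Structure B) (F : Interp B) (x : ℕ → B) : QF L → Prop
  | fls => False
  | eq s t => s.eval F x = t.eval F x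
  | rel R σ => I.RelMap R (x ∘ σ)
  | imp φ ψ => φ.eval I F x → ψ.eval I F x

def not (φ : QF L) : QF L := φ.imp fls

def and (φ ψ : QF L) : QF L := (φ.imp ψ.not).not

def or (φ ψ : QF L) : QF L := φ.not.imp ψ

def conj : List (QF L) → QF L
  | [] => fls.not
  | φ :: l => φ.and (conj l)

section
variable {B : Type w} {I : L.Structure B} {F : Interp B} {x : ℕ → B}

@[simp] theorem eval_eq {s t : Tm} : (eq s t : QF L).eval I F x ↔ s.eval F x = t.eval F x := Iff.rfl

@[simp] theorem eval_rel {n : ℕ} {R : L.Relations n} {σ : Fin n → ℕ} :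
    (rel R σ).eval I F x ↔ I.RelMap R (x ∘ σ) := Iff.rfl

@[simp] theorem eval_imp {φ ψ : QF L} :
    (φ.imp ψ).eval I F x ↔ (φ.eval I F x → ψ.eval I F x) := Iff.rfl

@[simp] theorem eval_not {φ : QF L} : φ.not.eval I F x ↔ ¬ φ.eval I F x := Iff.rfl

@[simp] theorem eval_and {φ ψ : QF L} :
    (φ.and ψ).eval I F x ↔ φ.eval I F x ∧ ψ.eval I F x := by
  simp [QF.and]

@[simp] theorem eval_or {φ ψ : QF L} :
    (φ.or ψ).eval I F x ↔ φ.eval I F x ∨ ψ.eval I F x := by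
  simp only [QF.or, eval_imp, eval_not]
  tauto

@[simp] theorem eval_conj {l : List (QF L)} : (conj l).eval I F x ↔ ∀ φ ∈ l, φ.eval I F x := by
  induction l with
  | nil => simp [conj, QF.eval, QF.not]
  | cons φ l ih => simp [conj, ih]

end

/-- Truth of the universal closure. -/
def Valid {B : Type w} (I : L.Structure B) (F : Interp B) (φ : QF L) : Prop :=
  ∀ x : ℕ → B, φ.eval I F x

theorem valid_conj {B : Type w} {I : L.Structure B} {F : Interp B} {l : List (QF L)} :
    (conj l).Valid I F ↔ ∀ φ ∈ l, φ.Valid I F := by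
  simp only [Valid, eval_conj]
  exact ⟨fun h φ hφ x => h x φ hφ, fun h x φ hφ => h φ hφ x⟩

end QF

@[simp] theorem Tm.eval_var {B : Type w} {F : Interp B} {x : ℕ → B} {j : ℕ} :
    (Tm.var j).eval F x = x j := rfl

@[simp] theorem Tm.eval_app {B : Type w} {F : Interp B} {x : ℕ → B} {k : ℕ} {f : Name k}
    {σ : Fin k → ℕ} : (Tm.app f σ).eval F x = F f (x ∘ σ) := rfl

/-! ### The axioms -/

namespace QF

variable {L : FirstOrder.Language.{u, v}}

/-- The value of a nullary symbol. -/
abbrev cst (f : Name 0) : Tm := .app f Fin.elim0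

/-- The order and the set of fresh points are given by functions, with the value `tt` for truth, so
that all auxiliary objects are functions. -/
abbrev less (i j : ℕ) : QF L := eq (.app .lt ![i, j]) (cst .tt)

abbrev fresh (i : ℕ) : QF L := eq (.app .chi ![i]) (cst .tt)

/-- `i` and `j` are not separated by a third point and `i` is below `j`. -/
def covers (i j k : ℕ) : QF L :=
  (less i j).and ((less i k).and (less k j)).not

/-- Besides a strict linear order, this fixes `card` as a fresh point with exactly the old points
below it, so its rank is the size of the old domain. Separating zero from `top` ensures that the
value zero is never an overflow. Terms have depth one, hence inner values are named by variables in
premises. -/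
def orderAxioms : QF L :=
  conj [(less 0 0).not, (less 0 1).imp ((less 1 2).imp (less 0 2)),
    (less 0 1).or ((eq (.var 0) (.var 1)).or (less 1 0)),
    (eq (cst (.pr .zero)) (cst .top)).not,
    (eq (.var 0) (cst .card)).imp
      ((fresh 0).and (((fresh 1).imp (less 1 0).not).and ((fresh 1).not.imp (less 1 0)))),
    (eq (.var 0) (cst (.pr .zero))).not.imp
      ((eq (.var 1) (.app .pred ![0])).imp (covers 1 0 2))]

/-- The variables `i, i + 1, …`. -/
def block (n i : ℕ) : Fin n → ℕ := fun j => i + j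

/-- The value `y` of the variable `y` of the function `c` is correct. -/
def prAxiom : {n : ℕ} → PR n → QF L
  | _, .zero => (eq (.var 0) (cst (.pr .zero))).imp (less 1 0).not
  -- From here on a value `top` means overflow. Only values other than `top` are required to be
  -- correct, and then the intermediate values must differ from `top` as well.
  | _, .succ => (eq (.app (.pr .succ) ![0]) (.var 1)).imp
      ((eq (.var 1) (cst .top)).not.imp (covers 0 1 2))
  | n, .get i => eq (.app (.pr (.get i)) (block n 0)) (.var i)
  | n, .comp (m := m) f g =>
      (conj ((List.finRange m).map fun i : Fin m =>
        eq (.app (.pr (g i)) (block n 0)) (.var (n + i)))).imp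
      ((eq (.app (.pr (.comp f g)) (block n 0)) (cst .top)).not.imp
        ((conj ((List.finRange m).map fun i : Fin m => (eq (.var (n + (i : ℕ))) (cst .top)).not)).and
          (eq (.app (.pr (.comp f g)) (block n 0)) (.app (.pr f) (block m n)))))
  -- Variable `0` is the recursion argument and `1, …, n` are the parameters; `n + 1` names the
  -- predecessor and `n + 2` the previous value.
  | _, .prec (n := n) f g =>
      (eq (.app (.pr (.prec f g)) (Fin.cons 0 (block n 1))) (cst .top)).not.imp
      (((eq (.var 0) (cst (.pr .zero))).imp
          (eq (.app (.pr (.prec f g)) (Fin.cons 0 (block n 1))) (.app (.pr f) (block n 1)))).and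
        ((eq (.var 0) (cst (.pr .zero))).not.imp
          ((eq (.var (n + 1)) (.app .pred ![0])).imp
          ((eq (.var (n + 2)) (.app (.pr (.prec f g)) (Fin.cons (n + 1) (block n 1)))).imp
          ((eq (.var (n + 2)) (cst .top)).not.and
          (eq (.app (.pr (.prec f g)) (Fin.cons 0 (block n 1)))
            (.app (.pr g) (Fin.cons (n + 1) (Fin.cons (n + 2) (block n 1))))))))))

/-- The axioms for `c` and all its subcodes. -/
def prAxioms : {n : ℕ} → PR n → QF L
  | _, .zero => prAxiom .zero
  | _, .succ => prAxiom .succ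
  | _, .get i => prAxiom (.get i)
  | _, .comp (m := m) f g => (prAxiom (.comp f g)).and
      ((prAxioms f).and (conj ((List.finRange m).map fun i => prAxioms (g i))))
  | _, .prec f g => (prAxiom (.prec f g)).and ((prAxioms f).and (prAxioms g))

/-- The function `c` correctly describes the relation `R` on the old points. -/
def relAxiom {k : ℕ} (R : L.Relations k) (c : PR (k + 1)) : QF L :=
  (eq (.var k) (cst .code)).imp
    (((rel R (block k 0)).imp
        (eq (.app (.pr c) (Fin.cons k (block k 0))) (cst (.pr .zero)))).and
      ((rel R (block k 0)).not.imp
        -- Outside the relation `top` must be excluded together with zero, since an overflow says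
        -- nothing about the true value. Tuples with fresh entries are exempt.
        ((conj ((List.finRange k).map fun i : Fin k => (fresh (i : ℕ)).not)).imp
          ((eq (.app (.pr c) (Fin.cons k (block k 0))) (cst (.pr .zero))).not.and
            (eq (.app (.pr c) (Fin.cons k (block k 0))) (cst .top)).not))))

/-- The function `c` accepts. -/
def accAxiom (c : PR 3) : QF L :=
  (eq (.var 0) (cst .card)).imp ((eq (.var 1) (cst .code)).imp ((eq (.var 2) (cst .wit)).imp
    (eq (.app (.pr c) ![0, 1, 2]) (cst (.pr .zero)))))

def axioms (cacc : PR 3) (rels : List (Σ k, L.Relations k))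
    (cbit : ∀ q : Σ k, L.Relations k, PR (q.1 + 1)) : QF L :=
  -- `PR.zero` is listed separately because it need not be a subcode of the other codes, while the
  -- axioms refer to its value.
  conj ([orderAxioms, prAxioms PR.zero, prAxioms cacc, accAxiom cacc] ++
    rels.map (fun q => prAxioms (cbit q)) ++ rels.map fun q => relAxiom q.2 (cbit q))

end QF


/-! ### Meaning of the axioms -/

section
variable {B : Type w}

theorem comp_elim0 (x : ℕ → B) (σ : Fin 0 → ℕ) : x ∘ σ = ![] := Subsingleton.elim _ _

theorem comp_vec_one (x : ℕ → B) (i : ℕ) : x ∘ ![i] = ![x i] := by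
  ext j; fin_cases j; rfl

theorem comp_vec_two (x : ℕ → B) (i j : ℕ) : x ∘ ![i, j] = ![x i, x j] := by
  ext k; fin_cases k <;> rfl

theorem comp_vec_three (x : ℕ → B) (i j k : ℕ) : x ∘ ![i, j, k] = ![x i, x j, x k] := by
  ext l; fin_cases l <;> rfl

theorem comp_fin_cons (x : ℕ → B) {n : ℕ} (i : ℕ) (σ : Fin n → ℕ) :
    x ∘ (Fin.cons i σ : Fin (n + 1) → ℕ) = Fin.cons (x i) (x ∘ σ) := by
  ext j; cases j using Fin.cases <;> rfl

theorem exists_blocks [Nonempty B] {n m : ℕ} (v : Fin n → B) (z : Fin m → B) :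
    ∃ x : ℕ → B, x ∘ QF.block n 0 = v ∧ x ∘ QF.block m n = z := by
  classical
  refine ⟨fun j => if h : j < n then v ⟨j, h⟩ else if h : j - n < m then z ⟨j - n, h⟩ else
    Classical.arbitrary B, ?_, ?_⟩
  · ext i; simp [QF.block]
  · ext i; simp [QF.block]

theorem block_succ (x : ℕ → B) (n i : ℕ) :
    x ∘ QF.block (n + 1) i = Fin.cons (x i) (x ∘ QF.block n (i + 1)) := by
  ext j
  cases j using Fin.cases with
  | zero => simp [QF.block]
  | succ j => simp [QF.block, add_assoc, add_comm 1]

/-- `F` satisfies the axioms of the order, where `fr` is the set of fresh points. -/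
structure OrderOk (F : Interp B) (fr : B → Prop) : Prop where
  irrefl : ∀ a, F .lt ![a, a] ≠ F .tt ![]
  trans : ∀ a b c, F .lt ![a, b] = F .tt ![] → F .lt ![b, c] = F .tt ![] → F .lt ![a, c] = F .tt ![]
  total : ∀ a b, F .lt ![a, b] = F .tt ![] ∨ a = b ∨ F .lt ![b, a] = F .tt ![]
  zero_ne_top : F (.pr .zero) ![] ≠ F .top ![]
  fresh_card : fr (F .card ![])
  not_lt_card : ∀ b, fr b → F .lt ![b, F .card ![] ] ≠ F .tt ![]
  lt_card : ∀ b, ¬ fr b → F .lt ![b, F .card ![] ] = F .tt ![]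
  pred : ∀ a c, a ≠ F (.pr .zero) ![] → F .lt ![F .pred ![a], a] = F .tt ![] ∧
    ¬ (F .lt ![F .pred ![a], c] = F .tt ![] ∧ F .lt ![c, a] = F .tt ![])

/-- `F` satisfies the axiom for the function with a given code. -/
def PR.Ok (F : Interp B) : {n : ℕ} → PR n → Prop
  | _, .zero => ∀ b, F .lt ![b, F (.pr .zero) ![] ] ≠ F .tt ![]
  | _, .succ => ∀ a c, F (.pr .succ) ![a] ≠ F .top ![] →
      F .lt ![a, F (.pr .succ) ![a] ] = F .tt ![] ∧
      ¬ (F .lt ![a, c] = F .tt ![] ∧ F .lt ![c, F (.pr .succ) ![a] ] = F .tt ![])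
  | _, .get i => ∀ v, F (.pr (.get i)) v = v i
  | _, .comp f g => ∀ v, F (.pr (.comp f g)) v ≠ F .top ![] →
      (∀ i, F (.pr (g i)) v ≠ F .top ![]) ∧
      F (.pr (.comp f g)) v = F (.pr f) fun i => F (.pr (g i)) v
  | _, .prec f g => ∀ a v, F (.pr (.prec f g)) (Fin.cons a v) ≠ F .top ![] →
      (a = F (.pr .zero) ![] → F (.pr (.prec f g)) (Fin.cons a v) = F (.pr f) v) ∧
      (a ≠ F (.pr .zero) ![] →
        F (.pr (.prec f g)) (Fin.cons (F .pred ![a]) v) ≠ F .top ![] ∧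
        F (.pr (.prec f g)) (Fin.cons a v) = F (.pr g) (Fin.cons (F .pred ![a])
          (Fin.cons (F (.pr (.prec f g)) (Fin.cons (F .pred ![a]) v)) v)))

/-- `F` satisfies the axioms for a code and all its subcodes. -/
def PR.AllOk (F : Interp B) : {n : ℕ} → PR n → Prop
  | _, .zero => PR.Ok F .zero
  | _, .succ => PR.Ok F .succ
  | _, .get i => PR.Ok F (.get i)
  | _, .comp f g => PR.Ok F (.comp f g) ∧ f.AllOk F ∧ ∀ i, (g i).AllOk F
  | _, .prec f g => PR.Ok F (.prec f g) ∧ f.AllOk F ∧ g.AllOk F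

variable {L : FirstOrder.Language.{u, v}} {I : L.Structure B} {F : Interp B}

namespace QF

theorem valid_orderAxioms [Nonempty B] {fr : B → Prop}
    (hfr : ∀ b, F .chi ![b] = F .tt ![] ↔ fr b) :
    (orderAxioms : QF L).Valid I F ↔ OrderOk F fr := by
  have key : ∀ a b c : B, ∃ x : ℕ → B, x 0 = a ∧ x 1 = b ∧ x 2 = c := fun a b c =>
    ⟨fun i => if i = 0 then a else if i = 1 then b else c, by simp⟩
  simp only [orderAxioms, valid_conj, List.mem_cons, List.not_mem_nil, or_false, forall_eq_or_imp,
    forall_eq]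
  simp only [Valid, eval_not, eval_imp, eval_or, eval_and, eval_eq, Tm.eval_var, Tm.eval_app,
    comp_elim0, comp_vec_one, comp_vec_two, covers, hfr]
  constructor
  · rintro ⟨h1, h2, h3, h4, h5, h6⟩
    refine ⟨fun a => ?_, fun a b c => ?_, fun a b => ?_, ?_, ?_, fun b => ?_, fun b => ?_,
      fun a c => ?_⟩
    · obtain ⟨x, rfl, -, -⟩ := key a a a
      exact h1 x
    · obtain ⟨x, rfl, rfl, rfl⟩ := key a b c
      exact h2 x
    · obtain ⟨x, rfl, rfl, -⟩ := key a b b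
      exact h3 x
    · exact h4 fun _ => Classical.arbitrary B
    · obtain ⟨x, h, -, -⟩ := key (F .card ![]) (F .card ![]) (F .card ![])
      exact h ▸ (h5 x h).1
    · obtain ⟨x, h, rfl, -⟩ := key (F .card ![]) b b
      exact h ▸ (h5 x h).2.1
    · obtain ⟨x, h, rfl, -⟩ := key (F .card ![]) b b
      exact h ▸ (h5 x h).2.2
    · obtain ⟨x, rfl, h, rfl⟩ := key a (F .pred ![a]) c
      intro h0
      have := h6 x h0 h
      rwa [h] at this
  · intro h
    refine ⟨fun x => h.irrefl _, fun x => h.trans _ _ _, fun x => h.total _ _,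
      fun x => h.zero_ne_top, fun x hx => ?_, fun x hx hx' => ?_⟩
    · rw [hx]
      exact ⟨h.fresh_card, h.not_lt_card _, h.lt_card _⟩
    · rw [hx']
      exact h.pred _ _ hx

/-- The auxiliary variables are eliminated by assigning them the values that the premises prescribe.
-/
theorem valid_prAxiom [Nonempty B] {n : ℕ} (c : PR n) : (prAxiom c : QF L).Valid I F ↔ c.Ok F := by
  cases c with
  | zero =>
    simp only [prAxiom, Valid, eval_not, eval_imp, eval_eq, Tm.eval_var, Tm.eval_app,
      comp_elim0, comp_vec_two, PR.Ok]
    constructor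
    · intro h b
      have := h (fun i => if i = 0 then F (.pr .zero) ![] else b)
      simpa using this
    · intro h x hx
      rw [hx]
      exact h _
  | succ =>
    simp only [prAxiom, Valid, eval_not, eval_imp, eval_eq, eval_and, Tm.eval_var, Tm.eval_app,
      comp_elim0, comp_vec_one, comp_vec_two, covers, PR.Ok]
    constructor
    · intro h a c
      have := h (fun i => if i = 0 then a else if i = 1 then F (.pr .succ) ![a] else c)
      simpa using this
    · intro h x hx
      rw [← hx]
      exact h _ _
  | get i =>
    simp only [prAxiom, Valid, eval_eq, Tm.eval_var, Tm.eval_app, PR.Ok]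
    constructor
    · intro h v
      obtain ⟨x, rfl, -⟩ := exists_blocks v v
      simpa [block] using h x
    · intro h x
      simpa [block] using h (x ∘ block _ 0)
  | comp f g =>
    simp only [prAxiom, Valid, eval_not, eval_imp, eval_eq, eval_and, eval_conj, Tm.eval_var,
      Tm.eval_app, comp_elim0, PR.Ok, List.mem_map, List.mem_finRange, true_and,
      forall_exists_index, forall_apply_eq_imp_iff]
    constructor
    · intro h v hv
      obtain ⟨x, rfl, hx⟩ := exists_blocks v fun i => F (.pr (g i)) v
      have hx' : ∀ i, F (.pr (g i)) (x ∘ block _ 0) = x (_ + i) := fun i => (congrFun hx i).symm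
      have := h x hx' hv
      refine ⟨fun i => ?_, ?_⟩
      · rw [hx' i]
        exact this.1 i
      · rw [this.2, hx]
    · intro h x hx hv
      have := h _ hv
      refine ⟨fun i => ?_, ?_⟩
      · rw [← hx]
        exact this.1 i
      · rw [this.2]
        exact congrArg _ (funext fun i => hx i)
  | @prec n f g =>
    simp only [prAxiom, Valid, eval_not, eval_imp, eval_eq, eval_and, Tm.eval_var,
      Tm.eval_app, comp_elim0, PR.Ok, comp_fin_cons, comp_vec_one]
    constructor
    · intro h a v hv
      obtain ⟨x, hx, hx'⟩ := exists_blocks (Fin.cons a v : Fin (n + 1) → B)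
        ![F .pred ![a], F (.pr (.prec f g)) (Fin.cons (F .pred ![a]) v)]
      rw [block_succ, Fin.cons_inj] at hx
      obtain ⟨rfl, rfl⟩ := hx
      have h1 := congrFun hx' 0
      have h2 := congrFun hx' 1
      simp only [block, Function.comp_apply, Fin.val_zero, add_zero, Matrix.cons_val_zero,
        Fin.val_one, Matrix.cons_val_one] at h1 h2
      have := h x hv
      refine ⟨this.1, fun h0 => ?_⟩
      have := this.2 h0 h1 (by rw [h1]; exact h2)
      rw [h1] at this
      have h2 : x (n + 2) = _ := h2
      rw [h2] at this
      exact this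
    · intro h x hv
      have := h _ _ hv
      refine ⟨this.1, fun h0 h1 h2 => ?_⟩
      rw [h1] at h2 ⊢
      rw [h2]
      exact this.2 h0

theorem valid_and {φ ψ : QF L} : (φ.and ψ).Valid I F ↔ φ.Valid I F ∧ ψ.Valid I F := by
  simp [Valid, forall_and]

theorem valid_prAxioms [Nonempty B] {n : ℕ} (c : PR n) :
    (prAxioms c : QF L).Valid I F ↔ c.AllOk F := by
  induction c with
  | zero => exact valid_prAxiom _
  | succ => exact valid_prAxiom _
  | get i => exact valid_prAxiom _
  | comp f g ihf ihg =>
    simp [prAxioms, PR.AllOk, valid_and, valid_prAxiom, valid_conj, ihf, ihg]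
  | prec f g ihf ihg =>
    simp [prAxioms, PR.AllOk, valid_and, valid_prAxiom, ihf, ihg]

/-- Meaning of `relAxiom`. -/
def RelOk (I : L.Structure B) (F : Interp B) (fr : B → Prop) {k : ℕ} (R : L.Relations k)
    (c : PR (k + 1)) : Prop :=
  ∀ a : Fin k → B,
    (I.RelMap R a → F (.pr c) (Fin.cons (F .code ![]) a) = F (.pr .zero) ![]) ∧
    (¬ I.RelMap R a → (∀ i, ¬ fr (a i)) →
      F (.pr c) (Fin.cons (F .code ![]) a) ≠ F (.pr .zero) ![] ∧
      F (.pr c) (Fin.cons (F .code ![]) a) ≠ F .top ![])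

theorem valid_relAxiom [Nonempty B] {fr : B → Prop}
    (hfr : ∀ b, F .chi ![b] = F .tt ![] ↔ fr b) {k : ℕ} (R : L.Relations k) (c : PR (k + 1)) :
    (relAxiom R c).Valid I F ↔ RelOk I F fr R c := by
  simp only [relAxiom, Valid, eval_not, eval_imp, eval_eq, eval_and, eval_conj, eval_rel,
    Tm.eval_var, Tm.eval_app, comp_elim0, comp_fin_cons, comp_vec_one, RelOk, List.mem_map,
    List.mem_finRange, true_and, forall_exists_index, forall_apply_eq_imp_iff, hfr]
  have key (x : ℕ → B) : (∀ i : Fin k, ¬ fr (x i)) ↔ ∀ i, ¬ fr ((x ∘ block k 0) i) := by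
    simp [block]
  constructor
  · intro h a
    obtain ⟨x, rfl, hx⟩ := exists_blocks a ![F .code ![] ]
    have hk : x k = F .code ![] := congrFun hx 0
    have := h x hk
    rw [hk, key] at this
    exact this
  · intro h x hk
    rw [hk, key]
    exact h _

theorem valid_accAxiom {c : PR 3} : (accAxiom c : QF L).Valid I F ↔
    F (.pr c) ![F .card ![], F .code ![], F .wit ![] ] = F (.pr .zero) ![] := by
  simp only [accAxiom, Valid, eval_imp, eval_eq, Tm.eval_var, Tm.eval_app, comp_elim0,
    comp_vec_three]
  constructor
  · intro h
    have := h (fun i => if i = 0 then F .card ![] else if i = 1 then F .code ![] else F .wit ![])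
    simpa using this
  · intro h x h0 h1 h2
    rw [h0, h1, h2, h]

theorem valid_axioms [Nonempty B] {fr : B → Prop}
    (hfr : ∀ b, F .chi ![b] = F .tt ![] ↔ fr b) {cacc : PR 3} {rels : List (Σ k, L.Relations k)}
    {cbit : ∀ q : Σ k, L.Relations k, PR (q.1 + 1)} :
    (axioms cacc rels cbit).Valid I F ↔
      OrderOk F fr ∧ PR.Ok F .zero ∧ cacc.AllOk F ∧
      F (.pr cacc) ![F .card ![], F .code ![], F .wit ![] ] = F (.pr .zero) ![] ∧
      ∀ q ∈ rels, (cbit q).AllOk F ∧ RelOk I F fr q.2 (cbit q) := by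
  simp only [axioms, valid_conj, List.mem_append, List.mem_cons, List.mem_map, List.not_mem_nil,
    or_false, or_imp, forall_and, forall_eq, forall_exists_index, and_imp, forall_apply_eq_imp_iff₂,
    valid_orderAxioms hfr, valid_prAxioms, valid_relAxiom hfr, valid_accAxiom, PR.AllOk]
  tauto

end QF

end

/-! ### Correctness of the axioms -/

section
variable {B : Type w}

/-- The number of points below `b`. -/
noncomputable def rank (F : Interp B) (b : B) : ℕ := {a | F .lt ![a, b] = F .tt ![]}.ncard

variable {F : Interp B} {fr : B → Prop}

theorem OrderOk.rank_lt [Finite B] (h : OrderOk F fr) {a b : B}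
    (hab : F .lt ![a, b] = F .tt ![]) : rank F a < rank F b := by
  refine Set.ncard_lt_ncard ⟨fun c hc => h.trans _ _ _ hc hab, fun hs => h.irrefl a (hs hab)⟩
    (Set.toFinite _)

theorem OrderOk.rank_injective [Finite B] (h : OrderOk F fr) : Function.Injective (rank F) := by
  intro a b hab
  rcases h.total a b with h1 | h1 | h1
  · exact absurd hab (h.rank_lt h1).ne
  · exact h1
  · exact absurd hab (h.rank_lt h1).ne'

/-- With no point strictly between, the points below `b` are those below `a` together with `a`
itself. -/
theorem OrderOk.rank_covers [Finite B] (h : OrderOk F fr) {a b : B}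
    (hab : F .lt ![a, b] = F .tt ![])
    (hc : ∀ c, ¬ (F .lt ![a, c] = F .tt ![] ∧ F .lt ![c, b] = F .tt ![])) :
    rank F b = rank F a + 1 := by
  have : {c | F .lt ![c, b] = F .tt ![]} = insert a {c | F .lt ![c, a] = F .tt ![]} := by
    ext c
    simp only [Set.mem_ofPred_eq, Set.mem_insert_iff]
    constructor
    · intro hcb
      rcases h.total c a with h1 | h1 | h1
      · exact Or.inr h1
      · exact Or.inl h1
      · exact absurd ⟨h1, hcb⟩ (hc c)
    · rintro (rfl | h1)
      · exact hab
      · exact h.trans _ _ _ h1 hab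
  have hn : a ∉ {c | F .lt ![c, a] = F .tt ![]} := h.irrefl a
  rw [rank, this, Set.ncard_insert_of_notMem hn (Set.toFinite _), rank]

theorem OrderOk.rank_pred [Finite B] (h : OrderOk F fr) {a : B} (ha : a ≠ F (.pr .zero) ![]) :
    rank F a = rank F (F .pred ![a]) + 1 :=
  h.rank_covers (h.pred a a ha).1 fun c => (h.pred a c ha).2

theorem rank_zero (h : PR.Ok F .zero) : rank F (F (.pr .zero) ![]) = 0 := by
  have : {a | F .lt ![a, F (.pr .zero) ![] ] = F .tt ![]} = ∅ := by
    ext a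
    simpa using h a
  rw [rank, this, Set.ncard_empty]

theorem OrderOk.rank_card (h : OrderOk F fr) : rank F (F .card ![]) = {b | ¬ fr b}.ncard := by
  rw [rank]
  congr 1
  ext b
  exact ⟨fun hb hf => h.not_lt_card b hf hb, fun hb => h.lt_card b hb⟩

/-- Soundness of the overflow convention. A value other than `top` forces all intermediate values to
differ from `top`, so the induction hypotheses apply to them. -/
theorem PR.AllOk.eval_eq_rank [Finite B] (h : OrderOk F fr) (h0 : PR.Ok F .zero) {n : ℕ} {c : PR n}
    (hc : c.AllOk F) (v : Fin n → B) (hv : F (.pr c) v ≠ F .top ![]) :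
    c.eval (rank F ∘ v) = rank F (F (.pr c) v) := by
  induction c with
  | zero =>
    rw [Subsingleton.elim v ![], rank_zero h0]
    rfl
  | succ =>
    obtain ⟨a, rfl⟩ : ∃ a, v = ![a] := ⟨v 0, by ext i; fin_cases i; rfl⟩
    rw [h.rank_covers (hc a a hv).1 fun c => (hc a c hv).2]
    rfl
  | get i => rw [hc v]; rfl
  | comp f g ihf ihg =>
    obtain ⟨hc, hf, hg⟩ := hc
    obtain ⟨h1, h2⟩ := hc v hv
    rw [h2] at hv ⊢
    rw [← ihf hf _ hv, PR.eval]
    congr 1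
    ext i
    exact ihg i (hg i) v (h1 i)
  | prec f g ihf ihg =>
    obtain ⟨hc, hf, hg⟩ := hc
    obtain ⟨a, v, rfl⟩ : ∃ a v', v = Fin.cons a v' := ⟨v 0, Fin.tail v, (Fin.cons_self_tail v).symm⟩
    have hcons : ∀ (k : ℕ) (a : B) (v : Fin k → B),
        rank F ∘ (Fin.cons a v : Fin (k + 1) → B) = Fin.cons (rank F a) (rank F ∘ v) := by
      intro k a v
      ext i
      cases i using Fin.cases <;> rfl
    rw [hcons]
    -- Primitive recursion needs an inner induction on the rank of the recursion argument: rank zero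
    -- forces `a` to be the zero point, and otherwise `pred` lowers the rank by one.
    generalize hr : rank F a = r
    induction r generalizing a with
    | zero =>
      have ha : a = F (.pr .zero) ![] := h.rank_injective (by rw [hr, rank_zero h0])
      have := (hc a v hv).1 ha
      rw [this] at hv
      rw [PR.eval_prec_zero, this, ihf hf v hv]
    | succ r ih =>
      have ha : a ≠ F (.pr .zero) ![] := by
        rintro rfl
        rw [rank_zero h0] at hr
        omega
      have hp : rank F (F .pred ![a]) = r := by
        have := h.rank_pred ha
        omega
      obtain ⟨h1, h2⟩ := (hc a v hv).2 ha
      have ih := ih _ h1 hp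
      rw [PR.eval_prec_succ, ih, h2]
      rw [h2] at hv
      rw [← ihg hg _ hv, hcons, hcons, hp]

end


/-! ### The canonical interpretation -/

/-- All values that occur properly inside the computation of `c` are below `K`. -/
def PR.Good (K : ℕ) : {n : ℕ} → PR n → (Fin n → ℕ) → Prop
  | _, .zero, _ => True
  | _, .succ, _ => True
  | _, .get _, _ => True
  | _, .comp f g, v => (∀ i, (g i).Good K v ∧ (g i).eval v < K) ∧ f.Good K fun i => (g i).eval v
  | _, .prec f g, v => f.Good K (Fin.tail v) ∧ ∀ j < v 0,
      (PR.prec f g).eval (Fin.cons j (Fin.tail v)) < K ∧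
      g.Good K (Fin.cons j (Fin.cons ((PR.prec f g).eval (Fin.cons j (Fin.tail v))) (Fin.tail v)))

/-- A computation has finitely many intermediate values, so every large bound exceeds them; for
recursion only the stages below `v 0` count. -/
theorem PR.eventually_good {n : ℕ} (c : PR n) (v : Fin n → ℕ) :
    ∀ᶠ K in Filter.atTop, c.Good K v := by
  induction c with
  | zero => simp [PR.Good]
  | succ => simp [PR.Good]
  | get i => simp [PR.Good]
  | comp f g ihf ihg =>
    simp only [PR.Good, Filter.eventually_and, Filter.eventually_all]
    exact ⟨fun i => ⟨ihg i v, Filter.eventually_gt_atTop _⟩, ihf _⟩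
  | prec f g ihf ihg =>
    simp only [PR.Good, Filter.eventually_and]
    refine ⟨ihf _, ?_⟩
    refine ((Set.finite_lt_nat (v 0)).eventually_all (l := Filter.atTop) (p := fun j K =>
      (PR.prec f g).eval (Fin.cons j (Fin.tail v)) < K ∧
      g.Good K (Fin.cons j (Fin.cons ((PR.prec f g).eval (Fin.cons j (Fin.tail v)))
        (Fin.tail v))))).2 fun j _ => ?_
    exact (Filter.eventually_gt_atTop _).and (ihg _)

section
variable {B : Type w} {K : ℕ}

/-- The point with number `m`. -/
def point (e : B ≃ Fin (K + 1)) (m : ℕ) : B := e.symm (Fin.ofNat (K + 1) m)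

theorem val_point {e : B ≃ Fin (K + 1)} {m : ℕ} (hm : m ≤ K) : (e (point e m) : ℕ) = m := by
  simp [point, Nat.mod_eq_of_lt (Nat.lt_succ_of_le hm)]

theorem eq_of_val {e : B ≃ Fin (K + 1)} {a b : B} (h : (e a : ℕ) = e b) : a = b :=
  e.injective (Fin.ext h)

open Classical in
/-- The canonical interpretation. -/
noncomputable def canon (e : B ≃ Fin (K + 1)) (n t w : ℕ) : Interp B
  | _, .lt, v => if e (v 0) < e (v 1) then point e K else point e 0
  | _, .tt, _ => point e K
  | _, .chi, v => if n ≤ e (v 0) then point e K else point e 0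
  | _, .top, _ => point e K
  | _, .pred, v => point e (e (v 0) - 1)
  | _, .card, _ => point e n
  | _, .code, _ => point e t
  | _, .wit, _ => point e w
  -- The intermediate values have to be checked too: a computation may have a small result but a
  -- large intermediate value, and the axioms then demand `top`.
  | _, .pr c, v => if c.Good K (fun i => e (v i)) ∧ c.eval (fun i => e (v i)) < K then
      point e (c.eval fun i => e (v i)) else point e K

variable {e : B ≃ Fin (K + 1)} {n t w : ℕ}

/-- Positivity of `K` keeps apart the points `0` and `K`, which act as truth values. -/
theorem canon_lt (hK : 0 < K) {a b : B} :
    canon e n t w .lt ![a, b] = canon e n t w .tt ![] ↔ (e a : ℕ) < e b := by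
  have h0 : point e 0 ≠ point e K := fun h => by
    have := congrArg (fun b => (e b : ℕ)) h
    simp only [val_point (Nat.zero_le K), val_point le_rfl] at this
    omega
  simp only [canon]
  by_cases h : e a < e b
  · simp [h]
  · simp [h, h0]

theorem canon_chi (hK : 0 < K) {b : B} :
    canon e n t w .chi ![b] = canon e n t w .tt ![] ↔ n ≤ e b := by
  have h0 : point e 0 ≠ point e K := fun h => by
    have := congrArg (fun b => (e b : ℕ)) h
    simp only [val_point (Nat.zero_le K), val_point le_rfl] at this
    omega
  simp only [canon]
  by_cases h : n ≤ e b
  · simp [h]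
  · simp [h, h0]

theorem canon_pr {k : ℕ} {c : PR k} {v : Fin k → B} (h : c.Good K fun i => e (v i))
    (h' : c.eval (fun i => e (v i)) < K) :
    (e (canon e n t w (.pr c) v) : ℕ) = c.eval fun i => e (v i) := by
  simp only [canon, h, h', and_self, if_true, val_point h'.le]

/-- The point `K` is reserved for overflow, since genuine results lie strictly below `K`. -/
theorem canon_ne_top {k : ℕ} {c : PR k} {v : Fin k → B} :
    canon e n t w (.pr c) v ≠ canon e n t w .top ![] ↔
      c.Good K (fun i => e (v i)) ∧ c.eval (fun i => e (v i)) < K := by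
  constructor
  · intro h
    by_contra h'
    exact h (by simp only [canon, h', if_false])
  · rintro ⟨h, h'⟩ hc
    have := canon_pr (n := n) (t := t) (w := w) h h'
    rw [hc] at this
    simp only [canon, val_point le_rfl] at this
    omega

theorem canon_zero (hK : 0 < K) : (e (canon e n t w (.pr .zero) ![]) : ℕ) = 0 :=
  canon_pr trivial hK

theorem val_canon_pred (a : B) : (e (canon e n t w .pred ![a]) : ℕ) = e a - 1 := by
  simp only [canon, Matrix.cons_val_zero]
  exact val_point (by omega)

theorem canon_ok {k : ℕ} (hK : 0 < K) (c : PR k) : c.Ok (canon e n t w) := by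
  cases c with
  | zero =>
    intro b
    rw [ne_eq, canon_lt hK, canon_zero hK]
    omega
  | succ =>
    intro a c h
    have h := canon_ne_top.1 h
    have h2 := canon_pr (n := n) (t := t) (w := w) h.1 h.2
    have h3 : PR.succ.eval (fun i => (e (![a] i) : ℕ)) = e a + 1 := rfl
    rw [canon_lt hK, canon_lt hK, canon_lt hK, h2, h3]
    omega
  | get i =>
    intro v
    apply eq_of_val (e := e)
    -- The projection axiom has no overflow guard. If the argument is the point `K`, the overflow
    -- value coincides with it.
    by_cases h : (e (v i) : ℕ) < K
    · exact canon_pr (c := PR.get i) (v := v) trivial h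
    · have : canon e n t w (.pr (.get i)) v = canon e n t w .top ![] := by
        by_contra h'
        exact h (canon_ne_top.1 h').2
      rw [this]
      simp only [canon, val_point le_rfl]
      omega
  | comp f g =>
    intro v h
    obtain ⟨⟨hg, hf⟩, hlt⟩ := canon_ne_top.1 h
    have hv : ∀ i, (e (canon e n t w (.pr (g i)) v) : ℕ) = (g i).eval fun i => e (v i) :=
      fun i => canon_pr (hg i).1 (hg i).2
    refine ⟨fun i => canon_ne_top.2 (hg i), eq_of_val (e := e) ?_⟩
    rw [canon_pr (c := PR.comp f g) ⟨hg, hf⟩ hlt, canon_pr]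
    · simp only [hv]
      rfl
    · simpa only [hv] using hf
    · simp only [hv]
      exact hlt
  | @prec k f g =>
    intro a v h
    have hcons : ∀ (k : ℕ) (a : B) (v : Fin k → B),
        (fun i => (e ((Fin.cons a v : Fin (k + 1) → B) i) : ℕ)) =
          Fin.cons (e a : ℕ) fun i => (e (v i) : ℕ) := by
      intro k a v
      ext i
      cases i using Fin.cases <;> rfl
    obtain ⟨⟨hf, hg⟩, hlt⟩ := canon_ne_top.1 h
    have hval := canon_pr (n := n) (t := t) (w := w) (c := PR.prec f g) (v := Fin.cons a v)
      ⟨hf, hg⟩ hlt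
    simp only [hcons, Fin.tail_cons, Fin.cons_zero] at hf hg hlt hval
    constructor
    · rintro rfl
      apply eq_of_val (e := e)
      rw [canon_zero hK, PR.eval_prec_zero] at hlt hval
      rw [hval, canon_pr hf hlt]
    · intro ha
      have ha' : (e a : ℕ) ≠ 0 := fun h => ha (eq_of_val (h.trans (canon_zero hK).symm))
      obtain ⟨r, hr⟩ := Nat.exists_eq_succ_of_ne_zero ha'
      have hp : (e (canon e n t w .pred ![a]) : ℕ) = r := by
        rw [val_canon_pred, hr]
        rfl
      -- Goodness speaks of all stages before the argument, so it is inherited by the predecessor.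
      have hG : (PR.prec f g).Good K fun i =>
          (e ((Fin.cons (canon e n t w .pred ![a]) v : Fin (k + 1) → B) i) : ℕ) := by
        refine ⟨?_, fun j hj => ?_⟩
        · simpa only [hcons, Fin.tail_cons] using hf
        · simp only [hcons, Fin.tail_cons, Fin.cons_zero, hp] at hj ⊢
          exact hg j (by omega)
      have hr' := hg r (by omega)
      have hL : (PR.prec f g).eval (fun i =>
          (e ((Fin.cons (canon e n t w .pred ![a]) v : Fin (k + 1) → B) i) : ℕ)) < K := by
        rw [hcons, hp]
        exact hr'.1
      have hz := canon_pr (n := n) (t := t) (w := w) hG hL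
      rw [hcons, hp] at hz
      refine ⟨canon_ne_top.2 ⟨hG, hL⟩, eq_of_val (e := e) ?_⟩
      rw [hr, Nat.succ_eq_add_one, PR.eval_prec_succ] at hval hlt
      rw [hval, canon_pr]
      · simp only [hcons, hp, hz]
      · simpa only [hcons, hp, hz] using hr'.2
      · simpa only [hcons, hp, hz] using hlt

theorem canon_allOk {k : ℕ} (hK : 0 < K) (c : PR k) : c.AllOk (canon e n t w) := by
  induction c with
  | zero => exact canon_ok hK _
  | succ => exact canon_ok hK _
  | get i => exact canon_ok hK _
  | comp f g ihf ihg => exact ⟨canon_ok hK _, ihf, ihg⟩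
  | prec f g ihf ihg => exact ⟨canon_ok hK _, ihf, ihg⟩

theorem canon_orderOk (hK : 0 < K) (hn : n ≤ K) : OrderOk (canon e n t w) fun b => n ≤ e b := by
  have hc : (e (canon e n t w .card ![]) : ℕ) = n := by
    simp only [canon, val_point hn]
  refine ⟨fun a => ?_, fun a b c => ?_, fun a b => ?_, ?_, hc.ge, fun b => ?_, fun b => ?_,
    fun a c h => ?_⟩
  · simp [canon_lt hK]
  · simpa only [canon_lt hK] using lt_trans
  · rw [canon_lt hK, canon_lt hK]
    rcases lt_trichotomy (e a : ℕ) (e b) with h | h | h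
    · exact Or.inl h
    · exact Or.inr (Or.inl (eq_of_val h))
    · exact Or.inr (Or.inr h)
  · exact canon_ne_top.2 ⟨trivial, hK⟩
  · rw [ne_eq, canon_lt hK, hc]
    omega
  · rw [canon_lt hK, hc]
    omega
  · have : (e a : ℕ) ≠ 0 := fun h0 => h (eq_of_val (h0.trans (canon_zero hK).symm))
    rw [canon_lt hK, canon_lt hK, canon_lt hK, val_canon_pred]
    omega

end

/-! ### The axioms describe accepted models -/

/-- A quantifier-free formula defines a property of models by means of fresh points and
function variables. -/
def QF.Defines {L : FirstOrder.Language.{u, v}} [L.IsRelational] (φ : QF L) {A : Type w}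
    (I : L.Structure A) : Prop :=
  ∃ (m : ℕ) (F : Interp (A ⊕ Fin (m + 1))),
    (∀ b, F .chi ![b] = F .tt ![] ↔ b ∈ Set.range Sum.inr) ∧
      φ.Valid (bloat I (Fin (m + 1))) F

section
variable {L : FirstOrder.Language.{u, v}} [L.IsRelational] {A : Type w} (I : L.Structure A)

theorem bloat_relMap_inl {S : Type} {k : ℕ} {R : L.Relations k} {a : Fin k → A} :
    (bloat I S).RelMap R (Sum.inl ∘ a) ↔ I.RelMap R a := by
  constructor
  · rintro ⟨b, hb, h⟩
    rwa [← Sum.inl_injective.comp_left hb] at h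
  · exact fun h => ⟨a, rfl, h⟩

theorem exists_comp_inl {S : Type} {k : ℕ} (b : Fin k → A ⊕ S)
    (h : ∀ i, b i ∉ Set.range (Sum.inr : S → A ⊕ S)) : ∃ a : Fin k → A, b = Sum.inl ∘ a := by
  have : ∀ i, ∃ a, b i = Sum.inl a := by
    intro i
    cases hb : b i with
    | inl a => exact ⟨a, rfl⟩
    | inr s => exact absurd ⟨s, hb.symm⟩ (h i)
  choose a ha using this
  exact ⟨a, funext ha⟩

/-- From an interpretation, the ranks of old points, of `code` and of `wit` give the numbers.
Conversely, finitely many computations matter, so some number of fresh points accommodates all of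
them. -/
theorem QF.defines_axioms [Finite A] {cacc : PR 3} {rels : List (Σ k, L.Relations k)}
    {cbit : ∀ q : Σ k, L.Relations k, PR (q.1 + 1)} :
    (axioms cacc rels cbit).Defines I ↔ ∃ (n : ℕ) (o : Fin n ≃ A) (t w : ℕ),
      cacc.eval ![n, t, w] = 0 ∧ ∀ q ∈ rels, ∀ a, I.RelMap q.2 a ↔
        (cbit q).eval (Fin.cons t fun i => (o.symm (a i) : ℕ)) = 0 := by
  constructor
  · rintro ⟨m, F, hF, hv⟩
    obtain ⟨ho, hz, hacc, hacc', hrel⟩ := (valid_axioms hF).1 hv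
    have hz0 := rank_zero hz
    have hn : rank F (F .card ![]) = Nat.card A := by
      rw [ho.rank_card, ← Set.ncard_range_of_injective (Sum.inl_injective (α := A) (β := Fin (m + 1)))]
      congr 1
      ext b
      cases b <;> simp
    have hlt : ∀ a : A, rank F (.inl a) < Nat.card A := fun a => by
      rw [← hn]
      exact ho.rank_lt (ho.lt_card _ (by simp))
    -- The old points lie below `card`, whose rank is the size of `A`; hence their ranks enumerate
    -- `A`.
    let f : A → Fin (Nat.card A) := fun a => ⟨rank F (.inl a), hlt a⟩
    have hf : Function.Bijective f := by
      refine Function.Injective.bijective_of_nat_card_le (fun a b h => ?_) (by simp)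
      exact Sum.inl_injective (ho.rank_injective (congrArg Fin.val h))
    refine ⟨Nat.card A, (Equiv.ofBijective f hf).symm, rank F (F .code ![]), rank F (F .wit ![]),
      ?_, fun q hq a => ?_⟩
    · have := hacc.eval_eq_rank ho hz ![F .card ![], F .code ![], F .wit ![] ]
        (by rw [hacc']; exact ho.zero_ne_top)
      rw [hacc', hz0] at this
      refine Eq.trans (congrArg cacc.eval ?_) this
      rw [← hn]
      ext i
      fin_cases i <;> rfl
    · have h1 := (hrel q hq).2 (Sum.inl ∘ a)
      rw [bloat_relMap_inl] at h1
      have h2 := (hrel q hq).1.eval_eq_rank ho hz (Fin.cons (F .code ![]) (Sum.inl ∘ a))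
      have h3 : rank F ∘ (Fin.cons (F .code ![]) (Sum.inl ∘ a) : Fin (q.1 + 1) → A ⊕ Fin (m + 1)) =
          Fin.cons (rank F (F .code ![])) fun i => rank F (.inl (a i)) := by
        ext i
        cases i using Fin.cases <;> rfl
      rw [h3] at h2
      change _ ↔ (cbit q).eval (Fin.cons _ fun i => rank F (.inl (a i))) = 0
      constructor
      · intro hR
        rw [h2 (by rw [h1.1 hR]; exact ho.zero_ne_top), h1.1 hR, hz0]
      · intro he
        by_contra hR
        obtain ⟨h4, h5⟩ := h1.2 hR (by simp)
        rw [h2 h5] at he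
        exact h4 (ho.rank_injective (he.trans hz0.symm))
  · rintro ⟨n, o, t, w, hacc, hrel⟩
    have hev : ∀ᶠ K in Filter.atTop, (0 < K ∧ t ≤ K ∧ w ≤ K ∧ cacc.Good K ![n, t, w]) ∧
        ∀ q ∈ {q | q ∈ rels}, ∀ a : Fin q.1 → A,
          (cbit q).Good K (Fin.cons t fun i => (o.symm (a i) : ℕ)) ∧
          (cbit q).eval (Fin.cons t fun i => (o.symm (a i) : ℕ)) < K := by
      refine ((Filter.eventually_gt_atTop 0).and ((Filter.eventually_ge_atTop t).and
        ((Filter.eventually_ge_atTop w).and (PR.eventually_good _ _)))).and ?_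
      refine (List.finite_toSet rels).eventually_all.2 fun q _ => Filter.eventually_all.2 fun a => ?_
      exact (PR.eventually_good _ _).and (Filter.eventually_gt_atTop _)
    -- The bound is `K = n + m`: with `m + 1` fresh points the domain has `K + 1` elements.
    obtain ⟨m, ⟨hK, ht, hw, hgood⟩, hbit⟩ :=
      ((Filter.tendsto_add_atTop_nat n).eventually hev).exists
    rw [add_comm m n] at hK ht hw hgood hbit
    -- Old points come first, in the order `o`, so that being fresh means having a number at least
    -- `n`.
    let e : A ⊕ Fin (m + 1) ≃ Fin (n + m + 1) :=
      (Equiv.sumCongr o.symm (Equiv.refl _)).trans finSumFinEquiv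
    have hl : ∀ a, (e (.inl a) : ℕ) = o.symm a := fun a => rfl
    have hr : ∀ i, (e (.inr i) : ℕ) = n + i := fun i => rfl
    have hfr : ∀ b : A ⊕ Fin (m + 1), n ≤ e b ↔ b ∈ Set.range Sum.inr := by
      rintro (a | i)
      · simp [hl]
      · simp [hr]
    have ha : ∀ x : ℕ, x ≤ n + m → (e (point e x) : ℕ) = x := fun x hx => val_point hx
    refine ⟨m, canon e n t w, fun b => (canon_chi hK).trans (hfr b), ?_⟩
    refine (valid_axioms fun b => canon_chi hK).2 ⟨canon_orderOk hK (by omega), canon_ok hK _,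
      canon_allOk hK _, ?_, fun q hq => ⟨canon_allOk hK _, fun b => ?_⟩⟩
    · have hval : (fun i => (e (![canon e n t w .card ![], canon e n t w .code ![],
          canon e n t w .wit ![] ] i) : ℕ)) = ![n, t, w] := by
        ext i
        fin_cases i
        · exact ha n (by omega)
        · exact ha t ht
        · exact ha w hw
      apply eq_of_val (e := e)
      rw [canon_zero hK, canon_pr, hval, hacc]
      · rwa [hval]
      · rw [hval, hacc]
        exact hK
    · have hval : ∀ a : Fin q.1 → A, (fun i => (e ((Fin.cons (canon e n t w .code ![])
          (Sum.inl ∘ a) : Fin (q.1 + 1) → A ⊕ Fin (m + 1)) i) : ℕ)) =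
          Fin.cons t fun i => (o.symm (a i) : ℕ) := by
        intro a
        ext i
        cases i using Fin.cases with
        | zero => exact ha t ht
        | succ i => rfl
      constructor
      · rintro ⟨a, rfl, h⟩
        apply eq_of_val (e := e)
        rw [canon_zero hK, canon_pr, hval]
        · exact (hrel q hq a).1 h
        · rw [hval]
          exact (hbit q hq a).1
        · rw [hval]
          exact (hbit q hq a).2
      · intro hR hb
        obtain ⟨a, rfl⟩ := exists_comp_inl b fun i => by
          rw [← hfr]
          exact hb i
        rw [bloat_relMap_inl, hrel q hq a] at hR
        refine ⟨fun h => hR ?_, canon_ne_top.2 ?_⟩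
        · rw [← hval, ← canon_pr (n := n) (t := t) (w := w), h, canon_zero hK]
          · rw [hval]
            exact (hbit q hq a).1
          · rw [hval]
            exact (hbit q hq a).2
        · rw [hval]
          exact hbit q hq a

end


/-! ### Variables and symbols -/

section
variable {L : FirstOrder.Language.{u, v}} {B : Type w}

/-- All variables of the term are below this bound. -/
def Tm.bound : Tm → ℕ
  | .var j => j + 1
  | .app _ σ => Finset.univ.sup fun i => σ i + 1

/-- The function symbols of a term with the variables to which they are applied. -/
def Tm.apps : Tm → List (Σ k, Name k × (Fin k → ℕ))
  | .var _ => []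
  | .app f σ => [⟨_, f, σ⟩]

theorem Tm.eval_congr {F : Interp B} {x y : ℕ → B} {t : Tm} (h : ∀ j < t.bound, x j = y j) :
    t.eval F x = t.eval F y := by
  cases t with
  | var j => exact h j (Nat.lt_succ_self j)
  | app f σ =>
    refine congrArg (F f) (funext fun i => h _ ?_)
    exact Finset.le_sup (f := fun i => σ i + 1) (Finset.mem_univ i)

namespace QF

def bound : QF L → ℕ
  | fls => 0
  | eq s t => max s.bound t.bound
  | rel _ σ => Finset.univ.sup fun i => σ i + 1
  | imp φ ψ => max φ.bound ψ.bound

def apps : QF L → List (Σ k, Name k × (Fin k → ℕ))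
  | fls => []
  | eq s t => s.apps ++ t.apps
  | rel _ _ => []
  | imp φ ψ => φ.apps ++ ψ.apps

theorem eval_congr {I : L.Structure B} {F : Interp B} {x y : ℕ → B} {φ : QF L}
    (h : ∀ j < φ.bound, x j = y j) : φ.eval I F x ↔ φ.eval I F y := by
  induction φ with
  | fls => rfl
  | eq s t =>
    rw [eval_eq, eval_eq, Tm.eval_congr fun j hj => h j (lt_max_of_lt_left hj),
      Tm.eval_congr fun j hj => h j (lt_max_of_lt_right hj)]
  | rel R σ =>
    have : x ∘ σ = y ∘ σ := by
      funext i
      exact h _ (Finset.le_sup (f := fun i => σ i + 1) (Finset.mem_univ i))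
    rw [eval_rel, eval_rel, this]
  | imp φ ψ ihf ihg =>
    rw [eval_imp, eval_imp, ihf fun j hj => h j (lt_max_of_lt_left hj),
      ihg fun j hj => h j (lt_max_of_lt_right hj)]

end QF

end

/-! ### Translation into `L_RE` -/

section
variable {L : FirstOrder.Language.{u, v}} {B : Type w}

open FirstOrder.Language

/-- The arities of the relation variables for the graphs of function symbols. -/
abbrev graphArity (ns : List (Σ k, Name k)) (i : Fin ns.length) : ℕ := (ns.get i).1 + 1

/-- The language with relation variables for the graphs of function symbols. -/
abbrev graphLanguage (L : FirstOrder.Language.{u, v}) (ns : List (Σ k, Name k)) :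
    FirstOrder.Language.{u, v} :=
  (L.sum vocabularyY).sum (relVocabulary (graphArity ns))

/-- The relation variables are interpreted by the graphs. -/
def IsGraph (ns : List (Σ k, Name k)) (F : Interp B)
    (J : (relVocabulary (graphArity ns)).Structure B) : Prop :=
  ∀ i (v : Fin (graphArity ns i) → B),
    J.RelMap (⟨i, rfl⟩ : (relVocabulary (graphArity ns)).Relations _) v ↔
      F (ns.get i).2 (Fin.init v) = v (Fin.last _)

theorem IsGraph.relMap {ns : List (Σ k, Name k)} {F : Interp B}
    {J : (relVocabulary (graphArity ns)).Structure B} (h : IsGraph ns F J) {k : ℕ} {f : Name k}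
    {i : Fin ns.length} (hi : ns.get i = ⟨k, f⟩) (h' : graphArity ns i = k + 1)
    (v : Fin (k + 1) → B) :
    J.RelMap (⟨i, h'⟩ : (relVocabulary (graphArity ns)).Relations _) v ↔
      F f (Fin.init v) = v (Fin.last _) := by
  obtain ⟨rfl, hf⟩ := Sigma.mk.inj_iff.1 hi
  rw [← eq_of_heq hf]
  exact h i v

/-- The relation variable for a graph. -/
def graphSymbol (L : FirstOrder.Language.{u, v}) (ns : List (Σ k, Name k)) {k : ℕ}
    (i : Fin ns.length) (h : graphArity ns i = k) : (graphLanguage L ns).Relations k :=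
  Sum.inr ⟨i, h⟩

/-- A symbol of the original vocabulary. -/
def oldSymbol (ns : List (Σ k, Name k)) {k : ℕ} (R : L.Relations k) :
    (graphLanguage L ns).Relations k :=
  Sum.inl (Sum.inl R)

/-- The symbol for the set of fresh points. -/
def freshSymbol (L : FirstOrder.Language.{u, v}) (ns : List (Σ k, Name k)) :
    (graphLanguage L ns).Relations 1 :=
  Sum.inl (Sum.inr ⟨0, rfl⟩)

open Classical in
/-- The formula that expresses that the last free variable is the value of a term. -/
noncomputable def Tm.toFormula (ns : List (Σ k, Name k)) (m : ℕ) :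
    Tm → (graphLanguage L ns).Formula ((Empty ⊕ Fin (m + 1)) ⊕ Unit)
  | .var j => Term.equal (.var (.inl (.inr (Fin.ofNat (m + 1) j)))) (.var (.inr ()))
  | .app (k := k) f σ =>
      if h : ∃ i, ns.get i = ⟨k, f⟩ then
        Relations.formula (n := k + 1) (graphSymbol L ns h.choose (by rw [graphArity, h.choose_spec]))
          (Fin.snoc (fun i => .var (.inl (.inr (Fin.ofNat (m + 1) (σ i))))) (.var (.inr ())))
      else ⊥

noncomputable def QF.toFormula (ns : List (Σ k, Name k)) (m : ℕ) :
    QF L → (graphLanguage L ns).Formula (Empty ⊕ Fin (m + 1))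
  | fls => ⊥
  -- Only graphs are available, so equality of terms becomes the existence of a common value.
  | eq s t => (s.toFormula ns m ⊓ t.toFormula ns m).iExs Unit
  | rel R σ => Relations.formula (oldSymbol ns R) fun i =>
      .var (.inr (Fin.ofNat (m + 1) (σ i)))
  | imp φ ψ => (φ.toFormula ns m).imp (ψ.toFormula ns m)

variable {ns : List (Σ k, Name k)} {F : Interp B} {m : ℕ}

theorem Tm.realize_toFormula [IY : (L.sum vocabularyY).Structure B]
    [J : (relVocabulary (graphArity ns)).Structure B] (hJ : IsGraph ns F J) {t : Tm}
    (ht : ∀ p ∈ t.apps, (⟨p.1, p.2.1⟩ : Σ k, Name k) ∈ ns) {y : Fin (m + 1) → B} {b : Unit → B} :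
    (t.toFormula (L := L) ns m).Realize (Sum.elim (Sum.elim Empty.elim y) b) ↔
      t.eval F (fun j => y (Fin.ofNat (m + 1) j)) = b () := by
  cases t with
  | var j => simp [Tm.toFormula, Formula.realize_equal]
  | @app k f σ =>
    have h : ∃ i, ns.get i = ⟨k, f⟩ := List.mem_iff_get.1 (ht ⟨k, f, σ⟩ (List.mem_singleton_self _))
    rw [Tm.toFormula, dif_pos h, Formula.realize_rel, Tm.eval_app]
    refine (hJ.relMap h.choose_spec (by rw [graphArity, h.choose_spec]) _).trans ?_
    have h1 : (fun i => ((Fin.snoc (α := fun _ => (graphLanguage L ns).Term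
        ((Empty ⊕ Fin (m + 1)) ⊕ Unit)) (fun i => .var (.inl (.inr (Fin.ofNat (m + 1) (σ i)))))
        (.var (.inr ()))) i).realize (Sum.elim (Sum.elim Empty.elim y) b)) =
        Fin.snoc (α := fun _ => B) (fun i => y (Fin.ofNat (m + 1) (σ i))) (b ()) := by
      ext i
      cases i using Fin.lastCases <;> simp
    rw [h1, Fin.init_snoc, Fin.snoc_last]
    rfl

theorem QF.realize_toFormula {I : L.Structure B} [IY : vocabularyY.Structure B]
    [J : (relVocabulary (graphArity ns)).Structure B] (hJ : IsGraph ns F J) {φ : QF L}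
    (hφ : ∀ p ∈ φ.apps, (⟨p.1, p.2.1⟩ : Σ k, Name k) ∈ ns) {y : Fin (m + 1) → B} :
    (φ.toFormula ns m).Realize (Sum.elim Empty.elim y) ↔
      φ.eval I F fun j => y (Fin.ofNat (m + 1) j) := by
  induction φ with
  | fls => simp [QF.toFormula, QF.eval]
  | eq s t =>
    simp only [QF.toFormula, Formula.realize_iExs, Formula.realize_inf]
    have hs := fun b => Tm.realize_toFormula (L := L) (m := m) hJ (t := s) (y := y) (b := b)
      fun p hp => hφ p (List.mem_append_left _ hp)
    have ht := fun b => Tm.realize_toFormula (L := L) (m := m) hJ (t := t) (y := y) (b := b)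
      fun p hp => hφ p (List.mem_append_right _ hp)
    simp only [hs, ht, eval_eq]
    constructor
    · rintro ⟨b, h1, h2⟩
      exact h1.trans h2.symm
    · intro h
      exact ⟨fun _ => _, rfl, h.symm⟩
  | rel R σ =>
    rw [QF.toFormula, Formula.realize_rel]
    rfl
  | imp φ ψ ihf ihg =>
    simp only [QF.toFormula, Formula.realize_imp, eval_imp]
    rw [ihf fun p hp => hφ p (List.mem_append_left _ hp),
      ihg fun p hp => hφ p (List.mem_append_right _ hp)]

/-- The formula that expresses that a relation variable is the graph of a function. -/
noncomputable def functional (L : FirstOrder.Language.{u, v}) (ns : List (Σ k, Name k))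
    (i : Fin ns.length) : (graphLanguage L ns).Sentence :=
  Formula.iAlls (Fin (ns.get i).1) (Formula.iExsUnique Unit
    (Relations.formula (n := graphArity ns i) (graphSymbol L ns i rfl)
      (Fin.snoc (fun j => .var (.inl (.inr j))) (.var (.inr ())))))

theorem realize_functional [IY : (L.sum vocabularyY).Structure B]
    [J : (relVocabulary (graphArity ns)).Structure B] {i : Fin ns.length} :
    B ⊨ functional L ns i ↔ ∀ x : Fin (ns.get i).1 → B, ∃! b : B,
      J.RelMap (⟨i, rfl⟩ : (relVocabulary (graphArity ns)).Relations _)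
        (Fin.snoc (α := fun _ => B) x b) := by
  rw [Sentence.Realize, functional, Formula.realize_iAlls]
  refine forall_congr' fun x => ?_
  rw [Formula.realize_iExsUnique]
  have h1 : ∀ b : Unit → B, (Relations.formula (L := graphLanguage L ns)
      (n := graphArity ns i) (graphSymbol L ns i rfl)
      (Fin.snoc (fun j => .var (.inl (.inr j))) (.var (.inr ())))).Realize
        (Sum.elim (Sum.elim (default : Empty → B) x) b) ↔
      J.RelMap (⟨i, rfl⟩ : (relVocabulary (graphArity ns)).Relations _)
        (Fin.snoc (α := fun _ => B) x (b ())) := by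
    intro b
    rw [Formula.realize_rel]
    have : (fun j => ((Fin.snoc (α := fun _ => (graphLanguage L ns).Term
        ((Empty ⊕ Fin (ns.get i).1) ⊕ Unit)) (fun j => .var (.inl (.inr j)))
        (.var (.inr ()))) j).realize (Sum.elim (Sum.elim (default : Empty → B) x) b)) =
        Fin.snoc (α := fun _ => B) x (b ()) := by
      ext j
      cases j using Fin.lastCases <;> simp
    rw [this]
    rfl
  simp only [h1]
  exact (Equiv.funUnique Unit B).existsUnique_congr (by intro b; rfl)

/-- The formula that expresses that `φ` holds and that the fresh points are described correctly. -/
noncomputable def QF.body (ns : List (Σ k, Name k)) (φ : QF L) :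
    (graphLanguage L ns).Formula (Empty ⊕ Fin (φ.bound + 1)) :=
  φ.toFormula ns φ.bound ⊓ ((fresh 0 : QF L).toFormula ns φ.bound).iff
    (Relations.formula (n := 1) (freshSymbol L ns) fun _ => .var (.inr 0))

theorem QF.realize_body {I : L.Structure B} [IY : vocabularyY.Structure B]
    [J : (relVocabulary (graphArity ns)).Structure B] (hJ : IsGraph ns F J) {φ : QF L}
    (hφ : ∀ p ∈ φ.apps, (⟨p.1, p.2.1⟩ : Σ k, Name k) ∈ ns)
    (hchi : ⟨1, .chi⟩ ∈ ns) (htt : ⟨0, .tt⟩ ∈ ns) :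
    B ⊨ (φ.body ns).iAlls (Fin (φ.bound + 1)) ↔
      (∀ b, F .chi ![b] = F .tt ![] ↔
        IY.RelMap (⟨0, rfl⟩ : vocabularyY.Relations 1) fun _ => b) ∧ φ.Valid I F := by
  rw [Sentence.Realize, Formula.realize_iAlls]
  have hc : ∀ p ∈ (fresh 0 : QF L).apps, (⟨p.1, p.2.1⟩ : Σ k, Name k) ∈ ns := by
    simp [QF.apps, Tm.apps, hchi, htt]
  have key : ∀ y : Fin (φ.bound + 1) → B,
      (φ.body ns).Realize (Sum.elim (default : Empty → B) y) ↔
        φ.eval I F (fun j => y (Fin.ofNat (φ.bound + 1) j)) ∧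
        (F .chi ![y 0] = F .tt ![] ↔ IY.RelMap (⟨0, rfl⟩ : vocabularyY.Relations 1) fun _ => y 0) := by
    intro y
    have h0 : (default : Empty → B) = Empty.elim := Subsingleton.elim _ _
    rw [body, Formula.realize_inf, Formula.realize_iff, h0, realize_toFormula hJ hφ,
      realize_toFormula (I := I) hJ hc, Formula.realize_rel, eval_eq, Tm.eval_app, Tm.eval_app,
      comp_elim0, comp_vec_one]
    rfl
  refine (forall_congr' key).trans ?_
  rw [forall_and, and_comm]
  -- The formula looks only at variables below `φ.bound`, so finitely many quantifiers suffice; the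
  -- extra one ensures that variable `0` exists.
  refine and_congr ⟨fun h b => h fun _ => b, fun h y => h _⟩ ⟨fun h x => ?_, fun h y => h _⟩
  refine (eval_congr fun j hj => ?_).1 (h fun i => x i)
  simp [Nat.mod_eq_of_lt (Nat.lt_succ_of_lt hj)]

theorem QF.realize_lre [IL : L.Structure B] [IY : vocabularyY.Structure B]
    [J : (relVocabulary (graphArity ns)).Structure B] {φ : QF L} :
    B ⊨ ((Formula.iInf fun i => functional L ns i) ⊓
        (φ.body ns).iAlls (Fin (φ.bound + 1)) : (graphLanguage L ns).Sentence) ↔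
      (∀ (i : Fin ns.length) (x : Fin (ns.get i).1 → B), ∃! b,
        J.RelMap (⟨i, rfl⟩ : (relVocabulary (graphArity ns)).Relations _)
          (Fin.snoc (α := fun _ => B) x b)) ∧
      B ⊨ (φ.body ns).iAlls (Fin (φ.bound + 1)) := by
  rw [Sentence.Realize, Formula.realize_inf, Formula.realize_iInf]
  exact and_congr (forall_congr' fun i => realize_functional) Iff.rfl

-- Graphs are indexed by positions in the list. The absence of duplicates ensures that no symbol is
-- given two graphs.
open Classical in
theorem exists_isGraph [Nonempty B] {J : (relVocabulary (graphArity ns)).Structure B}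
    (hn : ns.Nodup) (hJ : ∀ (i : Fin ns.length) (x : Fin (ns.get i).1 → B), ∃! b : B,
      J.RelMap (⟨i, rfl⟩ : (relVocabulary (graphArity ns)).Relations _)
        (Fin.snoc (α := fun _ => B) x b)) : ∃ F : Interp B, IsGraph ns F J := by
  choose G hG hG' using hJ
  let F : Interp B := fun k f x =>
    if h : ∃ i, ns.get i = ⟨k, f⟩ then
      G h.choose fun j => x (Fin.cast (congrArg Sigma.fst h.choose_spec) j)
    else Classical.arbitrary _
  have hF : ∀ i x, F (ns.get i).2 x = G i x := by
    intro i x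
    have h : ∃ j, ns.get j = ⟨(ns.get i).1, (ns.get i).2⟩ := ⟨i, rfl⟩
    have h2 : ∀ (j : Fin ns.length) (hj : ns.get j = ns.get i),
        (G j fun l => x (Fin.cast (congrArg Sigma.fst hj) l)) = G i x := by
      intro j hj
      obtain rfl := List.nodup_iff_injective_get.1 hn hj
      rfl
    simp only [F]
    rw [dif_pos h]
    exact h2 _ h.choose_spec
  refine ⟨F, fun i v => ?_⟩
  rw [hF, ← Fin.snoc_init_self v, Fin.init_snoc, Fin.snoc_last]
  exact ⟨fun h => (hG' i _ _ h).symm, fun h => h ▸ hG i _⟩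

open Classical in
/-- Every definable property of finite models is expressed by a sentence of `L_RE`. -/
theorem QF.exists_lre [L.IsRelational] (φ : QF L) :
    ∃ χ : LRE L, ∀ M : FinModel.{u, v, w} L, χ.Holds M ↔ φ.Defines M.str := by
  -- `chi` and `tt` are included even if `φ` does not mention them, because the clause for `Y` uses
  -- them.
  let ns : List (Σ k, Name k) :=
    (⟨1, .chi⟩ :: ⟨0, .tt⟩ :: φ.apps.map fun p => ⟨p.1, p.2.1⟩).dedup
  have hchi : ⟨1, .chi⟩ ∈ ns := by simp [ns]
  have htt : ⟨0, .tt⟩ ∈ ns := by simp [ns]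
  have hφ : ∀ p ∈ φ.apps, (⟨p.1, p.2.1⟩ : Σ k, Name k) ∈ ns := by
    intro p hp
    exact List.mem_dedup.2
      (List.mem_cons_of_mem _ (List.mem_cons_of_mem _ (List.mem_map_of_mem hp)))
  refine ⟨⟨⟨ns.length, graphArity ns,
    (Formula.iInf fun i => functional L ns i) ⊓ (φ.body ns).iAlls (Fin (φ.bound + 1))⟩⟩, fun M => ?_⟩
  obtain ⟨A, I, hfin, hne⟩ := M
  refine exists_congr fun n => ?_
  have key := fun J => @realize_lre L (A ⊕ Fin (n + 1)) ns (bloat I _) (freshY A _) J φ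
  constructor
  · rintro ⟨J, hJ⟩
    obtain ⟨h1, h2⟩ := (key J).1 hJ
    obtain ⟨F, hF⟩ := exists_isGraph (List.nodup_dedup _) h1
    exact ⟨F, (@realize_body L _ ns F (bloat I _) (freshY A _) J hF φ hφ hchi htt).1 h2⟩
  · rintro ⟨F, hF⟩
    let J : (relVocabulary (graphArity ns)).Structure (A ⊕ Fin (n + 1)) :=
      { funMap := fun {_} f _ => Empty.elim f
        RelMap := fun {_} R v =>
          F (ns.get R.1).2 (fun j => v (Fin.cast R.2 j.castSucc)) = v (Fin.cast R.2 (Fin.last _)) }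
    have hJ : IsGraph ns F J := fun i v => Iff.rfl
    refine ⟨J, (key J).2 ⟨fun i x => ?_,
      (@realize_body L _ ns F (bloat I _) (freshY A _) J hJ φ hφ hchi htt).2 hF⟩⟩
    simp [hJ i _]

end


/-! ### Blocks of quantifiers in team semantics -/

/-- The values of the variables `a, …, a + k - 1` are replaced by those of `x`. -/
def Assignment.extend {B : Type w} (s : Assignment B) (a k : ℕ) (x : ℕ → B) : Assignment B :=
  fun v => if a ≤ v ∧ v < a + k then some (x v) else s v

theorem Assignment.extend_zero {B : Type w} (s : Assignment B) (a : ℕ) (x : ℕ → B) :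
    s.extend a 0 x = s := by
  funext v
  have : ¬ (a ≤ v ∧ v < a + 0) := by omega
  simp [Assignment.extend]

theorem Assignment.set_extend {B : Type w} (s : Assignment B) (a k : ℕ) (x : ℕ → B) :
    (s.set (x a) a).extend (a + 1) k x = s.extend a (k + 1) x := by
  funext v
  simp only [Assignment.extend, Assignment.set, Function.update_apply]
  by_cases h : v = a
  · subst h; simp
  · have : (a + 1 ≤ v ∧ v < a + 1 + k) ↔ (a ≤ v ∧ v < a + (k + 1)) := by omega
    simp only [this, h, if_false]

theorem Assignment.extend_congr {B : Type w} (s : Assignment B) {a k : ℕ} {x y : ℕ → B}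
    (h : ∀ v, a ≤ v → x v = y v) : s.extend a k x = s.extend a k y := by
  funext v
  simp only [Assignment.extend]
  split_ifs with hv
  · rw [h v hv.1]
  · rfl

namespace DStar

variable {L : FirstOrder.Language.{u, v}}

def alls (a : ℕ) : ℕ → DStar L → DStar L
  | 0, ψ => ψ
  | k + 1, ψ => all a (alls (a + 1) k ψ)

def exs (a : ℕ) : ℕ → DStar L → DStar L
  | 0, ψ => ψ
  | k + 1, ψ => ex a (exs (a + 1) k ψ)

theorem freeVars_alls (a k : ℕ) (ψ : DStar L) :
    (alls a k ψ).freeVars = ψ.freeVars \ Set.Ico a (a + k) := by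
  induction k generalizing a with
  | zero => simp [alls]
  | succ k ih =>
    ext v
    simp only [alls, freeVars, ih, Set.mem_sdiff, Set.mem_Ico, Set.mem_singleton_iff]
    have : (¬ (a + 1 ≤ v ∧ v < a + 1 + k) ∧ ¬ v = a) ↔ ¬ (a ≤ v ∧ v < a + (k + 1)) := by omega
    rw [and_assoc, this]

theorem freeVars_exs (a k : ℕ) (ψ : DStar L) :
    (exs a k ψ).freeVars = ψ.freeVars \ Set.Ico a (a + k) := by
  induction k generalizing a with
  | zero => simp [exs]
  | succ k ih =>
    ext v
    simp only [exs, freeVars, ih, Set.mem_sdiff, Set.mem_Ico, Set.mem_singleton_iff]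
    have : (¬ (a + 1 ≤ v ∧ v < a + 1 + k) ∧ ¬ v = a) ↔ ¬ (a ≤ v ∧ v < a + (k + 1)) := by omega
    rw [and_assoc, this]

/-- Conjunctions of a list of formulas with a last formula. -/
def conjs (ψ : DStar L) (l : List (DStar L)) : DStar L := l.foldr and ψ

theorem freeVars_conjs {ψ : DStar L} {l : List (DStar L)} {N : Set ℕ} (h : ψ.freeVars ⊆ N)
    (hl : ∀ φ ∈ l, φ.freeVars ⊆ N) : (conjs ψ l).freeVars ⊆ N := by
  induction l with
  | nil => exact h
  | cons φ l ih =>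
    simp only [List.mem_cons, forall_eq_or_imp] at hl
    exact Set.union_subset hl.1 (ih hl.2)

variable [L.IsRelational] {B : Type w} {I : L.Structure B}

theorem sat_alls [Nonempty B] (a k : ℕ) (ψ : DStar L) (U : Team B) : (alls a k ψ).Sat B I U ↔
    ψ.Sat B I {t | ∃ s ∈ U, ∃ x : ℕ → B, t = s.extend a k x} := by
  induction k generalizing a U with
  | zero =>
    simp [alls, Assignment.extend_zero]
  | succ k ih =>
    rw [alls, Sat, ih]
    have : {t | ∃ s ∈ U.modify (fun _ => Set.univ) a, ∃ x : ℕ → B, t = s.extend (a + 1) k x} =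
        {t | ∃ s ∈ U, ∃ x : ℕ → B, t = s.extend a (k + 1) x} := by
      ext t
      constructor
      · rintro ⟨_, ⟨s, hs, b, -, rfl⟩, x, rfl⟩
        refine ⟨s, hs, Function.update x a b, ?_⟩
        rw [← Assignment.set_extend, Function.update_self]
        refine Assignment.extend_congr _ fun v hv => ?_
        rw [Function.update_of_ne (by omega)]
      · rintro ⟨s, hs, x, rfl⟩
        exact ⟨_, ⟨s, hs, x a, trivial, rfl⟩, x, (s.set_extend a k x).symm⟩
    rw [this]

/-- Under lax semantics an assignment may have several extensions. It is enough that each one has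
some extension in `V`, that all members of `V` arise so, and that the block is defined. -/
theorem exists_of_sat_exs (a k : ℕ) (ψ : DStar L) (U : Team B) (h : (exs a k ψ).Sat B I U) :
    ∃ V : Team B, ψ.Sat B I V ∧
      (∀ t ∈ V, ∃ s ∈ U, (∀ v < a, t v = s v) ∧ ∀ v, a ≤ v → v < a + k → (t v).isSome) ∧
      ∀ s ∈ U, ∃ t ∈ V, ∀ v < a, t v = s v := by
  induction k generalizing a U with
  | zero =>
    exact ⟨U, h, fun t ht => ⟨t, ht, fun _ _ => rfl, fun v h1 h2 => by omega⟩,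
      fun s hs => ⟨s, hs, fun _ _ => rfl⟩⟩
  | succ k ih =>
    obtain ⟨f, hf, h⟩ := h
    obtain ⟨V, hV, h1, h2⟩ := ih _ _ h
    have hset : ∀ (s : Assignment B) (b : B), ∀ v < a, s.set b a v = s v := fun s b v hv =>
      Function.update_of_ne (by omega) _ _
    refine ⟨V, hV, fun t ht => ?_, fun s hs => ?_⟩
    · obtain ⟨_, ⟨s, hs, b, hb, rfl⟩, h3, h4⟩ := h1 t ht
      refine ⟨s, hs, fun v hv => (h3 v (by omega)).trans (hset s b v hv), fun v hv hv' => ?_⟩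
      rcases Nat.eq_or_lt_of_le hv with rfl | hv
      · rw [h3 _ (by omega)]
        simp [Assignment.set]
      · exact h4 v hv (by omega)
    · obtain ⟨b, hb⟩ := hf s hs
      obtain ⟨t, ht, h3⟩ := h2 _ ⟨s, hs, b, hb, rfl⟩
      exact ⟨t, ht, fun v hv => (h3 v (by omega)).trans (hset s b v hv)⟩

/-- The quantifiers choose singletons. As `Y` depends only on variables before the block, it does
not change while the block is being filled. -/
theorem sat_exs_of_image {Y : Assignment B → ℕ → B} {a₀ : ℕ}
    (hY : ∀ s s' : Assignment B, (∀ v < a₀, s v = s' v) → Y s = Y s') (a k : ℕ) (ha : a₀ ≤ a)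
    (ψ : DStar L) (U : Team B) (h : ψ.Sat B I ((fun s => s.extend a k (Y s)) '' U)) :
    (exs a k ψ).Sat B I U := by
  induction k generalizing a U with
  | zero => simpa [exs, Assignment.extend_zero] using h
  | succ k ih =>
    refine ⟨fun s => {Y s a}, fun s _ => Set.singleton_nonempty _, ih (a + 1) (by omega) _ ?_⟩
    have hset : ∀ s : Assignment B, Y (s.set (Y s a) a) = Y s := fun s =>
      hY _ _ fun v hv => Function.update_of_ne (by omega) _ _
    have : (fun s => s.extend (a + 1) k (Y s)) '' (U.modify (fun s => {Y s a}) a) =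
        (fun s => s.extend a (k + 1) (Y s)) '' U := by
      ext t
      constructor
      · rintro ⟨_, ⟨s, hs, b, hb, rfl⟩, rfl⟩
        refine ⟨s, hs, ?_⟩
        rw [Set.mem_singleton_iff.1 hb]
        simp only [hset, Assignment.set_extend]
      · rintro ⟨s, hs, rfl⟩
        refine ⟨_, ⟨s, hs, Y s a, rfl, rfl⟩, ?_⟩
        simp only [hset, Assignment.set_extend]
    rwa [this]

theorem sat_conjs {ψ : DStar L} {l : List (DStar L)} {U : Team B} :
    (conjs ψ l).Sat B I U ↔ ψ.Sat B I U ∧ ∀ φ ∈ l, φ.Sat B I U := by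
  induction l with
  | nil => simp [conjs]
  | cons φ l ih =>
    change φ.Sat B I U ∧ (conjs ψ l).Sat B I U ↔ _
    rw [ih]
    simp only [List.mem_cons, forall_eq_or_imp]
    tauto

end DStar

/-! ### Teams in which a block of variables is defined -/

/-- All variables below `N` are in the domain of each assignment of the team. -/
def Team.Full {B : Type w} (N : ℕ) (U : Team B) : Prop := ∀ s ∈ U, ∀ v < N, (s v).isSome

/-- The values of an assignment. -/
noncomputable def Assignment.val {B : Type w} [Nonempty B] (s : Assignment B) (v : ℕ) : B :=
  (s v).getD (Classical.arbitrary B)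

section
variable {L : FirstOrder.Language.{u, v}} {B : Type w} [Nonempty B] {I : L.Structure B}
  {N : ℕ} {U : Team B}

theorem Team.Full.eq_some (hU : U.Full N) {s : Assignment B} (hs : s ∈ U) {v : ℕ} (hv : v < N) :
    s v = some (s.val v) := by
  obtain ⟨b, hb⟩ := Option.isSome_iff_exists.1 (hU s hs v hv)
  simp [Assignment.val, hb]

theorem Team.Full.mono (hU : U.Full N) {V : Team B} (h : V ⊆ U) : V.Full N :=
  fun s hs => hU s (h hs)

theorem Team.Full.mem_rel (hU : U.Full N) {k : ℕ} {x : Fin k → ℕ} (hx : ∀ i, x i < N)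
    {a : Fin k → B} : a ∈ U.Rel x ↔ ∃ s ∈ U, a = s.val ∘ x := by
  constructor
  · rintro ⟨s, hs, h⟩
    refine ⟨s, hs, funext fun i => ?_⟩
    have := h i
    rw [hU.eq_some hs (hx i)] at this
    exact (Option.some_injective _ this).symm
  · rintro ⟨s, hs, rfl⟩
    exact ⟨s, hs, fun i => hU.eq_some hs (hx i)⟩

/-! ### Translation of quantifier-free formulas -/

/-- Truth of a quantifier-free formula when the values of terms are given by variables. -/
def QF.evalVars (I : L.Structure B) (τ : Tm → ℕ) (z : ℕ → B) : QF L → Prop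
  | fls => False
  | eq s t => z (τ s) = z (τ t)
  | rel R σ => I.RelMap R (z ∘ σ)
  | imp φ ψ => φ.evalVars I τ z → ψ.evalVars I τ z

/-- Translation of a formula and of its negation. -/
def QF.toDStar (τ : Tm → ℕ) : Bool → QF L → DStar L
  | true, fls => .neq 0 0
  | false, fls => .eq 0 0
  | true, eq s t => .eq (τ s) (τ t)
  | false, eq s t => .neq (τ s) (τ t)
  | true, rel R σ => .rel R σ
  | false, rel R σ => .nrel R σ
  | true, imp φ ψ => .or (φ.toDStar τ false) (ψ.toDStar τ true)
  | false, imp φ ψ => .and (φ.toDStar τ true) (ψ.toDStar τ false)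

/-- The terms and the variables of atoms of the formula are represented by variables below `N`. -/
def QF.Below (N : ℕ) (τ : Tm → ℕ) : QF L → Prop
  | fls => 0 < N
  | eq s t => τ s < N ∧ τ t < N
  | rel _ σ => ∀ i, σ i < N
  | imp φ ψ => φ.Below N τ ∧ ψ.Below N τ

theorem QF.freeVars_toDStar {τ : Tm → ℕ} {φ : QF L} (h : φ.Below N τ) (b : Bool) :
    (φ.toDStar τ b).freeVars ⊆ Set.Iio N := by
  induction φ generalizing b with
  | fls => cases b <;> simpa [toDStar, DStar.freeVars, Below] using h
  | eq s t =>
    cases b <;>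
      simpa [toDStar, DStar.freeVars, Below, Set.insert_subset_iff] using h
  | rel R σ => cases b <;> exact Set.range_subset_iff.2 h
  | imp φ ψ ihf ihg =>
    cases b
    · exact Set.union_subset (ihf h.1 _) (ihg h.2 _)
    · exact Set.union_subset (ihf h.1 _) (ihg h.2 _)

theorem sat_eq_iff [L.IsRelational] (hU : U.Full N) {x y : ℕ} (hx : x < N) (hy : y < N) :
    (DStar.eq x y : DStar L).Sat B I U ↔ ∀ s ∈ U, s.val x = s.val y := by
  refine forall₂_congr fun s hs => ?_
  simp [hU.eq_some hs hx, hU.eq_some hs hy, eq_comm]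

theorem sat_neq_iff [L.IsRelational] (hU : U.Full N) {x y : ℕ} (hx : x < N) (hy : y < N) :
    (DStar.neq x y : DStar L).Sat B I U ↔ ∀ s ∈ U, s.val x ≠ s.val y := by
  refine forall₂_congr fun s hs => ?_
  simp [hU.eq_some hs hx, hU.eq_some hs hy]

theorem exists_vec_iff (hU : U.Full N) {s : Assignment B} (hs : s ∈ U) {k : ℕ} {x : Fin k → ℕ}
    (hx : ∀ i, x i < N) (P : (Fin k → B) → Prop) :
    (∃ a : Fin k → B, (∀ i, s (x i) = some (a i)) ∧ P a) ↔ P (s.val ∘ x) := by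
  constructor
  · rintro ⟨a, ha, h⟩
    have : a = s.val ∘ x := funext fun i =>
      Option.some_injective _ ((ha i).symm.trans (hU.eq_some hs (hx i)))
    rwa [← this]
  · exact fun h => ⟨_, fun i => hU.eq_some hs (hx i), h⟩

/-- These translations are flat. For an implication the team is split into the assignments that
violate the premise and those that satisfy the conclusion. -/
theorem QF.sat_toDStar [L.IsRelational] {τ : Tm → ℕ} {φ : QF L} (h : φ.Below N τ)
    (hU : U.Full N) :
    ((φ.toDStar τ true).Sat B I U ↔ ∀ s ∈ U, φ.evalVars I τ s.val) ∧
    ((φ.toDStar τ false).Sat B I U ↔ ∀ s ∈ U, ¬ φ.evalVars I τ s.val) := by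
  induction φ generalizing U with
  | fls =>
    simp only [toDStar, sat_eq_iff hU h h, sat_neq_iff hU h h, evalVars]
    simp
  | eq s t => exact ⟨sat_eq_iff hU h.1 h.2, sat_neq_iff hU h.1 h.2⟩
  | rel R σ =>
    exact ⟨forall₂_congr fun s hs => exists_vec_iff hU hs h _,
      forall₂_congr fun s hs => exists_vec_iff hU hs h _⟩
  | imp φ ψ ihf ihg =>
    constructor
    · constructor
      · rintro ⟨U₀, U₁, rfl, h0, h1⟩ s (hs | hs) hφ
        · exact absurd hφ ((ihf h.1 (hU.mono Set.subset_union_left)).2.1 h0 s hs)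
        · exact (ihg h.2 (hU.mono Set.subset_union_right)).1.1 h1 s hs
      · intro hs
        refine ⟨{s ∈ U | ¬ φ.evalVars I τ s.val}, {s ∈ U | ψ.evalVars I τ s.val}, ?_,
          (ihf h.1 (hU.mono fun s hs => hs.1)).2.2 fun s hs => hs.2,
          (ihg h.2 (hU.mono fun s hs => hs.1)).1.2 fun s hs => hs.2⟩
        ext s
        constructor
        · rintro (h | h) <;> exact h.1
        · intro h
          by_cases hφ : φ.evalVars I τ s.val
          · exact Or.inr ⟨h, hs s h hφ⟩
          · exact Or.inl ⟨h, hφ⟩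
    · change _ ∧ _ ↔ _
      rw [(ihf h.1 hU).1, (ihg h.2 hU).2, ← forall₂_and]
      refine forall₂_congr fun s hs => ?_
      simp [evalVars]

end


/-! ### Translation into `D*` -/

/-- A function symbol with the variables to which it is applied. -/
abbrev App : Type := Σ k, Name k × (Fin k → ℕ)

/-- The application of the function symbol to the first variables. -/
def App.std (p : App) : App := ⟨p.1, p.2.1, fun i => i⟩

def App.eval {B : Type w} (F : Interp B) (z : ℕ → B) (p : App) : B := F p.2.1 (z ∘ p.2.2)

section
variable {L : FirstOrder.Language.{u, v}}

/-- `l` contains all relevant applications for `φ`, and they concern variables below `m`. -/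
structure Covers (φ : QF L) (l : List App) (m : ℕ) : Prop where
  bound : φ.bound ≤ m
  pos : 0 < m
  arity : ∀ p ∈ l, p.1 ≤ m
  lt : ∀ p ∈ l, ∀ i, p.2.2 i < m
  chi : ⟨1, .chi, ![0]⟩ ∈ l
  tt : ⟨0, .tt, Fin.elim0⟩ ∈ l
  apps : ∀ p ∈ φ.apps, p ∈ l
  std : ∀ p ∈ l, p.std ∈ l

/-- Standardizing is idempotent, so adding the standard applications once closes the list; any large
`m` then works. -/
theorem exists_covers (φ : QF L) : ∃ l m, Covers φ l m := by
  let l₀ : List App := ⟨1, .chi, ![0]⟩ :: ⟨0, .tt, Fin.elim0⟩ :: φ.apps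
  let l : List App := l₀ ++ l₀.map App.std
  have hev : ∀ᶠ m in Filter.atTop, φ.bound ≤ m ∧ 0 < m ∧
      ∀ p ∈ {p | p ∈ l}, p.1 ≤ m ∧ ∀ i, p.2.2 i < m := by
    refine (Filter.eventually_ge_atTop _).and ((Filter.eventually_gt_atTop 0).and ?_)
    refine (List.finite_toSet l).eventually_all.2 fun p _ => ?_
    exact (Filter.eventually_ge_atTop _).and
      (Filter.eventually_all.2 fun i => Filter.eventually_gt_atTop _)
  obtain ⟨m, h1, h2, h3⟩ := hev.exists
  refine ⟨l, m, h1, h2, fun p hp => (h3 p hp).1, fun p hp => (h3 p hp).2,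
    List.mem_append_left _ (by simp [l₀]), List.mem_append_left _ (by simp [l₀]),
    fun p hp => List.mem_append_left _ (by simp [l₀, hp]), fun p hp => ?_⟩
  rcases List.mem_append.1 hp with hp | hp
  · exact List.mem_append_right _ (List.mem_map_of_mem hp)
  · obtain ⟨q, -, rfl⟩ := List.mem_map.1 hp
    change q.std ∈ l
    exact List.mem_append_right _ hp

open Classical in
/-- The variable for the value of an application. -/
noncomputable def valueVar (l : List App) (m : ℕ) (p : App) : ℕ := m + 1 + l.idxOf p

/-- Layout: the variables below `m` are quantified universally, `m` ranges over the fresh points,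
and the values of the applications occupy the variables from `m + 1` on. -/
noncomputable def termVar (l : List App) (m : ℕ) : Tm → ℕ
  | .var j => j
  | .app f σ => valueVar l m ⟨_, f, σ⟩

theorem valueVar_lt {l : List App} {m : ℕ} {p : App} (hp : p ∈ l) :
    valueVar l m p < m + 1 + l.length := by
  classical
  have := List.idxOf_lt_length_of_mem hp
  simp only [valueVar]
  omega

/-- The value of `f` depends on its arguments. -/
noncomputable def depFormula (L : FirstOrder.Language.{u, v}) (l : List App) (m : ℕ) (p : App) :
    DStar L :=
  .dep (Fin.snoc (α := fun _ => ℕ) (fun i : Fin p.1 => (i : ℕ)) (valueVar l m p.std))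

/-- All applications of `f` yield values of the same function. -/
noncomputable def inclFormula (L : FirstOrder.Language.{u, v}) (l : List App) (m : ℕ) (p : App) :
    DStar L :=
  .incl (Fin.snoc (α := fun _ => ℕ) p.2.2 (valueVar l m p))
    (Fin.snoc (α := fun _ => ℕ) (fun i : Fin p.1 => (i : ℕ)) (valueVar l m p.std))

/-- `chi` is the characteristic function of the set of fresh points. -/
noncomputable def chiFormula (L : FirstOrder.Language.{u, v}) (l : List App) (m : ℕ) : DStar L :=
  .or (.and (.eq (valueVar l m ⟨1, .chi, ![0]⟩) (valueVar l m ⟨0, .tt, Fin.elim0⟩))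
      -- Inclusion says that the marked points are fresh; the exclusion in the other half says that
      -- no fresh point is unmarked.
      (.incl ![0] ![m]))
    (.and (.neq (valueVar l m ⟨1, .chi, ![0]⟩) (valueVar l m ⟨0, .tt, Fin.elim0⟩))
      (.excl ![0] ![m]))

/-- Dependence atoms make the value of each standard application a function of the first variables.
Every argument tuple occurs there, so an inclusion atom can compare any other application with a
standard one. -/
noncomputable def matrix (φ : QF L) (l : List App) (m : ℕ) : DStar L :=
  DStar.conjs (φ.toDStar (termVar l m) true)
    (chiFormula L l m :: (l.map (depFormula L l m) ++ l.map (inclFormula L l m)))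

/-- The sentence of `D*` that expresses the property that is defined by `φ`. -/
noncomputable def QF.dstar (φ : QF L) (l : List App) (m : ℕ) : DStar L :=
  .ix m (.alls 0 m (.exs (m + 1) l.length (matrix φ l m)))

variable {φ : QF L} {l : List App} {m : ℕ}

theorem below_of_apps {l : List App} {m : ℕ} {ψ : QF L} (hb : ψ.bound ≤ m)
    (ha : ∀ p ∈ ψ.apps, p ∈ l) : ψ.Below (m + 1 + l.length) (termVar l m) := by
  induction ψ with
  | fls => simp only [QF.Below]; omega
  | eq s t =>
    have key : ∀ t : Tm, t.bound ≤ m → (∀ p ∈ t.apps, p ∈ l) →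
        termVar l m t < m + 1 + l.length := by
      rintro (j | ⟨f, σ⟩) hb ha
      · simp only [Tm.bound] at hb
        simp only [termVar]
        omega
      · exact valueVar_lt (ha _ (List.mem_singleton_self _))
    exact ⟨key s (le_trans (le_max_left _ _) hb) fun p hp => ha p (List.mem_append_left _ hp),
      key t (le_trans (le_max_right _ _) hb) fun p hp => ha p (List.mem_append_right _ hp)⟩
  | rel R σ =>
    intro i
    have : σ i + 1 ≤ m := (Finset.le_sup (f := fun i => σ i + 1) (Finset.mem_univ i)).trans hb
    change σ i < m + 1 + l.length
    omega
  | imp φ ψ ihf ihg =>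
    exact ⟨ihf (le_trans (le_max_left _ _) hb) fun p hp => ha p (List.mem_append_left _ hp),
      ihg (le_trans (le_max_right _ _) hb) fun p hp => ha p (List.mem_append_right _ hp)⟩

theorem Covers.below (h : Covers φ l m) : φ.Below (m + 1 + l.length) (termVar l m) :=
  below_of_apps h.bound h.apps

theorem snoc_lt {k N : ℕ} {σ : Fin k → ℕ} {y : ℕ} (hσ : ∀ i, σ i < N) (hy : y < N)
    (i : Fin (k + 1)) : (Fin.snoc (α := fun _ => ℕ) σ y : Fin (k + 1) → ℕ) i < N := by
  cases i using Fin.lastCases with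
  | last => simpa using hy
  | cast i => simpa using hσ i

theorem Covers.std_lt (h : Covers φ l m) {p : App} (hp : p ∈ l) (i : Fin (p.1 + 1)) :
    (Fin.snoc (α := fun _ => ℕ) (fun i : Fin p.1 => (i : ℕ)) (valueVar l m p.std) :
      Fin (p.1 + 1) → ℕ) i < m + 1 + l.length :=
  snoc_lt (fun i => by have := h.arity p hp; omega) (valueVar_lt (h.std p hp)) i

theorem Covers.app_lt (h : Covers φ l m) {p : App} (hp : p ∈ l) (i : Fin (p.1 + 1)) :
    (Fin.snoc (α := fun _ => ℕ) p.2.2 (valueVar l m p) : Fin (p.1 + 1) → ℕ) i <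
      m + 1 + l.length :=
  snoc_lt (fun i => by have := h.lt p hp i; omega) (valueVar_lt hp) i

theorem Covers.isSentence (h : Covers φ l m) : (φ.dstar l m).IsSentence := by
  have hm : (matrix φ l m).freeVars ⊆ Set.Iio (m + 1 + l.length) := by
    refine DStar.freeVars_conjs (QF.freeVars_toDStar h.below _) fun ψ hψ => ?_
    simp only [List.mem_cons, List.mem_append, List.mem_map] at hψ
    rcases hψ with rfl | ⟨p, hp, rfl⟩ | ⟨p, hp, rfl⟩
    · have h1 := valueVar_lt (m := m) h.chi
      have h2 := valueVar_lt (m := m) h.tt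
      have h3 := h.pos
      simp [chiFormula, DStar.freeVars, Set.insert_subset_iff, h1, h2]
      omega
    · exact Set.range_subset_iff.2 (h.std_lt hp)
    · exact Set.union_subset (Set.range_subset_iff.2 (h.app_lt hp))
        (Set.range_subset_iff.2 (h.std_lt hp))
  rw [DStar.IsSentence, QF.dstar, DStar.freeVars, DStar.freeVars_alls, DStar.freeVars_exs]
  ext v
  simp only [Set.mem_sdiff, Set.mem_Ico, Set.mem_singleton_iff, Set.mem_empty_iff_false, iff_false]
  rintro ⟨⟨⟨h1, h2⟩, h3⟩, h4⟩
  have := Set.mem_Iio.1 (hm h1)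
  omega

/-! ### Satisfaction of the matrix by rich teams -/

variable {B : Type w} [Nonempty B] {S : Set B} {U : Team B} {F : Interp B}

/-- The variables below `m` take all values independently of the variable `m`, which takes the
values in `S`. -/
structure Rich (N m : ℕ) (S : Set B) (U : Team B) : Prop where
  full : U.Full N
  mem : ∀ s ∈ U, s.val m ∈ S
  exists_mem : ∀ (x : ℕ → B), ∀ b ∈ S, ∃ s ∈ U, (∀ v < m, s.val v = x v) ∧ s.val m = b

theorem evalVars_iff {I : L.Structure B} {z : ℕ → B} {ψ : QF L}
    (h : ∀ p ∈ ψ.apps, z (valueVar l m p) = App.eval F z p) :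
    ψ.evalVars I (termVar l m) z ↔ ψ.eval I F z := by
  induction ψ with
  | fls => rfl
  | eq s t =>
    have key : ∀ t : Tm, (∀ p ∈ t.apps, z (valueVar l m p) = App.eval F z p) →
        z (termVar l m t) = t.eval F z := by
      rintro (j | ⟨f, σ⟩) ha
      · rfl
      · exact ha _ (List.mem_singleton_self _)
    rw [QF.evalVars, QF.eval_eq, key s fun p hp => h p (List.mem_append_left _ hp),
      key t fun p hp => h p (List.mem_append_right _ hp)]
  | rel R σ => rfl
  | imp φ ψ ihf ihg =>
    rw [QF.evalVars, QF.eval_imp, ihf fun p hp => h p (List.mem_append_left _ hp),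
      ihg fun p hp => h p (List.mem_append_right _ hp)]

variable [L.IsRelational] {I : L.Structure B}

theorem sat_depFormula (h : Covers φ l m) (hU : U.Full (m + 1 + l.length)) {p : App} (hp : p ∈ l) :
    (depFormula L l m p).Sat B I U ↔ ∀ s ∈ U, ∀ s' ∈ U, (∀ i : Fin p.1, s.val i = s'.val i) →
      s.val (valueVar l m p.std) = s'.val (valueVar l m p.std) := by
  simp only [depFormula, DStar.Sat, hU.mem_rel (h.std_lt hp)]
  constructor
  · intro h s hs s' hs' he
    have := h _ ⟨s, hs, rfl⟩ _ ⟨s', hs', rfl⟩ fun i => by simpa using he i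
    simpa using this
  · rintro h _ ⟨s, hs, rfl⟩ _ ⟨s', hs', rfl⟩ he
    have := h s hs s' hs' fun i => by simpa using he i
    simpa using this

theorem sat_inclFormula (h : Covers φ l m) (hU : U.Full (m + 1 + l.length)) {p : App}
    (hp : p ∈ l) :
    (inclFormula L l m p).Sat B I U ↔ ∀ s ∈ U, ∃ s' ∈ U, (∀ i, s.val (p.2.2 i) = s'.val i) ∧
      s.val (valueVar l m p) = s'.val (valueVar l m p.std) := by
  simp only [inclFormula, DStar.Sat, Set.subset_def, hU.mem_rel (h.std_lt hp),
    hU.mem_rel (h.app_lt hp)]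
  constructor
  · intro h s hs
    obtain ⟨s', hs', he⟩ := h _ ⟨s, hs, rfl⟩
    refine ⟨s', hs', fun i => ?_, ?_⟩
    · simpa using congrFun he i.castSucc
    · simpa using congrFun he (Fin.last _)
  · rintro h _ ⟨s, hs, rfl⟩
    obtain ⟨s', hs', h1, h2⟩ := h s hs
    refine ⟨s', hs', funext fun i => ?_⟩
    cases i using Fin.lastCases with
    | last => simpa using h2
    | cast i => simpa using h1 i

theorem mem_rel_singleton {N : ℕ} (hU : U.Full N) {x : ℕ} (hx : x < N) {a : Fin 1 → B} :
    a ∈ U.Rel ![x] ↔ ∃ s ∈ U, a = ![s.val x] := by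
  rw [hU.mem_rel (by simpa using hx)]
  simp only [comp_vec_one]

/-- Richness supplies assignments in which the variables `0` and `m` take the same prescribed fresh
value; these make the inclusion and exclusion atoms describe `S`. -/
theorem sat_chiFormula (h : Covers φ l m) (hU : Rich (m + 1 + l.length) m S U) :
    (∀ s ∈ U, s.val (valueVar l m ⟨1, .chi, ![0]⟩) = F .chi ![s.val 0]) →
    (∀ s ∈ U, s.val (valueVar l m ⟨0, .tt, Fin.elim0⟩) = F .tt ![]) →
    S.Nonempty →
    ((chiFormula L l m).Sat B I U ↔ ∀ b, F .chi ![b] = F .tt ![] ↔ b ∈ S) := by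
  intro hchi htt ⟨b₀, hb₀⟩
  have h1 := valueVar_lt (m := m) h.chi
  have h2 := valueVar_lt (m := m) h.tt
  have h0 : 0 < m + 1 + l.length := by omega
  have hm : m < m + 1 + l.length := by omega
  constructor
  · rintro ⟨U₀, U₁, rfl, ⟨h3, h4⟩, h5, h6⟩
    have hf0 := hU.full.mono (Set.subset_union_left (s := U₀) (t := U₁))
    have hf1 := hU.full.mono (Set.subset_union_right (s := U₀) (t := U₁))
    rw [sat_eq_iff hf0 h1 h2] at h3
    rw [sat_neq_iff hf1 h1 h2] at h5
    have h3' : ∀ s ∈ U₀, F .chi ![s.val 0] = F .tt ![] := fun s hs => by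
      rw [← hchi s (Or.inl hs), ← htt s (Or.inl hs), h3 s hs]
    have h5' : ∀ s ∈ U₁, F .chi ![s.val 0] ≠ F .tt ![] := fun s hs => by
      rw [← hchi s (Or.inr hs), ← htt s (Or.inr hs)]
      exact h5 s hs
    intro b
    constructor
    · intro hb
      obtain ⟨s, hs, hs0, -⟩ := hU.exists_mem (fun _ => b) b₀ hb₀
      have hs0 := hs0 0 h.pos
      rcases hs with hs | hs
      · have := h4 ((mem_rel_singleton hf0 h0).2 ⟨s, hs, rfl⟩)
        obtain ⟨s', hs', he⟩ := (mem_rel_singleton hf0 hm).1 this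
        have he : s.val 0 = s'.val m := congrFun he 0
        rw [← hs0, he]
        exact hU.mem s' (Or.inl hs')
      · exact absurd (by rw [hs0, hb]) (h5' s hs)
    · intro hb
      by_contra hne
      -- An assignment with equal values of `0` and `m` cannot lie in the half with the exclusion
      -- atom.
      obtain ⟨s, hs, hs0, hsm⟩ := hU.exists_mem (fun _ => b) b hb
      have hs0 := hs0 0 h.pos
      rcases hs with hs | hs
      · exact hne (by rw [← h3' s hs, hs0])
      · have hmem : (![b] : Fin 1 → B) ∈ U₁.Rel ![0] ∩ U₁.Rel ![m] :=
          ⟨(mem_rel_singleton hf1 h0).2 ⟨s, hs, by rw [hs0]⟩,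
            (mem_rel_singleton hf1 hm).2 ⟨s, hs, by rw [hsm]⟩⟩
        have h6 : U₁.Rel ![0] ∩ U₁.Rel ![m] = ∅ := h6
        rw [h6] at hmem
        exact hmem
  · intro hS
    have hf0 := hU.full.mono (V := {s ∈ U | s.val 0 ∈ S}) fun s hs => hs.1
    have hf1 := hU.full.mono (V := {s ∈ U | s.val 0 ∉ S}) fun s hs => hs.1
    refine ⟨{s ∈ U | s.val 0 ∈ S}, {s ∈ U | s.val 0 ∉ S}, ?_, ⟨?_, ?_⟩, ?_, ?_⟩
    · ext s
      by_cases hs : s.val 0 ∈ S <;> simp [hs]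
    · rw [sat_eq_iff hf0 h1 h2]
      rintro s ⟨hs, hs0⟩
      rw [hchi s hs, htt s hs, hS]
      exact hs0
    · intro a ha
      obtain ⟨s, ⟨hs, hs0⟩, rfl⟩ := (mem_rel_singleton hf0 h0).1 ha
      -- The witness keeps the variables below `m`, so it stays in the same half, and moves `m` to
      -- the value of `0`.
      obtain ⟨s', hs', h3, h4⟩ := hU.exists_mem s.val _ hs0
      refine (mem_rel_singleton hf0 hm).2 ⟨s', ⟨hs', ?_⟩, by rw [h4]⟩
      rw [h3 0 h.pos]
      exact hs0
    · rw [sat_neq_iff hf1 h1 h2]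
      rintro s ⟨hs, hs0⟩
      rw [hchi s hs, htt s hs, ne_eq, hS]
      exact hs0
    · refine Set.eq_empty_of_forall_notMem fun a ⟨ha, ha'⟩ => ?_
      obtain ⟨s, ⟨hs, hs0⟩, rfl⟩ := (mem_rel_singleton hf1 h0).1 ha
      obtain ⟨s', ⟨hs', -⟩, he⟩ := (mem_rel_singleton hf1 hm).1 ha'
      have he : s.val 0 = s'.val m := congrFun he 0
      exact hs0 (he ▸ hU.mem s' hs')

theorem sat_matrix (hU : U.Full (m + 1 + l.length)) (h : Covers φ l m) :
    (matrix φ l m).Sat B I U ↔ (∀ s ∈ U, φ.evalVars I (termVar l m) s.val) ∧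
      (chiFormula L l m).Sat B I U ∧ (∀ p ∈ l, (depFormula L l m p).Sat B I U) ∧
      ∀ p ∈ l, (inclFormula L l m p).Sat B I U := by
  rw [matrix, DStar.sat_conjs, (QF.sat_toDStar h.below hU).1]
  simp only [List.mem_cons, List.mem_append, List.mem_map, or_imp, forall_and, forall_eq,
    forall_exists_index, and_imp, forall_apply_eq_imp_iff₂]

open Classical in
theorem exists_interp_of_sat_matrix (hU : Rich (m + 1 + l.length) m S U) (h : Covers φ l m)
    (hS : S.Nonempty) (hsat : (matrix φ l m).Sat B I U) :
    ∃ F : Interp B, (∀ b, F .chi ![b] = F .tt ![] ↔ b ∈ S) ∧ φ.Valid I F := by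
  obtain ⟨h1, h2, h3, h4⟩ := (sat_matrix hU.full h).1 hsat
  -- The function is read off from the standard applications. The dependence atom makes the choice
  -- of the assignment irrelevant, and the inclusion atom carries the value over to other
  -- applications.
  let F : Interp B := fun k f a =>
    if h : ∃ s ∈ U, ∀ i : Fin k, s.val i = a i then
      h.choose.val (valueVar l m ⟨k, f, fun i => i⟩) else Classical.arbitrary B
  have hF : ∀ p ∈ l, ∀ s ∈ U, s.val (valueVar l m p) = App.eval F s.val p := by
    intro p hp s hs
    obtain ⟨s', hs', h5, h6⟩ := (sat_inclFormula h hU.full hp).1 (h4 p hp) s hs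
    have hex : ∃ s' ∈ U, ∀ i : Fin p.1, s'.val i = (s.val ∘ p.2.2) i :=
      ⟨s', hs', fun i => (h5 i).symm⟩
    rw [h6, App.eval]
    simp only [F]
    rw [dif_pos hex]
    exact (sat_depFormula h hU.full hp).1 (h3 p hp) s' hs' _ hex.choose_spec.1 fun i =>
      (h5 i).symm.trans (hex.choose_spec.2 i).symm
  refine ⟨F, ?_, fun x => ?_⟩
  · refine (sat_chiFormula (I := I) h hU (fun s hs => ?_) (fun s hs => ?_) hS).1 h2
    · rw [hF _ h.chi s hs, App.eval, comp_vec_one]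
    · rw [hF _ h.tt s hs, App.eval, comp_elim0]
  · obtain ⟨b, hb⟩ := hS
    obtain ⟨s, hs, hx, -⟩ := hU.exists_mem x b hb
    refine (QF.eval_congr fun j hj => ?_).1
      ((evalVars_iff fun p hp => hF p (h.apps p hp) s hs).1 (h1 s hs))
    exact hx j (lt_of_lt_of_le hj h.bound)

theorem sat_matrix_of_interp (hU : Rich (m + 1 + l.length) m S U) (h : Covers φ l m)
    (hS : S.Nonempty) (hchi : ∀ b, F .chi ![b] = F .tt ![] ↔ b ∈ S) (hφ : φ.Valid I F)
    (hF : ∀ p ∈ l, ∀ s ∈ U, s.val (valueVar l m p) = App.eval F s.val p) :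
    (matrix φ l m).Sat B I U := by
  refine (sat_matrix hU.full h).2 ⟨fun s hs => ?_, ?_, fun p hp => ?_, fun p hp => ?_⟩
  · exact (evalVars_iff fun p hp => hF p (h.apps p hp) s hs).2 (hφ _)
  · refine (sat_chiFormula h hU (fun s hs => ?_) (fun s hs => ?_) hS).2 hchi
    · rw [hF _ h.chi s hs, App.eval, comp_vec_one]
    · rw [hF _ h.tt s hs, App.eval, comp_elim0]
  · refine (sat_depFormula h hU.full hp).2 fun s hs s' hs' he => ?_
    rw [hF _ (h.std p hp) s hs, hF _ (h.std p hp) s' hs']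
    exact congrArg (F p.2.1) (funext he)
  · refine (sat_inclFormula h hU.full hp).2 fun s hs => ?_
    obtain ⟨b, hb⟩ := hS
    -- The witness for the inclusion atom has the arguments of `p` as the values of its first
    -- variables.
    obtain ⟨s', hs', hx, -⟩ := hU.exists_mem
      (fun v => if hv : v < p.1 then s.val (p.2.2 ⟨v, hv⟩) else s.val v) b hb
    have he : ∀ i, s.val (p.2.2 i) = s'.val i := fun i => by
      rw [hx i (lt_of_lt_of_le i.2 (h.arity p hp))]
      simp
    refine ⟨s', hs', he, ?_⟩
    rw [hF _ hp s hs, hF _ (h.std p hp) s' hs']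
    exact congrArg (F p.2.1) (funext he)

end

/-! ### Correctness of the `D*`-sentence -/

section
variable {L : FirstOrder.Language.{u, v}} [L.IsRelational] {A : Type w} {I : L.Structure A}
  {φ : QF L} {l : List App} {m : ℕ}

theorem Covers.sat_dstar (h : Covers φ l m) :
    (φ.dstar l m).Sat A I {emptyAssignment A} ↔ φ.Defines I := by
  refine exists_congr fun n => ?_
  have hmod : (Team.lift {emptyAssignment A} (Fin (n + 1))).modify
      (fun _ => Set.range Sum.inr) m =
      {t | ∃ i : Fin (n + 1), t = (emptyAssignment (A ⊕ Fin (n + 1))).set (.inr i) m} := by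
    have : Team.lift {emptyAssignment A} (Fin (n + 1)) = {emptyAssignment _} := by
      rw [Team.lift, Set.image_singleton]
      rfl
    rw [this]
    ext t
    simp [Team.modify]
  rw [hmod, DStar.sat_alls]
  set U : Team (A ⊕ Fin (n + 1)) := {t | ∃ s ∈ {t | ∃ i : Fin (n + 1),
    t = (emptyAssignment (A ⊕ Fin (n + 1))).set (.inr i) m}, ∃ x : ℕ → A ⊕ Fin (n + 1),
      t = s.extend 0 m x} with hUdef
  have hU1 : ∀ s ∈ U, (∀ v < m + 1, (s v).isSome) ∧ ∃ i, s m = some (.inr i) := by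
    rintro _ ⟨_, ⟨i, rfl⟩, x, rfl⟩
    refine ⟨fun v hv => ?_, i, ?_⟩
    · by_cases hv' : v < m
      · simp [Assignment.extend, hv']
      · obtain rfl : v = m := by omega
        simp [Assignment.extend, Assignment.set]
    · simp [Assignment.extend, Assignment.set]
  have hU2 : ∀ (x : ℕ → A ⊕ Fin (n + 1)) (i : Fin (n + 1)),
      ∃ s ∈ U, (∀ v < m, s v = some (x v)) ∧ s m = some (.inr i) := by
    intro x i
    refine ⟨_, ⟨_, ⟨i, rfl⟩, x, rfl⟩, fun v hv => ?_, ?_⟩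
    · simp [Assignment.extend, hv]
    · simp [Assignment.extend, Assignment.set]
  have hne : (Set.range (Sum.inr : Fin (n + 1) → A ⊕ Fin (n + 1))).Nonempty := ⟨_, 0, rfl⟩
  constructor
  · intro hsat
    obtain ⟨V, hV, h1, h2⟩ := DStar.exists_of_sat_exs _ _ _ _ hsat
    refine exists_interp_of_sat_matrix ⟨fun t ht v hv => ?_, fun t ht => ?_, ?_⟩ h hne hV
    · obtain ⟨s, hs, h3, h4⟩ := h1 t ht
      by_cases hv' : v < m + 1
      · rw [h3 v hv']
        exact (hU1 s hs).1 v hv'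
      · exact h4 v (by omega) hv
    · obtain ⟨s, hs, h3, h4⟩ := h1 t ht
      obtain ⟨i, hi⟩ := (hU1 s hs).2
      exact ⟨i, by rw [Assignment.val, h3 m (by omega), hi]; rfl⟩
    · rintro x _ ⟨i, rfl⟩
      obtain ⟨s, hs, h3, h4⟩ := hU2 x i
      obtain ⟨t, ht, h5⟩ := h2 s hs
      exact ⟨t, ht, fun v hv => by rw [Assignment.val, h5 v (by omega), h3 v hv]; rfl,
        by rw [Assignment.val, h5 m (by omega), h4]; rfl⟩
  · classical
    rintro ⟨F, hF, hφ⟩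
    -- The existential block is filled with the true values of the applications, which depend only
    -- on variables below `m`.
    let Y : Assignment (A ⊕ Fin (n + 1)) → ℕ → A ⊕ Fin (n + 1) := fun s v =>
      if hv : v - (m + 1) < l.length then App.eval F s.val (l[v - (m + 1)]'hv)
      else Classical.arbitrary _
    have hval : ∀ (s s' : Assignment (A ⊕ Fin (n + 1))), (∀ v < m, s v = s' v) → ∀ p ∈ l,
        App.eval F s.val p = App.eval F s'.val p := by
      intro s s' hs p hp
      refine congrArg (F p.2.1) (funext fun i => ?_)
      simp only [Function.comp_apply, Assignment.val, hs _ (h.lt p hp i)]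
    have hY : ∀ s s' : Assignment (A ⊕ Fin (n + 1)), (∀ v < m, s v = s' v) → Y s = Y s' := by
      intro s s' hs
      funext v
      simp only [Y]
      split_ifs with hv
      · exact hval s s' hs _ (List.getElem_mem hv)
      · rfl
    refine DStar.sat_exs_of_image hY (m + 1) l.length (by omega) _ _ ?_
    have hlow : ∀ s : Assignment (A ⊕ Fin (n + 1)), ∀ v < m + 1,
        s.extend (m + 1) l.length (Y s) v = s v := fun s v hv => by
      have : ¬ (m + 1 ≤ v ∧ v < m + 1 + l.length) := by omega
      simp only [Assignment.extend, this, if_false]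
    refine sat_matrix_of_interp (S := Set.range Sum.inr) ⟨?_, ?_, ?_⟩ h hne hF hφ ?_
    · rintro _ ⟨s, hs, rfl⟩ v hv
      by_cases hv' : v < m + 1
      · simp only [hlow s v hv']
        exact (hU1 s hs).1 v hv'
      · have : m + 1 ≤ v ∧ v < m + 1 + l.length := by omega
        simp only [Assignment.extend, this, and_self, if_true, Option.isSome_some]
    · rintro _ ⟨s, hs, rfl⟩
      obtain ⟨i, hi⟩ := (hU1 s hs).2
      exact ⟨i, by simp only [Assignment.val, hlow s m (by omega), hi]; rfl⟩
    · rintro x _ ⟨i, rfl⟩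
      obtain ⟨s, hs, h3, h4⟩ := hU2 x i
      refine ⟨_, ⟨s, hs, rfl⟩, fun v hv => ?_, ?_⟩
      · simp only [Assignment.val, hlow s v (by omega), h3 v hv]
        rfl
      · simp only [Assignment.val, hlow s m (by omega), h4]
        rfl
    · rintro p hp _ ⟨s, hs, rfl⟩
      have hi := List.idxOf_lt_length_of_mem hp
      have h1 : m + 1 ≤ valueVar l m p ∧ valueVar l m p < m + 1 + l.length :=
        ⟨Nat.le_add_right _ _, valueVar_lt hp⟩
      have h2 : valueVar l m p - (m + 1) = l.idxOf p := by simp [valueVar]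
      have h3 : Y s (valueVar l m p) = App.eval F s.val p := by
        simp only [Y, h2, hi, dif_pos, List.getElem_idxOf]
      refine Eq.trans ?_ (hval s _ (fun v hv => (hlow s v (by omega)).symm) p hp)
      rw [← h3]
      simp only [Assignment.val, Assignment.extend, h1, and_self, if_true, Option.getD_some]

end

/-- Every definable property of finite models is expressed by a sentence of `D*`. -/
theorem QF.exists_dstar {L : FirstOrder.Language.{u, v}} [L.IsRelational] (φ : QF L) :
    ∃ ψ : DStar L, ψ.IsSentence ∧ ∀ M : FinModel.{u, v, w} L, ψ.Holds M ↔ φ.Defines M.str := by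
  obtain ⟨l, m, h⟩ := exists_covers φ
  exact ⟨φ.dstar l m, h.isSentence, fun M => h.sat_dstar⟩


/-! ### Projections of primitive recursive relations -/

section
variable {α β γ : Type*} [Primcodable α] [Primcodable β] [Primcodable γ]

theorem primrecPred_forall_mem {f : α → List β} {p : α → β → Prop} (hf : Primrec f)
    (hp : PrimrecPred fun q : α × β => p q.1 q.2) : PrimrecPred fun a => ∀ b ∈ f a, p a b := by
  have h : PrimrecRel fun (b : β) (a : α) => p a b := hp.comp (Primrec.pair Primrec.snd Primrec.fst)
  exact h.forall_mem_list.comp hf Primrec.id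

theorem primrecPred_exists_mem {f : α → List β} {p : α → β → Prop} (hf : Primrec f)
    (hp : PrimrecPred fun q : α × β => p q.1 q.2) : PrimrecPred fun a => ∃ b ∈ f a, p a b := by
  have h : PrimrecRel fun (b : β) (a : α) => p a b := hp.comp (Primrec.pair Primrec.snd Primrec.fst)
  exact h.exists_mem_list.comp hf Primrec.id

theorem primrecPred_mem {f : α → β} {g : α → List β} (hf : Primrec f) (hg : Primrec g) :
    PrimrecPred fun a => f a ∈ g a := by
  have : PrimrecPred fun a => ∃ b ∈ g a, b = f a :=
    primrecPred_exists_mem hg (Primrec.eq.comp Primrec.snd (hf.comp Primrec.fst))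
  exact this.of_eq fun a => by simp

theorem primrecPred_imp {p q : α → Prop} (hp : PrimrecPred p) (hq : PrimrecPred q) :
    PrimrecPred fun a => p a → q a :=
  (hp.not.or hq).of_eq fun a => by tauto

/-- `p` is the projection of a primitive recursive relation. -/
def SigmaOne (p : α → Prop) : Prop :=
  ∃ R : α → ℕ → Prop, PrimrecRel R ∧ ∀ a, p a ↔ ∃ w, R a w

theorem _root_.PrimrecPred.sigmaOne {p : α → Prop} (hp : PrimrecPred p) : SigmaOne p :=
  ⟨fun a _ => p a, hp.comp Primrec.fst, fun _ => by simp⟩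

namespace SigmaOne

theorem comp {p : β → Prop} (hp : SigmaOne p) {f : α → β} (hf : Primrec f) :
    SigmaOne fun a => p (f a) := by
  obtain ⟨R, hR, h⟩ := hp
  exact ⟨fun a w => R (f a) w, hR.comp (hf.comp Primrec.fst) Primrec.snd, fun a => h (f a)⟩

theorem and {p q : α → Prop} (hp : SigmaOne p) (hq : SigmaOne q) :
    SigmaOne fun a => p a ∧ q a := by
  obtain ⟨R, hR, h⟩ := hp
  obtain ⟨R', hR', h'⟩ := hq
  refine ⟨fun a w => R a w.unpair.1 ∧ R' a w.unpair.2,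
    PrimrecPred.and (hR.comp Primrec.fst (Primrec.fst.comp (Primrec.unpair.comp Primrec.snd)))
      (hR'.comp Primrec.fst (Primrec.snd.comp (Primrec.unpair.comp Primrec.snd))), fun a => ?_⟩
  refine Iff.trans (and_congr (h a) (h' a)) ?_
  constructor
  · rintro ⟨⟨w, hw⟩, w', hw'⟩
    exact ⟨Nat.pair w w', by simpa using ⟨hw, hw'⟩⟩
  · rintro ⟨w, hw, hw'⟩
    exact ⟨⟨_, hw⟩, _, hw'⟩

/-- The witness pairs a code of `b` with a witness for `b`. Numbers that decode to nothing stand for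
`default`, which is harmless as it is a legitimate `b`. -/
theorem ex [Inhabited β] {p : α → β → Prop} (hp : SigmaOne fun q : α × β => p q.1 q.2) :
    SigmaOne fun a => ∃ b, p a b := by
  obtain ⟨R, hR, h⟩ := hp
  refine ⟨fun a w => R (a, ((Encodable.decode w.unpair.1 : Option β).getD default)) w.unpair.2,
    hR.comp (Primrec.pair Primrec.fst (Primrec.option_getD_default.comp
      (Primrec.decode.comp (Primrec.fst.comp (Primrec.unpair.comp Primrec.snd)))))
      (Primrec.snd.comp (Primrec.unpair.comp Primrec.snd)), fun a => ?_⟩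
  constructor
  · rintro ⟨b, hb⟩
    obtain ⟨w, hw⟩ := (h (a, b)).1 hb
    exact ⟨Nat.pair (Encodable.encode b) w, by simpa using hw⟩
  · rintro ⟨w, hw⟩
    exact ⟨_, (h (a, _)).2 ⟨_, hw⟩⟩

theorem rePred {p : α → Prop} (hp : SigmaOne p) : REPred p := by
  obtain ⟨R, ⟨hd, hR⟩, h⟩ := hp
  let : ∀ a w, Decidable (R a w) := fun a w => hd (a, w)
  have h1 : Computable₂ fun a w => decide (R a w) := Primrec.to_comp hR
  refine (Partrec.rfind h1.partrec₂).dom_re.of_eq fun a => ?_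
  refine (Nat.rfind_dom (p := ((fun w => decide (R a w) : ℕ → Bool) : ℕ →. Bool))).trans ?_
  rw [h]
  simp

end SigmaOne

/-- The witness is a bound for step-limited evaluation, which is primitive recursive. -/
theorem _root_.REPred.sigmaOne {p : α → Prop} (hp : REPred p) : SigmaOne p := by
  obtain ⟨c, hc⟩ := Nat.Partrec.Code.exists_code.1 hp
  refine ⟨fun a k => (Nat.Partrec.Code.evaln k c (Encodable.encode a)).isSome = true, ?_,
    fun a => ?_⟩
  · refine Primrec.eq.comp (Primrec.option_isSome.comp (Nat.Partrec.Code.primrec_evaln.comp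
      (Primrec.pair (Primrec.pair Primrec.snd (Primrec.const c))
        (Primrec.encode.comp Primrec.fst)))) (Primrec.const true)
  · have h : p a ↔ (Nat.Partrec.Code.eval c (Encodable.encode a)).Dom := by
      rw [hc]
      simp [Part.assert]
    rw [h, Part.dom_iff_mem]
    simp only [Nat.Partrec.Code.evaln_complete, Option.isSome_iff_exists]
    exact exists_comm

end

/-! ### Codes of finite models and teams -/

/-- Codes of the relations of a model, as lists of the tuples in them. -/
abbrev TableCode : Type := List (ℕ × List ℕ)

/-- Codes of assignments, as association lists. -/
abbrev AssignmentCode : Type := List (ℕ × ℕ)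

abbrev TeamCode : Type := List AssignmentCode

section
variable {L : FirstOrder.Language.{u, v}} {A : Type w}

/-- `v` identifies the model with the model on `{0, …, n - 1}` that has the code `T`. -/
structure Represents (idx : ∀ {k}, L.Relations k → ℕ) (I : L.Structure A) (v : A → ℕ) (n : ℕ)
    (T : TableCode) : Prop where
  inj : Function.Injective v
  lt_iff : ∀ m, m < n ↔ ∃ a, v a = m
  rel : ∀ {k : ℕ} (R : L.Relations k) (a : Fin k → A),
    I.RelMap R a ↔ (idx R, List.ofFn (v ∘ a)) ∈ T
  bdd : ∀ q ∈ T, ∀ x ∈ q.2, x < n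

/-- The assignment has the given code. -/
def Codes (v : A → ℕ) (g : AssignmentCode) (s : Assignment A) : Prop :=
  ∀ x, g.lookup x = (s x).map v

/-- The team has the given code. -/
structure RepresentsTeam (v : A → ℕ) (U : Team A) (c : TeamCode) : Prop where
  exists_code : ∀ s ∈ U, ∃ g ∈ c, Codes v g s
  exists_assignment : ∀ g ∈ c, ∃ s ∈ U, Codes v g s

/-- The values of a tuple of variables. -/
def tup {k : ℕ} (x : Fin k → ℕ) (g : AssignmentCode) : List (Option ℕ) :=
  List.ofFn fun i => g.lookup (x i)

theorem primrec_tup {k : ℕ} (x : Fin k → ℕ) : Primrec (tup x) :=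
  Primrec.list_ofFn fun i => Primrec.listLookup.comp (Primrec.const (x i)) Primrec.id

theorem tup_eq_iff {v : A → ℕ} (hv : Function.Injective v) {g g' : AssignmentCode}
    {s s' : Assignment A} (h : Codes v g s) (h' : Codes v g' s') {k : ℕ} {x y : Fin k → ℕ} :
    tup x g = tup y g' ↔ ∀ i, s (x i) = s' (y i) := by
  rw [tup, tup, List.ofFn_inj, funext_iff]
  refine forall_congr' fun i => ?_
  rw [h, h']
  exact (Option.map_injective hv).eq_iff

/-- All variables of the tuple have values. -/
def Total {k : ℕ} (x : Fin k → ℕ) (g : AssignmentCode) : Prop := ∀ o ∈ tup x g, o.isSome = true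

theorem primrecPred_total {k : ℕ} (x : Fin k → ℕ) : PrimrecPred (Total x) :=
  primrecPred_forall_mem (primrec_tup x)
    (Primrec.eq.comp (Primrec.option_isSome.comp Primrec.snd) (Primrec.const true))

theorem total_iff {v : A → ℕ} {g : AssignmentCode} {s : Assignment A} (h : Codes v g s) {k : ℕ}
    {x : Fin k → ℕ} : Total x g ↔ ∃ a : Fin k → A, ∀ i, s (x i) = some (a i) := by
  refine Iff.trans ?_ (Classical.skolem (b := fun _ => A) (p := fun i a => s (x i) = some a))
  simp only [Total, tup, List.forall_mem_ofFn_iff, h _, Option.isSome_map]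
  simp only [Option.isSome_iff_exists]

/-- All assignments that arise from those in `c` by giving `x` a value in
`{k, …, k + n - 1}`. -/
def spread (c : TeamCode) (k n x : ℕ) : TeamCode :=
  c.flatMap fun g => (List.range n).map fun a => (x, k + a) :: g

theorem mem_spread {c : TeamCode} {k n x : ℕ} {h : AssignmentCode} :
    h ∈ spread c k n x ↔ ∃ g ∈ c, ∃ a < n, h = (x, k + a) :: g := by
  simp [spread, eq_comm]

theorem primrec_spread {α : Type*} [Primcodable α] {c : α → TeamCode} {k n : α → ℕ} (x : ℕ)
    (hc : Primrec c) (hk : Primrec k) (hn : Primrec n) :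
    Primrec fun a => spread (c a) (k a) (n a) x := by
  refine Primrec.list_flatMap hc (Primrec.list_map (Primrec.list_range.comp (hn.comp Primrec.fst)) ?_)
  refine Primrec.list_cons.comp (Primrec.pair (Primrec.const x) (Primrec.nat_add.comp
    (hk.comp (Primrec.fst.comp Primrec.fst)) Primrec.snd)) (Primrec.snd.comp Primrec.fst)

/-- The front entry of an association list shadows later entries for the same variable, just as
resetting does. -/
theorem Codes.cons {v : A → ℕ} {g : AssignmentCode} {s : Assignment A} (h : Codes v g s) (a : A)
    (x : ℕ) : Codes v ((x, v a) :: g) (s.set a x) := by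
  intro y
  rw [List.lookup_cons, Assignment.set, Function.update_apply]
  by_cases hy : y = x
  · simp [hy]
  · simp [hy, h y, beq_false_of_ne hy]

variable {idx : ∀ {k}, L.Relations k → ℕ} {I : L.Structure A} {v : A → ℕ} {n : ℕ} {T : TableCode}
  {U : Team A} {c : TeamCode}

theorem RepresentsTeam.modify_univ (hU : RepresentsTeam v U c) (hn : ∀ m, m < n ↔ ∃ a, v a = m)
    (x : ℕ) : RepresentsTeam v (U.modify (fun _ => Set.univ) x) (spread c 0 n x) := by
  constructor
  · rintro _ ⟨s, hs, a, -, rfl⟩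
    obtain ⟨g, hg, h⟩ := hU.exists_code s hs
    exact ⟨_, mem_spread.2 ⟨g, hg, v a, (hn _).2 ⟨a, rfl⟩, by rw [zero_add]⟩, h.cons a x⟩
  · intro h hh
    obtain ⟨g, hg, m, hm, rfl⟩ := mem_spread.1 hh
    obtain ⟨a, rfl⟩ := (hn m).1 hm
    obtain ⟨s, hs, h⟩ := hU.exists_assignment g hg
    rw [zero_add]
    exact ⟨_, ⟨s, hs, a, trivial, rfl⟩, h.cons a x⟩

/-- The numbering of the points after `n` fresh points have been added. -/
def bloatVal (v : A → ℕ) (n : ℕ) (m : ℕ) : A ⊕ Fin (m + 1) → ℕ := Sum.elim v fun i => n + i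

/-- Fresh points receive the numbers from `n` on. The table can stay as it is, because `bdd` keeps
these numbers out of its tuples. -/
theorem Represents.bloat [L.IsRelational] (hI : Represents idx I v n T) (m : ℕ) :
    Represents idx (bloat I (Fin (m + 1))) (bloatVal v n m) (n + (m + 1)) T where
  inj := by
    have hlt : ∀ a, v a < n := fun a => (hI.lt_iff _).2 ⟨a, rfl⟩
    rintro (a | i) (b | j) h
    · exact congrArg _ (hI.inj h)
    · have := hlt a
      simp only [bloatVal, Sum.elim_inl, Sum.elim_inr] at h
      omega
    · have := hlt b
      simp only [bloatVal, Sum.elim_inl, Sum.elim_inr] at h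
      omega
    · simp only [bloatVal, Sum.elim_inr] at h
      exact congrArg _ (Fin.ext (by omega))
  lt_iff := by
    intro k
    constructor
    · intro hk
      by_cases h : k < n
      · obtain ⟨a, rfl⟩ := (hI.lt_iff k).1 h
        exact ⟨.inl a, rfl⟩
      · exact ⟨.inr ⟨k - n, by omega⟩, by simp only [bloatVal, Sum.elim_inr]; omega⟩
    · rintro ⟨a | i, rfl⟩
      · have : v a < n := (hI.lt_iff _).2 ⟨a, rfl⟩
        simp only [bloatVal, Sum.elim_inl]
        omega
      · simp only [bloatVal, Sum.elim_inr]
        omega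
  rel := by
    intro k R b
    constructor
    · rintro ⟨a, rfl, h⟩
      exact (hI.rel R a).1 h
    · intro h
      obtain ⟨a, rfl⟩ := exists_comp_inl b fun i => by
        rintro ⟨j, hj⟩
        have := hI.bdd _ h (bloatVal v n m (b i)) ((List.mem_ofFn' _ _).2 ⟨i, rfl⟩)
        rw [← hj] at this
        simp only [bloatVal, Sum.elim_inr] at this
        omega
      exact ⟨a, rfl, (hI.rel R a).2 h⟩
  bdd := fun q hq x hx => (hI.bdd q hq x hx).trans_le (Nat.le_add_right _ _)

theorem RepresentsTeam.bloat (hU : RepresentsTeam v U c) (m x : ℕ) :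
    RepresentsTeam (bloatVal v n m)
      ((U.lift (Fin (m + 1))).modify (fun _ => Set.range Sum.inr) x) (spread c n (m + 1) x) := by
  have key : ∀ {g s}, Codes v g s →
      Codes (bloatVal v n m) g fun x => (s x).map Sum.inl := by
    intro g s h x
    rw [h, Option.map_map]
    rfl
  constructor
  · rintro _ ⟨_, ⟨s, hs, rfl⟩, _, ⟨i, rfl⟩, rfl⟩
    obtain ⟨g, hg, h⟩ := hU.exists_code s hs
    exact ⟨_, mem_spread.2 ⟨g, hg, i, i.2, rfl⟩, (key h).cons (.inr i) x⟩
  · intro h hh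
    obtain ⟨g, hg, i, hi, rfl⟩ := mem_spread.1 hh
    obtain ⟨s, hs, h⟩ := hU.exists_assignment g hg
    exact ⟨_, ⟨_, ⟨s, hs, rfl⟩, .inr ⟨i, hi⟩, ⟨_, rfl⟩, rfl⟩, (key h).cons (.inr ⟨i, hi⟩) x⟩

/-! ### Satisfaction is a projection of a primitive recursive relation -/

/-- This turns quantification over a team into bounded quantification over a list, although an
assignment may have several codes. -/
theorem RepresentsTeam.forall_iff (hU : RepresentsTeam v U c) {P : Assignment A → Prop}
    {Q : AssignmentCode → Prop} (h : ∀ g s, Codes v g s → (P s ↔ Q g)) :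
    (∀ s ∈ U, P s) ↔ ∀ g ∈ c, Q g := by
  constructor
  · intro hP g hg
    obtain ⟨s, hs, hgs⟩ := hU.exists_assignment g hg
    exact (h g s hgs).1 (hP s hs)
  · intro hQ s hs
    obtain ⟨g, hg, hgs⟩ := hU.exists_code s hs
    exact (h g s hgs).2 (hQ g hg)

theorem RepresentsTeam.exists_iff (hU : RepresentsTeam v U c) {P : Assignment A → Prop}
    {Q : AssignmentCode → Prop} (h : ∀ g s, Codes v g s → (P s ↔ Q g)) :
    (∃ s ∈ U, P s) ↔ ∃ g ∈ c, Q g := by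
  have := hU.forall_iff (P := fun s => ¬ P s) (Q := fun g => ¬ Q g) fun g s hgs =>
    not_congr (h g s hgs)
  simpa using not_congr this

theorem Represents.rel_iff (hI : Represents idx I v n T) {g : AssignmentCode} {s : Assignment A}
    (h : Codes v g s) {k : ℕ} (R : L.Relations k) (x : Fin k → ℕ) :
    (∃ a : Fin k → A, (∀ i, s (x i) = some (a i)) ∧ I.RelMap R a) ↔
      ∃ q ∈ T, q.1 = idx R ∧ q.2.map some = tup x g := by
  constructor
  · rintro ⟨a, ha, hR⟩
    refine ⟨_, (hI.rel R a).1 hR, rfl, ?_⟩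
    rw [List.map_ofFn, tup]
    congr 1
    funext i
    rw [h, ha]
    rfl
  · rintro ⟨⟨i, t⟩, hq, rfl, ht⟩
    have htot : Total x g := by
      intro o ho
      rw [← ht] at ho
      obtain ⟨y, -, rfl⟩ := List.mem_map.1 ho
      rfl
    obtain ⟨a, ha⟩ := (total_iff h).1 htot
    refine ⟨a, ha, (hI.rel R a).2 ?_⟩
    have : tup x g = (List.ofFn (v ∘ a)).map some := by
      rw [List.map_ofFn, tup]
      congr 1
      funext i
      rw [h, ha]
      rfl
    rw [this] at ht
    rw [← List.map_injective_iff.2 (Option.some_injective ℕ) ht]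
    exact hq

end


/-! ### Descriptions of satisfaction, clause by clause -/

section
variable {L : FirstOrder.Language.{u, v}} [L.IsRelational]

/-- Satisfaction of `φ` in the models with code `T` of size `n` by the teams with code `c` is
described by `P (n, T, c)`. -/
def Describes (idx : ∀ {k}, L.Relations k → ℕ) (φ : DStar L)
    (P : ℕ × TableCode × TeamCode → Prop) : Prop :=
  ∀ (A : Type w) (I : L.Structure A) (v : A → ℕ) (n : ℕ) (T : TableCode) (U : Team A)
    (c : TeamCode), Represents idx I v n T → RepresentsTeam v U c →
      (φ.Sat A I U ↔ P (n, T, c))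

abbrev codeT : ℕ × TableCode × TeamCode → TableCode := fun d => d.2.1

abbrev codeU : ℕ × TableCode × TeamCode → TeamCode := fun d => d.2.2

theorem primrec_codeT : Primrec codeT := Primrec.fst.comp Primrec.snd

theorem primrec_codeU : Primrec codeU := Primrec.snd.comp Primrec.snd

theorem primrec_lookup (x : ℕ) : Primrec fun g : AssignmentCode => g.lookup x :=
  Primrec.listLookup.comp (Primrec.const x) Primrec.id

theorem primrecPred_isSome_lookup (x : ℕ) :
    PrimrecPred fun g : AssignmentCode => (g.lookup x).isSome = true :=
  Primrec.eq.comp (Primrec.option_isSome.comp (primrec_lookup x)) (Primrec.const true)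

theorem primrecPred_table {k : ℕ} (i : ℕ) (x : Fin k → ℕ) :
    PrimrecPred fun q : (ℕ × TableCode × TeamCode) × AssignmentCode =>
      ∃ r ∈ q.1.2.1, r.1 = i ∧ r.2.map some = tup x q.2 := by
  refine primrecPred_exists_mem (primrec_codeT.comp Primrec.fst) (PrimrecPred.and ?_ ?_)
  · exact Primrec.eq.comp (Primrec.fst.comp Primrec.snd) (Primrec.const i)
  · refine Primrec.eq.comp (Primrec.list_map (Primrec.snd.comp Primrec.snd) ?_)
      ((primrec_tup x).comp (Primrec.snd.comp Primrec.fst))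
    exact Primrec.option_some.comp Primrec.snd

variable {idx : ∀ {k}, L.Relations k → ℕ}

theorem describes_literal {φ : DStar L} {Q : TableCode → AssignmentCode → Prop}
    (hQ : PrimrecPred fun q : (ℕ × TableCode × TeamCode) × AssignmentCode => Q q.1.2.1 q.2)
    (h : ∀ (A : Type w) (I : L.Structure A) (v : A → ℕ) (n : ℕ) (T : TableCode) (U : Team A)
      (c : TeamCode), Represents idx I v n T → RepresentsTeam v U c →
      (φ.Sat A I U ↔ ∀ g ∈ c, Q T g)) : ∃ P, SigmaOne P ∧ Describes.{u, v, w} idx φ P :=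
  ⟨fun d => ∀ g ∈ d.2.2, Q d.2.1 g, (primrecPred_forall_mem primrec_codeU hQ).sigmaOne, h⟩

theorem describes_eq (x y : ℕ) : ∃ P, SigmaOne P ∧ Describes.{u, v, w} idx (.eq x y) P := by
  refine describes_literal
    (Q := fun _ g => (g.lookup x).isSome = true ∧ g.lookup x = g.lookup y)
    (((primrecPred_isSome_lookup x).comp Primrec.snd).and
      (Primrec.eq.comp ((primrec_lookup x).comp Primrec.snd)
        ((primrec_lookup y).comp Primrec.snd))) fun A I v n T U c hI hU => ?_
  refine hU.forall_iff fun g s h => ?_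
  rw [h, h, (Option.map_injective hI.inj).eq_iff]
  cases s x <;> cases s y <;> simp [eq_comm]

theorem describes_neq (x y : ℕ) : ∃ P, SigmaOne P ∧ Describes.{u, v, w} idx (.neq x y) P := by
  refine describes_literal
    (Q := fun _ g => (g.lookup x).isSome = true ∧ (g.lookup y).isSome = true ∧
      ¬ g.lookup x = g.lookup y)
    (((primrecPred_isSome_lookup x).comp Primrec.snd).and
      (((primrecPred_isSome_lookup y).comp Primrec.snd).and
      (Primrec.eq.comp ((primrec_lookup x).comp Primrec.snd)
        ((primrec_lookup y).comp Primrec.snd)).not)) fun A I v n T U c hI hU => ?_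
  refine hU.forall_iff fun g s h => ?_
  rw [h, h, (Option.map_injective hI.inj).eq_iff]
  cases s x <;> cases s y <;> simp

theorem describes_rel {k : ℕ} (R : L.Relations k) (x : Fin k → ℕ) :
    ∃ P, SigmaOne P ∧ Describes.{u, v, w} idx (.rel R x) P := by
  refine describes_literal
    (Q := fun T g => ∃ r ∈ T, r.1 = idx R ∧ r.2.map some = tup x g) (primrecPred_table _ x)
    fun A I v n T U c hI hU => ?_
  exact hU.forall_iff fun g s h => hI.rel_iff h R x

theorem describes_nrel {k : ℕ} (R : L.Relations k) (x : Fin k → ℕ) :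
    ∃ P, SigmaOne P ∧ Describes.{u, v, w} idx (.nrel R x) P := by
  refine describes_literal
    (Q := fun T g => Total x g ∧ ¬ ∃ r ∈ T, r.1 = idx R ∧ r.2.map some = tup x g)
    (((primrecPred_total x).comp Primrec.snd).and (primrecPred_table _ x).not)
    fun A I v n T U c hI hU => ?_
  refine hU.forall_iff fun g s h => ?_
  rw [total_iff h, ← hI.rel_iff h R x]
  constructor
  · rintro ⟨a, ha, hR⟩
    refine ⟨⟨a, ha⟩, ?_⟩
    rintro ⟨b, hb, hR'⟩
    obtain rfl : a = b := funext fun i => Option.some_injective _ ((ha i).symm.trans (hb i))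
    exact hR hR'
  · rintro ⟨⟨a, ha⟩, hR⟩
    exact ⟨a, ha, fun hR' => hR ⟨a, ha, hR'⟩⟩

theorem primrecPred_tup_eq {α : Type*} [Primcodable α] {k : ℕ} (x y : Fin k → ℕ)
    {f g : α → AssignmentCode} (hf : Primrec f) (hg : Primrec g) :
    PrimrecPred fun a => tup x (f a) = tup y (g a) :=
  Primrec.eq.comp ((primrec_tup x).comp hf) ((primrec_tup y).comp hg)

theorem describes_dep {k : ℕ} (x : Fin (k + 1) → ℕ) :
    ∃ P, SigmaOne P ∧ Describes.{u, v, w} idx (.dep x) P := by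
  refine ⟨fun d => ∀ g ∈ d.2.2, ∀ g' ∈ d.2.2, Total x g → Total x g' →
    tup (Fin.init x) g = tup (Fin.init x) g' → tup x g = tup x g', ?_, ?_⟩
  · refine PrimrecPred.sigmaOne (primrecPred_forall_mem primrec_codeU
      (primrecPred_forall_mem (primrec_codeU.comp Primrec.fst) ?_))
    refine primrecPred_imp ((primrecPred_total x).comp (Primrec.snd.comp Primrec.fst))
      (primrecPred_imp ((primrecPred_total x).comp Primrec.snd) (primrecPred_imp ?_ ?_))
    · exact primrecPred_tup_eq _ _ (Primrec.snd.comp Primrec.fst) Primrec.snd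
    · exact primrecPred_tup_eq _ _ (Primrec.snd.comp Primrec.fst) Primrec.snd
  · intro A I v n T U c hI hU
    -- The atom is rephrased by assignments instead of value tuples. Totality enters because
    -- `Team.Rel` ignores assignments that leave a variable of the tuple undefined.
    have h1 : (DStar.dep x).Sat A I U ↔ ∀ s ∈ U, ∀ s' ∈ U,
        (∃ a : Fin (k + 1) → A, ∀ i, s (x i) = some (a i)) →
        (∃ a : Fin (k + 1) → A, ∀ i, s' (x i) = some (a i)) →
        (∀ i, s (Fin.init x i) = s' (Fin.init x i)) → ∀ i, s (x i) = s' (x i) := by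
      constructor
      · rintro h s hs s' hs' ⟨a, ha⟩ ⟨b, hb⟩ he i
        have hab : ∀ i : Fin k, a i.castSucc = b i.castSucc := fun i =>
          Option.some_injective _ ((ha _).symm.trans ((he i).trans (hb _)))
        have hl := h a ⟨s, hs, ha⟩ b ⟨s', hs', hb⟩ hab
        rw [ha, hb]
        cases i using Fin.lastCases with
        | last => rw [hl]
        | cast i => rw [hab]
      · rintro h a ⟨s, hs, ha⟩ b ⟨s', hs', hb⟩ he
        have := h s hs s' hs' ⟨a, ha⟩ ⟨b, hb⟩
          (fun i => by rw [Fin.init, ha, hb, he]) (Fin.last k)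
        rw [ha, hb] at this
        exact Option.some_injective _ this
    rw [h1]
    refine hU.forall_iff fun g s h => hU.forall_iff fun g' s' h' => ?_
    rw [total_iff h, total_iff h', tup_eq_iff hI.inj h h', tup_eq_iff hI.inj h h']

theorem describes_incl {k : ℕ} (x y : Fin (k + 1) → ℕ) :
    ∃ P, SigmaOne P ∧ Describes.{u, v, w} idx (.incl x y) P := by
  refine ⟨fun d => ∀ g ∈ d.2.2, Total x g → ∃ g' ∈ d.2.2, tup x g = tup y g', ?_, ?_⟩
  · refine PrimrecPred.sigmaOne (primrecPred_forall_mem primrec_codeU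
      (primrecPred_imp ((primrecPred_total x).comp Primrec.snd)
      (primrecPred_exists_mem (primrec_codeU.comp Primrec.fst) ?_)))
    exact primrecPred_tup_eq _ _ (Primrec.snd.comp Primrec.fst) Primrec.snd
  · intro A I v n T U c hI hU
    have h1 : (DStar.incl x y).Sat A I U ↔ ∀ s ∈ U,
        (∃ a : Fin (k + 1) → A, ∀ i, s (x i) = some (a i)) →
        ∃ s' ∈ U, ∀ i, s (x i) = s' (y i) := by
      constructor
      · rintro h s hs ⟨a, ha⟩
        obtain ⟨s', hs', hb⟩ := h ⟨s, hs, ha⟩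
        exact ⟨s', hs', fun i => (ha i).trans (hb i).symm⟩
      · rintro h a ⟨s, hs, ha⟩
        obtain ⟨s', hs', hb⟩ := h s hs ⟨a, ha⟩
        exact ⟨s', hs', fun i => (hb i).symm.trans (ha i)⟩
    rw [h1]
    refine hU.forall_iff fun g s h => imp_congr (total_iff h).symm
      (hU.exists_iff fun g' s' h' => ?_)
    rw [tup_eq_iff hI.inj h h']

theorem describes_excl {k : ℕ} (x y : Fin (k + 1) → ℕ) :
    ∃ P, SigmaOne P ∧ Describes.{u, v, w} idx (.excl x y) P := by
  refine ⟨fun d => ∀ g ∈ d.2.2, ∀ g' ∈ d.2.2, Total x g → ¬ tup x g = tup y g', ?_, ?_⟩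
  · refine PrimrecPred.sigmaOne (primrecPred_forall_mem primrec_codeU
      (primrecPred_forall_mem (primrec_codeU.comp Primrec.fst)
      (primrecPred_imp ((primrecPred_total x).comp (Primrec.snd.comp Primrec.fst)) ?_)))
    exact (primrecPred_tup_eq _ _ (Primrec.snd.comp Primrec.fst) Primrec.snd).not
  · intro A I v n T U c hI hU
    have h1 : (DStar.excl x y).Sat A I U ↔ ∀ s ∈ U, ∀ s' ∈ U,
        (∃ a : Fin (k + 1) → A, ∀ i, s (x i) = some (a i)) → ¬ ∀ i, s (x i) = s' (y i) := by
      constructor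
      · rintro h s hs s' hs' ⟨a, ha⟩ he
        have hmem : a ∈ U.Rel x ∩ U.Rel y :=
          ⟨⟨s, hs, ha⟩, ⟨s', hs', fun i => (he i).symm.trans (ha i)⟩⟩
        have h : U.Rel x ∩ U.Rel y = ∅ := h
        rw [h] at hmem
        exact hmem
      · intro h
        refine Set.eq_empty_of_forall_notMem ?_
        rintro a ⟨⟨s, hs, ha⟩, ⟨s', hs', hb⟩⟩
        exact h s hs s' hs' ⟨a, ha⟩ fun i => (ha i).trans (hb i).symm
    rw [h1]
    refine hU.forall_iff fun g s h => hU.forall_iff fun g' s' h' => ?_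
    rw [total_iff h, tup_eq_iff hI.inj h h']

theorem describes_indep {k m l : ℕ} (x : Fin (k + 1) → ℕ) (z : Fin m → ℕ) (y : Fin (l + 1) → ℕ) :
    ∃ P, SigmaOne P ∧ Describes.{u, v, w} idx (.indep x z y) P := by
  refine ⟨fun d => ∀ g ∈ d.2.2, ∀ g' ∈ d.2.2, ∃ h ∈ d.2.2, tup z g = tup z g' →
    tup x h = tup x g ∧ tup z h = tup z g ∧ tup y h = tup y g', ?_, ?_⟩
  · refine PrimrecPred.sigmaOne (primrecPred_forall_mem primrec_codeU
      (primrecPred_forall_mem (primrec_codeU.comp Primrec.fst)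
      (primrecPred_exists_mem (primrec_codeU.comp (Primrec.fst.comp Primrec.fst)) ?_)))
    have hg : Primrec fun q : (((ℕ × TableCode × TeamCode) × AssignmentCode) × AssignmentCode) ×
        AssignmentCode => q.1.1.2 := Primrec.snd.comp (Primrec.fst.comp Primrec.fst)
    have hg' : Primrec fun q : (((ℕ × TableCode × TeamCode) × AssignmentCode) × AssignmentCode) ×
        AssignmentCode => q.1.2 := Primrec.snd.comp Primrec.fst
    exact primrecPred_imp (primrecPred_tup_eq _ _ hg hg')
      ((primrecPred_tup_eq _ _ Primrec.snd hg).and ((primrecPred_tup_eq _ _ Primrec.snd hg).and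
        (primrecPred_tup_eq _ _ Primrec.snd hg')))
  · intro A I v n T U c hI hU
    refine hU.forall_iff fun g s h => hU.forall_iff fun g' s' h' => hU.exists_iff fun g'' t h'' => ?_
    rw [tup_eq_iff hI.inj h h', tup_eq_iff hI.inj h'' h, tup_eq_iff hI.inj h'' h,
      tup_eq_iff hI.inj h'' h']

theorem describes_and {φ ψ : DStar L} (hφ : ∃ P, SigmaOne P ∧ Describes.{u, v, w} idx φ P)
    (hψ : ∃ P, SigmaOne P ∧ Describes.{u, v, w} idx ψ P) :
    ∃ P, SigmaOne P ∧ Describes.{u, v, w} idx (.and φ ψ) P := by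
  obtain ⟨P, hP, h⟩ := hφ
  obtain ⟨Q, hQ, h'⟩ := hψ
  exact ⟨_, hP.and hQ, fun A I v n T U c hI hU =>
    and_congr (h A I v n T U c hI hU) (h' A I v n T U c hI hU)⟩

-- The two subteams are guessed as lists with members from the code of the team.
open Classical in
theorem describes_or {φ ψ : DStar L} (hφ : ∃ P, SigmaOne P ∧ Describes.{u, v, w} idx φ P)
    (hψ : ∃ P, SigmaOne P ∧ Describes.{u, v, w} idx ψ P) :
    ∃ P, SigmaOne P ∧ Describes.{u, v, w} idx (.or φ ψ) P := by
  obtain ⟨P, hP, h⟩ := hφ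
  obtain ⟨Q, hQ, h'⟩ := hψ
  refine ⟨fun d => ∃ c : TeamCode × TeamCode, ((∀ g ∈ d.2.2, g ∈ c.1 ∨ g ∈ c.2) ∧
    (∀ g ∈ c.1, g ∈ d.2.2) ∧ ∀ g ∈ c.2, g ∈ d.2.2) ∧ P (d.1, d.2.1, c.1) ∧ Q (d.1, d.2.1, c.2),
    ?_, ?_⟩
  · have h1 : Primrec fun q : (ℕ × TableCode × TeamCode) × TeamCode × TeamCode => q.2.1 :=
      Primrec.fst.comp Primrec.snd
    have h2 : Primrec fun q : (ℕ × TableCode × TeamCode) × TeamCode × TeamCode => q.2.2 :=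
      Primrec.snd.comp Primrec.snd
    have hd := primrec_codeU.comp (Primrec.fst (α := ℕ × TableCode × TeamCode)
      (β := TeamCode × TeamCode))
    have hn := (Primrec.fst (α := ℕ) (β := TableCode × TeamCode)).comp
      (Primrec.fst (β := TeamCode × TeamCode))
    have ht := primrec_codeT.comp (Primrec.fst (α := ℕ × TableCode × TeamCode)
      (β := TeamCode × TeamCode))
    refine SigmaOne.ex (SigmaOne.and (PrimrecPred.sigmaOne (PrimrecPred.and ?_
      (PrimrecPred.and ?_ ?_))) ((hP.comp ?_).and (hQ.comp ?_)))
    · exact primrecPred_forall_mem hd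
        ((primrecPred_mem Primrec.snd (h1.comp Primrec.fst)).or
          (primrecPred_mem Primrec.snd (h2.comp Primrec.fst)))
    · exact primrecPred_forall_mem h1 (primrecPred_mem Primrec.snd (hd.comp Primrec.fst))
    · exact primrecPred_forall_mem h2 (primrecPred_mem Primrec.snd (hd.comp Primrec.fst))
    · exact Primrec.pair hn (Primrec.pair ht h1)
    · exact Primrec.pair hn (Primrec.pair ht h2)
  · intro A I v n T U c hI hU
    have hsub : ∀ V : Team A, V ⊆ U →
        RepresentsTeam v V (c.filter fun g => decide (∃ s ∈ V, Codes v g s)) := by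
      intro V hV
      constructor
      · intro s hs
        obtain ⟨g, hg, hgs⟩ := hU.exists_code s (hV hs)
        exact ⟨g, List.mem_filter.2 ⟨hg, decide_eq_true ⟨s, hs, hgs⟩⟩, hgs⟩
      · intro g hg
        exact of_decide_eq_true (List.mem_filter.1 hg).2
    -- A guessed list represents the subteam of all assignments that have some code in it.
    have hsub' : ∀ c' : TeamCode, (∀ g ∈ c', g ∈ c) →
        RepresentsTeam v {s ∈ U | ∃ g ∈ c', Codes v g s} c' := by
      intro c' hc'
      constructor
      · rintro s ⟨-, h⟩
        exact h
      · intro g hg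
        obtain ⟨s, hs, hgs⟩ := hU.exists_assignment g (hc' g hg)
        exact ⟨s, ⟨hs, g, hg, hgs⟩, hgs⟩
    constructor
    · rintro ⟨U₀, U₁, rfl, h0, h1⟩
      have r0 := hsub U₀ Set.subset_union_left
      have r1 := hsub U₁ Set.subset_union_right
      refine ⟨⟨_, _⟩, ⟨fun g hg => ?_, fun g hg => (List.mem_filter.1 hg).1,
        fun g hg => (List.mem_filter.1 hg).1⟩, (h _ _ _ _ _ _ _ hI r0).1 h0,
        (h' _ _ _ _ _ _ _ hI r1).1 h1⟩
      obtain ⟨s, hs | hs, hgs⟩ := hU.exists_assignment g hg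
      · exact Or.inl (List.mem_filter.2 ⟨hg, decide_eq_true ⟨s, hs, hgs⟩⟩)
      · exact Or.inr (List.mem_filter.2 ⟨hg, decide_eq_true ⟨s, hs, hgs⟩⟩)
    · rintro ⟨⟨c₀, c₁⟩, ⟨h0, h1, h2⟩, h3, h4⟩
      refine ⟨{s ∈ U | ∃ g ∈ c₀, Codes v g s}, {s ∈ U | ∃ g ∈ c₁, Codes v g s}, ?_,
        (h _ _ _ _ _ _ _ hI (hsub' _ h1)).2 h3, (h' _ _ _ _ _ _ _ hI (hsub' _ h2)).2 h4⟩
      ext s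
      constructor
      · rintro (h | h) <;> exact h.1
      · intro hs
        obtain ⟨g, hg, hgs⟩ := hU.exists_code s hs
        rcases h0 g hg with h | h
        · exact Or.inl ⟨hs, g, h, hgs⟩
        · exact Or.inr ⟨hs, g, h, hgs⟩

theorem describes_all {φ : DStar L} (hφ : ∃ P, SigmaOne P ∧ Describes.{u, v, w} idx φ P) (x : ℕ) :
    ∃ P, SigmaOne P ∧ Describes.{u, v, w} idx (.all x φ) P := by
  obtain ⟨P, hP, h⟩ := hφ
  refine ⟨fun d => P (d.1, d.2.1, spread d.2.2 0 d.1 x), hP.comp (Primrec.pair Primrec.fst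
    (Primrec.pair primrec_codeT (primrec_spread x primrec_codeU (Primrec.const 0) Primrec.fst))),
    fun A I v n T U c hI hU => h _ _ _ _ _ _ _ hI (hU.modify_univ hI.lt_iff x)⟩

theorem describes_ix {φ : DStar L} (hφ : ∃ P, SigmaOne P ∧ Describes.{u, v, w} idx φ P) (x : ℕ) :
    ∃ P, SigmaOne P ∧ Describes.{u, v, w} idx (.ix x φ) P := by
  obtain ⟨P, hP, h⟩ := hφ
  refine ⟨fun d => ∃ m : ℕ, P (d.1 + (m + 1), d.2.1, spread d.2.2 d.1 (m + 1) x),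
    SigmaOne.ex (hP.comp (Primrec.pair ?_ (Primrec.pair (primrec_codeT.comp Primrec.fst)
      (primrec_spread x (primrec_codeU.comp Primrec.fst) (Primrec.fst.comp Primrec.fst)
        (Primrec.succ.comp Primrec.snd))))),
    fun A I v n T U c hI hU => exists_congr fun m =>
      h _ _ _ _ _ _ _ (hI.bloat m) (hU.bloat m x)⟩
  exact Primrec.nat_add.comp (Primrec.fst.comp Primrec.fst) (Primrec.succ.comp Primrec.snd)

-- The code of the modified team is guessed: it contains only extensions of listed assignments, and
-- at least one extension of each.
open Classical in
theorem describes_ex {φ : DStar L} (hφ : ∃ P, SigmaOne P ∧ Describes.{u, v, w} idx φ P) (x : ℕ) :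
    ∃ P, SigmaOne P ∧ Describes.{u, v, w} idx (.ex x φ) P := by
  obtain ⟨P, hP, h⟩ := hφ
  refine ⟨fun d => ∃ c' : TeamCode, ((∀ g ∈ d.2.2, ∃ a ∈ List.range d.1, (x, a) :: g ∈ c') ∧
    (∀ h ∈ c', h ∈ spread d.2.2 0 d.1 x)) ∧ P (d.1, d.2.1, c'), ?_, ?_⟩
  · have hn := (Primrec.fst (α := ℕ) (β := TableCode × TeamCode)).comp (Primrec.fst (β := TeamCode))
    have ht := primrec_codeT.comp (Primrec.fst (β := TeamCode))
    have hd := primrec_codeU.comp (Primrec.fst (β := TeamCode))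
    refine SigmaOne.ex (SigmaOne.and (PrimrecPred.sigmaOne (PrimrecPred.and ?_ ?_)) (hP.comp ?_))
    · refine primrecPred_forall_mem hd (primrecPred_exists_mem
        (Primrec.list_range.comp (hn.comp Primrec.fst)) (primrecPred_mem ?_
          (Primrec.snd.comp (Primrec.fst.comp Primrec.fst))))
      exact Primrec.list_cons.comp (Primrec.pair (Primrec.const x) Primrec.snd)
        (Primrec.snd.comp Primrec.fst)
    · refine primrecPred_forall_mem Primrec.snd (primrecPred_mem Primrec.snd
        (primrec_spread x (hd.comp Primrec.fst) (Primrec.const 0) (hn.comp Primrec.fst)))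
    · exact Primrec.pair hn (Primrec.pair ht Primrec.snd)
  · intro A I v n T U c hI hU
    constructor
    · rintro ⟨f, hf, hsat⟩
      have hr : RepresentsTeam v (U.modify f x) ((spread c 0 n x).filter fun h =>
          decide (∃ t ∈ U.modify f x, Codes v h t)) := by
        constructor
        · rintro _ ⟨s, hs, a, ha, rfl⟩
          obtain ⟨g, hg, hgs⟩ := hU.exists_code s hs
          refine ⟨(x, v a) :: g, List.mem_filter.2 ⟨mem_spread.2 ⟨g, hg, v a,
            (hI.lt_iff _).2 ⟨a, rfl⟩, by rw [zero_add]⟩, decide_eq_true ?_⟩, hgs.cons a x⟩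
          exact ⟨_, ⟨s, hs, a, ha, rfl⟩, hgs.cons a x⟩
        · intro g hg
          exact of_decide_eq_true (List.mem_filter.1 hg).2
      refine ⟨_, ⟨fun g hg => ?_, fun h hh => (List.mem_filter.1 hh).1⟩,
        (h _ _ _ _ _ _ _ hI hr).1 hsat⟩
      obtain ⟨s, hs, hgs⟩ := hU.exists_assignment g hg
      obtain ⟨a, ha⟩ := hf s hs
      have hlt := (hI.lt_iff _).2 ⟨a, rfl⟩
      refine ⟨v a, List.mem_range.2 hlt, List.mem_filter.2 ⟨mem_spread.2 ⟨g, hg, v a,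
        hlt, by rw [zero_add]⟩, decide_eq_true ?_⟩⟩
      exact ⟨_, ⟨s, hs, a, ha, rfl⟩, hgs.cons a x⟩
    · rintro ⟨c', ⟨h1, h2⟩, h3⟩
      -- The choice function allows exactly those values whose resulting assignment has a code in
      -- the guessed list.
      refine ⟨fun s => {a | ∃ h ∈ c', Codes v h (s.set a x)}, fun s hs => ?_, ?_⟩
      · obtain ⟨g, hg, hgs⟩ := hU.exists_code s hs
        obtain ⟨m, hm, hmem⟩ := h1 g hg
        obtain ⟨a, rfl⟩ := (hI.lt_iff m).1 (List.mem_range.1 hm)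
        exact ⟨a, _, hmem, hgs.cons a x⟩
      · refine (h _ _ _ _ _ _ _ hI ⟨?_, fun g' hg' => ?_⟩).2 h3
        · rintro _ ⟨s, hs, a, ha, rfl⟩
          exact ha
        · obtain ⟨g, hg, m, hm, rfl⟩ := mem_spread.1 (h2 g' hg')
          obtain ⟨a, rfl⟩ := (hI.lt_iff m).1 hm
          obtain ⟨s, hs, hgs⟩ := hU.exists_assignment g hg
          rw [zero_add] at hg' ⊢
          exact ⟨_, ⟨s, hs, a, ⟨_, hg', hgs.cons a x⟩, rfl⟩, hgs.cons a x⟩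

theorem exists_describes (φ : DStar L) : ∃ P, SigmaOne P ∧ Describes.{u, v, w} idx φ P := by
  induction φ with
  | eq x y => exact describes_eq x y
  | neq x y => exact describes_neq x y
  | rel R x => exact describes_rel R x
  | nrel R x => exact describes_nrel R x
  | dep x => exact describes_dep x
  | incl x y => exact describes_incl x y
  | excl x y => exact describes_excl x y
  | indep x z y => exact describes_indep x z y
  | and φ ψ ihf ihg => exact describes_and ihf ihg
  | or φ ψ ihf ihg => exact describes_or ihf ihg
  | all x φ ih => exact describes_all ih x
  | ex x φ ih => exact describes_ex ih x
  | ix x φ ih => exact describes_ix ih x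

end


/-! ### Encodings -/

/-- All `k`-tuples of numbers below `n` in lexicographic order. -/
def tuples (n : ℕ) : ℕ → List (List ℕ)
  | 0 => [ [] ]
  | k + 1 => (List.range n).flatMap fun a => (tuples n k).map (a :: ·)

theorem map_lexTuples (n k : ℕ) :
    (lexTuples n k).map (fun t => List.ofFn fun i => (t i : ℕ)) = tuples n k := by
  induction k with
  | zero => simp [lexTuples, tuples]
  | succ k ih =>
    simp only [lexTuples, tuples, ← ih, List.map_flatMap, List.map_map]
    have : List.range n = (List.finRange n).map Fin.val := by simp
    rw [this, List.flatMap_map]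
    congr 1
    funext a
    refine List.map_congr_left fun t _ => ?_
    simp [List.ofFn_succ]

theorem mem_lexTuples {n k : ℕ} (t : Fin k → Fin n) : t ∈ lexTuples n k := by
  induction k with
  | zero =>
    rw [lexTuples, List.mem_singleton]
    exact Subsingleton.elim _ _
  | succ k ih =>
    rw [lexTuples, List.mem_flatMap]
    exact ⟨t 0, List.mem_finRange _, List.mem_map.2 ⟨Fin.tail t, ih _, Fin.cons_self_tail t⟩⟩

theorem primrec_tuples : Primrec₂ tuples := by
  have : Primrec₂ fun n k : ℕ => (Nat.rec [ [] ] (fun _ l => (List.range n).flatMap fun a =>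
      l.map (a :: ·)) k : List (List ℕ)) := by
    refine Primrec.nat_rec (Primrec.const [ [] ]) (g := fun n (q : ℕ × List (List ℕ)) =>
      (List.range n).flatMap fun a => q.2.map (a :: ·)) ?_
    refine Primrec.list_flatMap (Primrec.list_range.comp Primrec.fst) ?_
    refine Primrec.list_map (Primrec.snd.comp (Primrec.snd.comp Primrec.fst)) ?_
    exact Primrec.list_cons.comp (Primrec.snd.comp Primrec.fst) Primrec.snd
  refine this.of_eq fun n k => ?_
  induction k with
  | zero => rfl
  | succ k ih =>
    rw [tuples, ← ih]

/-- The encoding of the model of size `n` with code `T`, for the arities `ar`. -/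
def encodeTable {p : ℕ} (ar : Fin p → ℕ) (n : ℕ) (T : TableCode) : List Bool :=
  List.replicate n false ++ [true] ++
    (List.finRange p).flatMap fun i => (tuples n (ar i)).map fun t => decide (((i : ℕ), t) ∈ T)

theorem primrec_encodeTable {p : ℕ} (ar : Fin p → ℕ) : Primrec₂ (encodeTable ar) := by
  refine Primrec.list_append.comp (Primrec.list_append.comp ?_ (Primrec.const [true])) ?_
  · have : Primrec fun q : ℕ × TableCode => (List.range q.1).map fun _ => false :=
      Primrec.list_map (Primrec.list_range.comp Primrec.fst) (Primrec.const false).to₂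
    exact this.of_eq fun q => by simp
  · refine Primrec.list_flatMap (Primrec.const _) ?_
    refine Primrec.list_map (primrec_tuples.comp (Primrec.fst.comp Primrec.fst)
      ((Primrec.dom_finite ar).comp Primrec.snd)) ?_
    have : PrimrecPred fun q : ((ℕ × TableCode) × Fin p) × List ℕ =>
        ((q.1.2 : ℕ), q.2) ∈ q.1.1.2 :=
      primrecPred_mem (Primrec.pair (Primrec.fin_val.comp (Primrec.snd.comp Primrec.fst))
        Primrec.snd) (Primrec.snd.comp (Primrec.fst.comp Primrec.fst))
    exact this.decide

/-! ### Tables, encodings and isomorphism -/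

section
variable {L : FirstOrder.Language.{u, v}} {p : ℕ} (e : Fin p ≃ Σ k, L.Relations k) {A : Type w}

/-- The position of a relation symbol. -/
def symbolIndex {k : ℕ} (R : L.Relations k) : ℕ := e.symm ⟨k, R⟩

/-- The table `T` describes the relations with respect to the enumeration `o`. -/
def Agrees (I : L.Structure A) {n : ℕ} (o : Fin n ≃ A) (T : TableCode) : Prop :=
  ∀ (q : Σ k, L.Relations k) (a : Fin q.1 → A),
    I.RelMap q.2 a ↔ (symbolIndex e q.2, List.ofFn fun i => (o.symm (a i) : ℕ)) ∈ T

variable {e}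

/-- This trades the noncomputable `encoding` for a primitive recursive function of the size and the
table. -/
theorem Agrees.encoding_eq {I : L.Structure A} {n : ℕ} {o : Fin n ≃ A} {T : TableCode}
    (h : Agrees e I o T) : encoding e I o = encodeTable (fun i => (e i).1) n T := by
  classical
  rw [encoding, encodeTable]
  congr 1
  congr 1
  funext i
  rw [← map_lexTuples, List.map_map]
  refine List.map_congr_left fun t _ => ?_
  have := h (e i) (o ∘ t)
  simp only [symbolIndex, Sigma.eta, Equiv.symm_apply_apply, Function.comp_apply] at this
  simp only [Function.comp_apply, decide_eq_decide]
  exact this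

theorem exists_agrees (I : L.Structure A) {n : ℕ} (o : Fin n ≃ A) :
    ∃ T, Agrees e I o T ∧ ∀ r ∈ T, ∀ x ∈ r.2, x < n := by
  classical
  have : Finite A := Finite.of_equiv _ o
  let f : {z : Σ i : Fin p, Fin (e i).1 → A // I.RelMap (e z.1).2 z.2} → ℕ × List ℕ := fun z =>
    (z.1.1, List.ofFn fun i => (o.symm (z.1.2 i) : ℕ))
  refine ⟨(Set.finite_range f).toFinset.toList, ?_, ?_⟩
  · intro q a
    obtain ⟨i, rfl⟩ := e.surjective q
    simp only [Finset.mem_toList, Set.Finite.mem_toFinset, Set.mem_range, symbolIndex, Sigma.eta,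
      Equiv.symm_apply_apply]
    constructor
    · intro h
      exact ⟨⟨⟨i, a⟩, h⟩, rfl⟩
    · rintro ⟨⟨⟨j, b⟩, hb⟩, h⟩
      simp only [f, Prod.mk.injEq] at h
      obtain ⟨h1, h2⟩ := h
      obtain rfl := Fin.ext h1
      have : b = a := by
        have := List.ofFn_injective h2
        funext l
        exact o.symm.injective (Fin.ext (congrFun this l))
      rwa [← this]
  · intro r hr x hx
    simp only [Finset.mem_toList, Set.Finite.mem_toFinset, Set.mem_range] at hr
    obtain ⟨z, rfl⟩ := hr
    obtain ⟨i, rfl⟩ := (List.mem_ofFn' _ _).1 hx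
    exact (o.symm _).2

theorem Agrees.represents {I : L.Structure A} {n : ℕ} {o : Fin n ≃ A} {T : TableCode}
    (h : Agrees e I o T) (hT : ∀ r ∈ T, ∀ x ∈ r.2, x < n) :
    Represents (symbolIndex e) I (fun a => (o.symm a : ℕ)) n T where
  inj := Fin.val_injective.comp o.symm.injective
  lt_iff := fun m => ⟨fun hm => ⟨o ⟨m, hm⟩, by simp⟩, fun ⟨a, ha⟩ => ha ▸ (o.symm a).2⟩
  rel := fun {k} R a => h ⟨k, R⟩ a
  bdd := hT

theorem representsTeam_empty (v : A → ℕ) : RepresentsTeam v {emptyAssignment A} [ [] ] where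
  exists_code := by
    rintro _ rfl
    exact ⟨[], List.mem_singleton_self _, fun x => rfl⟩
  exists_assignment := by
    intro g hg
    obtain rfl := List.mem_singleton.1 hg
    exact ⟨_, rfl, fun x => rfl⟩

/-- Blocks of known lengths can be recovered from their concatenation. -/
theorem flatMap_inj_of_length {α β : Type*} {f g : α → List β} {l : List α}
    (hlen : ∀ a ∈ l, (f a).length = (g a).length) (h : l.flatMap f = l.flatMap g) :
    ∀ a ∈ l, f a = g a := by
  induction l with
  | nil => simp
  | cons b l ih =>
    simp only [List.flatMap_cons, List.mem_cons, forall_eq_or_imp] at h hlen ⊢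
    obtain ⟨h1, h2⟩ := List.append_inj h hlen.1
    exact ⟨h1, ih hlen.2 h2⟩

/-- The first `true` marks the end of the unary size. -/
theorem replicate_append_inj {n m : ℕ} {x y : List Bool}
    (h : List.replicate n false ++ [true] ++ x = List.replicate m false ++ [true] ++ y) :
    n = m ∧ x = y := by
  induction n generalizing m with
  | zero =>
    cases m with
    | zero => simpa using h
    | succ m => simp [List.replicate_succ] at h
  | succ n ih =>
    cases m with
    | zero => simp [List.replicate_succ] at h
    | succ m =>
      have := ih (m := m) (by simpa [List.replicate_succ] using h)
      exact ⟨congrArg _ this.1, this.2⟩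

/-- Models with the same encoding are isomorphic. -/
theorem iso_of_encoding_eq [L.IsRelational] {M N : FinModel.{u, v, w} L} {n m : ℕ}
    {o : Fin n ≃ M.carrier} {o' : Fin m ≃ N.carrier}
    (h : encoding e M.str o = encoding e N.str o') : M.Iso N := by
  classical
  obtain ⟨rfl, h⟩ := replicate_append_inj h
  have h := flatMap_inj_of_length (fun i _ => by simp) h
  let := M.str
  let := N.str
  refine ⟨(⟨o.symm.trans o', fun f => isEmptyElim f, fun {k} R a => ?_⟩ :
    M.carrier ≃[L] N.carrier)⟩
  have h := h (e.symm ⟨k, R⟩) (List.mem_finRange _)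
  rw [Equiv.apply_symm_apply] at h
  -- The bit at the positions of `a` decides the relation in both models.
  have h := List.map_inj_left.1 h (o.symm ∘ a) (mem_lexTuples _)
  rw [decide_eq_decide] at h
  have ha : o ∘ o.symm ∘ a = a := by
    funext i
    simp
  rw [ha] at h
  exact h.symm

theorem exists_equiv_fin (M : FinModel.{u, v, w} L) : ∃ n, Nonempty (Fin n ≃ M.carrier) := by
  have := M.fin
  exact ⟨Nat.card M.carrier, ⟨(Finite.equivFin _).symm⟩⟩

theorem Agrees.of_equiv {B : Type w} {I : L.Structure A} {J : L.Structure B} {n : ℕ} {o : Fin n ≃ A}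
    {T : TableCode} (h : Agrees e I o T) (f : A ≃[L] B) : Agrees e J (o.trans f.toEquiv) T := by
  intro q b
  have h1 := f.map_rel' q.2 (f.toEquiv.symm ∘ b)
  have h2 : f.toFun ∘ f.toEquiv.symm ∘ b = b := by
    funext i
    exact f.toEquiv.apply_symm_apply _
  rw [h2] at h1
  rw [h1, h q]
  rfl

end

/-! ### The main theorem -/

section
variable {L : FirstOrder.Language.{u, v}} [L.IsRelational] {p : ℕ}
  (e : Fin p ≃ Σ k, L.Relations k)

/-- The model of size `n` with code `T`. -/
def tableModel (n : ℕ) (hn : 0 < n) (T : TableCode) : FinModel.{u, v, w} L where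
  carrier := ULift.{w} (Fin n)
  str :=
    { funMap := fun {_} f _ => isEmptyElim f
      RelMap := fun {_} R a => (symbolIndex e R, List.ofFn fun i => ((a i).down : ℕ)) ∈ T }
  fin := inferInstance
  nonempty := ⟨⟨⟨0, hn⟩⟩⟩

/-- A size and a table are guessed that produce the given string. Positivity of the size and bounded
entries guarantee that the guess comes from an actual model. -/
theorem DStar.recEnum (φ : DStar L) : RecEnum e {M : FinModel.{u, v, w} L | φ.Holds M} := by
  obtain ⟨P, hP, h⟩ := exists_describes.{u, v, w} (idx := symbolIndex e) φ
  have hs : SigmaOne fun b : List Bool => ∃ d : ℕ × TableCode,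
      (b = encodeTable (fun i => (e i).1) d.1 d.2 ∧ 0 < d.1 ∧ ∀ r ∈ d.2, ∀ x ∈ r.2, x < d.1) ∧
        P (d.1, d.2, [ [] ]) := by
    have h1 : Primrec fun q : List Bool × ℕ × TableCode => q.2.1 := Primrec.fst.comp Primrec.snd
    have h2 : Primrec fun q : List Bool × ℕ × TableCode => q.2.2 := Primrec.snd.comp Primrec.snd
    refine SigmaOne.ex (SigmaOne.and (PrimrecPred.sigmaOne (PrimrecPred.and ?_ (PrimrecPred.and
      ?_ ?_))) (hP.comp ?_))
    · exact Primrec.eq.comp Primrec.fst ((primrec_encodeTable _).comp h1 h2)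
    · exact Primrec.nat_lt.comp (Primrec.const 0) h1
    · exact primrecPred_forall_mem h2 (primrecPred_forall_mem (Primrec.snd.comp Primrec.snd)
        (Primrec.nat_lt.comp Primrec.snd (h1.comp (Primrec.fst.comp Primrec.fst))))
    · exact Primrec.pair h1 (Primrec.pair h2 (Primrec.const _))
  refine hs.rePred.of_eq fun b => ?_
  constructor
  · rintro ⟨⟨n, T⟩, ⟨rfl, hn, hT⟩, hPT⟩
    have ha : Agrees e (tableModel.{u, v, w} e n hn T).str (Equiv.ulift.symm : Fin n ≃ ULift.{w} (Fin n)) T :=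
      fun q a => Iff.rfl
    refine ⟨tableModel.{u, v, w} e n hn T, ?_, n, (Equiv.ulift.symm : Fin n ≃ ULift.{w} (Fin n)),
      ha.encoding_eq.symm⟩
    exact (h _ _ _ _ _ _ _ (ha.represents hT) (representsTeam_empty _)).2 hPT
  · rintro ⟨M, hM, n, o, rfl⟩
    obtain ⟨T, ha, hT⟩ := exists_agrees (e := e) M.str o
    obtain ⟨a⟩ := M.nonempty
    exact ⟨⟨n, T⟩, ⟨ha.encoding_eq, (Nat.zero_le _).trans_lt (o.symm a).2, hT⟩,
      (h _ _ _ _ _ _ _ (ha.represents hT) (representsTeam_empty _)).1 hM⟩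

/-- Isomorphic models share a size and a table, and satisfaction is determined by these. -/
theorem DStar.isoClosed (e : Fin p ≃ Σ k, L.Relations k) (φ : DStar L) : IsoClosed {M : FinModel.{u, v, w} L | φ.Holds M} := by
  intro M N hMN hM
  obtain ⟨f⟩ := hMN
  obtain ⟨P, -, h⟩ := exists_describes.{u, v, w} (idx := symbolIndex e) φ
  obtain ⟨n, ⟨o⟩⟩ := exists_equiv_fin M
  obtain ⟨T, ha, hT⟩ := exists_agrees (e := e) M.str o
  have hb := ha.of_equiv (J := N.str) f
  exact (h _ _ _ _ _ _ _ (hb.represents hT) (representsTeam_empty _)).2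
    ((h _ _ _ _ _ _ _ (ha.represents hT) (representsTeam_empty _)).1 hM)

open Classical in
/-- Every recursively enumerable class that is closed under isomorphism is definable. -/
theorem exists_defines {C : Set (FinModel.{u, v, w} L)} (hC : IsoClosed C) (hre : RecEnum e C) :
    ∃ φ : QF L, ∀ M : FinModel.{u, v, w} L, φ.Defines M.str ↔ M ∈ C := by
  obtain ⟨R, hR, h⟩ := REPred.sigmaOne hre
  have hdec : Primrec fun t : ℕ => ((Encodable.decode t : Option TableCode).getD default) :=
    Primrec.option_getD_default.comp Primrec.decode
  -- Zero stands for acceptance, and likewise for membership in `bit`, matching the tests for zero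
  -- in the axioms. Undecodable codes are read as the default table.
  let acc : List.Vector ℕ 3 → ℕ := fun v =>
    if R (encodeTable (fun i => (e i).1) (v.get 0)
      ((Encodable.decode (v.get 1) : Option TableCode).getD default)) (v.get 2) then 0 else 1
  have hacc : Primrec acc := by
    have hget : ∀ i, Primrec fun v : List.Vector ℕ 3 => v.get i := fun i =>
      Primrec.vector_get.comp Primrec.id (Primrec.const i)
    refine Primrec.ite (hR.comp ?_ (hget 2)) (Primrec.const 0) (Primrec.const 1)
    exact (primrec_encodeTable _).comp (hget 0) (hdec.comp (hget 1))
  let bit : ∀ q : Σ k, L.Relations k, List.Vector ℕ (q.1 + 1) → ℕ := fun q v =>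
    if (symbolIndex e q.2, v.tail.toList) ∈
      ((Encodable.decode v.head : Option TableCode).getD default) then 0 else 1
  have hbit : ∀ q, Primrec (bit q) := by
    intro q
    refine Primrec.ite (primrecPred_mem (Primrec.pair (Primrec.const _) ?_)
      (hdec.comp Primrec.vector_head)) (Primrec.const 0) (Primrec.const 1)
    exact Primrec.vector_toList.comp Primrec.vector_tail
  obtain ⟨cacc, hcacc⟩ := PR.exists_code (Nat.Primrec'.of_prim hacc)
  choose cbit hcbit using fun q => PR.exists_code (Nat.Primrec'.of_prim (hbit q))
  refine ⟨QF.axioms cacc ((List.finRange p).map e) cbit, fun M => ?_⟩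
  have := M.fin
  have hA : ∀ n t w, cacc.eval ![n, t, w] = 0 ↔ R (encodeTable (fun i => (e i).1) n
      ((Encodable.decode t : Option TableCode).getD default)) w := by
    intro n t w
    rw [hcacc]
    simp only [acc, List.Vector.get_ofFn]
    simp
  have hB : ∀ (n : ℕ) (o : Fin n ≃ M.carrier) (t : ℕ), (∀ q ∈ (List.finRange p).map e, ∀ a,
      M.str.RelMap q.2 a ↔ (cbit q).eval (Fin.cons t fun i => (o.symm (a i) : ℕ)) = 0) ↔
      Agrees e M.str o ((Encodable.decode t : Option TableCode).getD default) := by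
    intro n o t
    have hmem : ∀ q, q ∈ (List.finRange p).map e := fun q =>
      List.mem_map.2 ⟨e.symm q, List.mem_finRange _, e.apply_symm_apply q⟩
    simp only [hmem, true_imp_iff, Agrees, hcbit, bit, List.Vector.head_ofFn,
      List.Vector.tail_ofFn, List.Vector.toList_ofFn, Fin.cons_zero, Fin.cons_succ]
    simp
  rw [QF.defines_axioms]
  constructor
  · rintro ⟨n, o, t, w, h1, h2⟩
    rw [hA] at h1
    rw [hB] at h2
    rw [← h2.encoding_eq] at h1
    obtain ⟨N, hN, m, o', he⟩ := (h _).2 ⟨w, h1⟩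
    -- The accepted string is an encoding of some `N` in the class, not necessarily of `M` alone;
    -- this is where closure under isomorphism is used.
    exact hC N M (iso_of_encoding_eq he.symm) hN
  · intro hM
    obtain ⟨n, ⟨o⟩⟩ := exists_equiv_fin M
    obtain ⟨T, ha, -⟩ := exists_agrees (e := e) M.str o
    obtain ⟨w, hw⟩ := (h _).1 ⟨M, hM, n, o, rfl⟩
    refine ⟨n, o, Encodable.encode T, w, ?_, ?_⟩
    · rw [hA, Encodable.encodek, Option.getD_some, ← ha.encoding_eq]
      exact hw
    · rw [hB, Encodable.encodek, Option.getD_some]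
      exact ha

end

end TeamRE

theorem mainTheorem3 (L : FirstOrder.Language.{u, v}) [L.IsRelational] {p : ℕ}
    (e : Fin p ≃ Σ k, L.Relations k) :
    (∀ φ : TeamRE.DStar L, φ.IsSentence →
      TeamRE.RecEnum e {M : TeamRE.FinModel.{u, v, w} L | φ.Holds M} ∧
      ∃ χ : TeamRE.LRE L, ∀ M : TeamRE.FinModel.{u, v, w} L, φ.Holds M ↔ χ.Holds M) ∧
    (∀ C : Set (TeamRE.FinModel.{u, v, w} L),
      (TeamRE.IsoClosed C ∧ TeamRE.RecEnum e C) ↔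
        ∃ φ : TeamRE.DStar L, φ.IsSentence ∧
          ∀ M : TeamRE.FinModel.{u, v, w} L, M ∈ C ↔ φ.Holds M) := by
  refine ⟨fun φ _ => ⟨φ.recEnum e, ?_⟩, fun C => ⟨?_, ?_⟩⟩
  -- The sentence of `L_RE` is obtained from the enumerability of the models of `φ`, not from the
  -- syntax of `φ`.
  · obtain ⟨ψ, hψ⟩ := TeamRE.exists_defines e (TeamRE.DStar.isoClosed e φ) (φ.recEnum e)
    obtain ⟨χ, hχ⟩ := ψ.exists_lre
    exact ⟨χ, fun M => ((hχ M).trans (hψ M)).symm⟩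
  · rintro ⟨hC, hre⟩
    obtain ⟨ψ, hψ⟩ := TeamRE.exists_defines e hC hre
    obtain ⟨φ, hφ, h⟩ := ψ.exists_dstar
    exact ⟨φ, hφ, fun M => ((h M).trans (hψ M)).symm⟩
  · rintro ⟨φ, -, h⟩
    obtain rfl : C = {M : TeamRE.FinModel.{u, v, w} L | φ.Holds M} := Set.ext h
    exact ⟨TeamRE.DStar.isoClosed e φ, φ.recEnum e⟩
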